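/- Consider a single-server retrial queue with no waiting room, two customer classes $k=1,2$ and one orbit per class. Class-$k$ customers arrive from outside according to a Poisson process of rate $\lambda_k>0$. An arriving class-$k$ customer enters service at once if the server is idle, and otherwise joins orbit $k$. As long as orbit $k$ is non-empty, it makes retrial attempts at constant rate $\alpha_k>0$ (exponential retrial times, independent of the size of the orbit); an attempt that finds the server idle moves one customer from orbit $k$ into service, and an attempt that finds the server busy has no effect. Class-$k$ service times are i.i.d. with distribution function $F_k$ and mean $1/\mu_k$. Inputs, retrials and service times are independent. Let $X^{(k)}(t)$ be the size of orbit $k$ just before time $t$, and let $\mathbf X_n=(X^{(1)}_n,X^{(2)}_n)$ be the Markov chain of the orbit sizes just after the $n$-th departure. Put $\rho_k=\lambda_k/\mu_k$, $\hat\rho_k=\alpha_k/\mu_k$, $\rho=\rho_1+\rho_2$, $\hat\rho=\hat\rho_1+\hat\rho_2$. Assume that each $F_k$ belongs to the class $\mathcal D$ of non-negative absolutely continuous distributions whose failure rate $r(x)=f(x)/(1-F(x))$ ($f$ a density) is bounded away from zero on the set of $x\ge 0$ with $1-F(x)>0$. **Theorem 2.** (i) If $$\hat\rho_1>\rho_1(\rho+\hat\rho)\qquad\text{and}\qquad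 \rho>\frac{\hat\rho_2}{\rho_2+\hat\rho_2},\tag{$*$}$$ then, in the initially empty system, orbit 1 is tight (for every $\varepsilon>0$ there is $K$ with $P(X^{(1)}(t)>K)\le\varepsilon$ for all $t\ge 0$) and orbit 2 tends to infinity in probability ($P(X^{(2)}(t)\le K)\to 0$ as $t\to\infty$ for every $K$). Moreover, the Markov chain $(\mathbf X_n)$ is transient. (ii) Let $\mathsf M^{11}_k$ and $\mathsf M^{01}_k$ be the mean one-step increments of the $k$-th component of $(\mathbf X_n)$ from states with both orbits non-empty and from states with orbit 1 empty and orbit 2 non-empty, respectively (each depends on the region only). The conditions $(*)$ hold if and only if $$\mathsf M^{11}_1<0,\qquad \mathsf M^{11}_2\ge 0,\qquad \mathsf M^{11}_2\mathsf M^{01}_1-\mathsf M^{11}_1\mathsf M^{01}_2>0,$$ which is the transience case (c.2) of the classification of random walks in the quarter plane. -/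

import Mathlib

open MeasureTheory ProbabilityTheory Filter Topology

namespace Retrial

/-! ### Sample paths of the two-class constant retrial rate system

The classes are the elements of `Fin 2`: class `0` is "class 1" and class `1` is "class 2". -/

/-- The kinds of random variables that drive the system: interarrival times of the external
inputs, times between consecutive retrial attempts, and service times. -/
inductive Source where
  | arrival : Source
  | retrial : Source
  | service : Source

/-- The data of one sample path: for every kind and class a sequence of reals. -/
abbrev Path : Type := Source → Fin 2 → ℕ → ℝ

/-- Numbers of customers in the two orbits. -/
abbrev Orbits : Type := Fin 2 → ℕ

/-- The epochs `g 0, g 0 + g 1, …` of the point process with gaps `g`. -/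
def epoch (g : ℕ → ℝ) (m : ℕ) : ℝ := ∑ i ∈ Finset.range (m + 1), g i

/-- The first epoch strictly after time `t`. -/
noncomputable def nextEpoch (g : ℕ → ℝ) (t : ℝ) : ℝ := epoch g {m | epoch g m ≤ t}.ncard

section Cycle

/- A cycle begins at a time `d` at which the server is idle (a departure instant or time `0`),
with orbits `x`. It consists of an idle period followed by the service of one customer. -/

variable (u : Path) (d : ℝ) (x : Orbits)

/-- The first time after `d` at which a class-`k` customer tries to enter the server: the next
external class-`k` arrival, or, if orbit `k` is non-empty, the next retrial attempt from
orbit `k` if that is earlier. -/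
noncomputable def attemptTime (k : Fin 2) : ℝ :=
  if 0 < x k then
    min (nextEpoch (u .arrival k) d) (nextEpoch (u .retrial k) d)
  else nextEpoch (u .arrival k) d

/-- The time at which the idle period that begins at `d` ends. -/
noncomputable def startTime : ℝ := min (attemptTime u d x 0) (attemptTime u d x 1)

/-- The class of the customer that enters the server at `startTime`. -/
noncomputable def servedClass : Fin 2 :=
  if attemptTime u d x 0 ≤ attemptTime u d x 1 then 0 else 1

/-- The customer that enters the server at `startTime` comes from orbit `k`. -/
def FromOrbit (k : Fin 2) : Prop :=
  servedClass u d x = k ∧ 0 < x k ∧ nextEpoch (u .retrial k) d < nextEpoch (u .arrival k) d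

open Classical in
/-- Size of orbit `k` immediately after the service has started. -/
noncomputable def orbitAtStart (k : Fin 2) : ℕ := if FromOrbit u d x k then x k - 1 else x k

/-- The time at which the service started in cycle `n` ends. -/
noncomputable def endTime (n : ℕ) : ℝ :=
  startTime u d x + u .service (servedClass u d x) n

/-- Orbit sizes just after the departure that ends cycle `n`: external class-`k` arrivals during
the service have joined orbit `k`; retrial attempts during the service were void. -/
noncomputable def orbitsAtEnd (n : ℕ) : Orbits := fun k =>
  orbitAtStart u d x k +
    {m | startTime u d x < epoch (u .arrival k) m ∧
      epoch (u .arrival k) m ≤ endTime u d x n}.ncard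

end Cycle

/-- The `n`-th departure instant (`0` for `n = 0`) together with the orbit sizes just after it,
for the system that starts at time `0` with idle server and orbits `x₀`. -/
noncomputable def departure (u : Path) (x₀ : Orbits) : ℕ → ℝ × Orbits
  | 0 => (0, x₀)
  | n + 1 =>
    let s := departure u x₀ n
    (endTime u s.1 s.2 n, orbitsAtEnd u s.1 s.2 n)

/-- The `n`-th departure instant. -/
noncomputable def departureTime (u : Path) (x₀ : Orbits) (n : ℕ) : ℝ := (departure u x₀ n).1

/-- The chain embedded at departure instants. -/
noncomputable def embedded (u : Path) (x₀ : Orbits) (n : ℕ) : Orbits := (departure u x₀ n).2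

/-- The number of departures strictly before time `t`. -/
noncomputable def departuresBefore (u : Path) (x₀ : Orbits) (t : ℝ) : ℕ :=
  {n | departureTime u x₀ (n + 1) < t}.ncard

/-- The size of orbit `k` at the instant `t` (just before `t`). -/
noncomputable def orbit (u : Path) (x₀ : Orbits) (k : Fin 2) (t : ℝ) : ℕ :=
  let n := departuresBefore u x₀ t
  let d := departureTime u x₀ n
  let x := embedded u x₀ n
  if t ≤ startTime u d x then x k
  else orbitAtStart u d x k +
    {m | startTime u d x < epoch (u .arrival k) m ∧ epoch (u .arrival k) m < t}.ncard

/-! ### The probabilistic model -/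

/-- The law of the driving variables: external class-`k` arrivals form a Poisson process of rate
`lam k`, the retrial attempts from orbit `k` (effective only when orbit `k` is non-empty and the
server is idle) occur at rate `alpha k`, class-`k` service times have distribution `F k`. -/
noncomputable def sourceLaw (lam alpha : Fin 2 → ℝ) (F : Fin 2 → Measure ℝ) :
    Source → Fin 2 → Measure ℝ
  | .arrival, k => expMeasure (lam k)
  | .retrial, k => expMeasure (alpha k)
  | .service, k => F k

/-- The family `U` of random variables drives the system with arrival rates `lam`, retrial rates
`alpha` and service time distributions `F`: all variables are independent, with the laws above. -/
structure Drives {Ω : Type*} [MeasurableSpace Ω] (P : Measure Ω) (lam alpha : Fin 2 → ℝ)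
    (F : Fin 2 → Measure ℝ) (U : Source → Fin 2 → ℕ → Ω → ℝ) : Prop where
  measurable : ∀ a k n, Measurable (U a k n)
  law : ∀ a k n, P.map (U a k n) = sourceLaw lam alpha F a k
  indep : iIndepFun (fun i : Source × Fin 2 × ℕ => U i.1 i.2.1 i.2.2) P

/-- The sample path of the driving variables at `ω`. -/
def pathAt {Ω : Type*} (U : Source → Fin 2 → ℕ → Ω → ℝ) (ω : Ω) : Path := fun a k n => U a k n ω

/-- The failure rate `f x / (1 - F x)` of a distribution `F` with density `f`. -/
noncomputable def failureRate (F : Measure ℝ) (f : ℝ → ℝ) (x : ℝ) : ℝ := f x / (1 - cdf F x)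

/-- Class `𝒟`: non-negative absolutely continuous distributions whose failure rate is bounded
away from zero on the set of all `x ≥ 0` with `1 - F x > 0`. -/
structure ClassD (F : Measure ℝ) : Prop where
  prob : IsProbabilityMeasure F
  nonneg : F (Set.Iio 0) = 0
  rate : ∃ f : ℝ → ℝ, Measurable f ∧ (∀ x, 0 ≤ f x) ∧
    F = volume.withDensity (fun x => ENNReal.ofReal (f x)) ∧
    ∃ c > 0, ∀ x, 0 ≤ x → 0 < 1 - cdf F x → c ≤ failureRate F f x

/-- The service rate `μ = 1 / E S`. -/
noncomputable def serviceRate (F : Measure ℝ) : ℝ := 1 / ∫ s, s ∂F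

/-- The load coefficient `r / μ` of a stream of rate `r`: this is `ρ_k` for `r = λ_k` and `ρ̂_k`
for `r = α_k`. -/
noncomputable def load (r : ℝ) (F : Measure ℝ) : ℝ := r / serviceRate F

/-! ### The embedded Markov chain: mean drifts and transience -/

section Chain

variable {Ω : Type*} [MeasurableSpace Ω] (P : Measure Ω) (U : Source → Fin 2 → ℕ → Ω → ℝ)

/-- `m` is the mean increment of component `k` of the embedded chain in one step, conditionally
on the chain being at `x`, for every state `x` of `region`, every time and every initial state:
`E[X_{n+1} k - X_n k ; X_n = x] = m * P(X_n = x)`. -/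
def HasMeanDrift (region : Set Orbits) (k : Fin 2) (m : ℝ) : Prop :=
  ∀ (x₀ : Orbits) (n : ℕ), ∀ x ∈ region,
    IntegrableOn (fun ω => (embedded (pathAt U ω) x₀ (n + 1) k : ℝ) -
      (embedded (pathAt U ω) x₀ n k : ℝ)) {ω | embedded (pathAt U ω) x₀ n = x} P ∧
    ∫ ω in {ω | embedded (pathAt U ω) x₀ n = x},
      ((embedded (pathAt U ω) x₀ (n + 1) k : ℝ) - (embedded (pathAt U ω) x₀ n k : ℝ)) ∂P =
      m * P.real {ω | embedded (pathAt U ω) x₀ n = x}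

/-- Case (c.2) of the classification of random walks in the quarter plane, for the embedded chain:
with `M11 k` the mean drifts in the interior and `M01 k` those on the face where orbit 1 is empty
and orbit 2 is not, `M11_1 < 0`, `M11_2 ≥ 0` and `M11_2 * M01_1 - M11_1 * M01_2 > 0`. -/
def CaseC2 : Prop :=
  ∃ M11 M01 : Fin 2 → ℝ,
    (∀ k, HasMeanDrift P U {x | 0 < x 0 ∧ 0 < x 1} k (M11 k)) ∧
    (∀ k, HasMeanDrift P U {x | x 0 = 0 ∧ 0 < x 1} k (M01 k)) ∧
    M11 0 < 0 ∧ 0 ≤ M11 1 ∧ 0 < M11 1 * M01 0 - M11 0 * M01 1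

/-- The embedded chain is transient: from every initial state, the expected number of visits to
every state is finite. -/
def EmbeddedTransient : Prop :=
  ∀ x₀ y : Orbits, ∑' n : ℕ, P {ω | embedded (pathAt U ω) x₀ n = y} < ⊤

/-- Tightness of orbit `k` in the initially empty system. -/
def OrbitTight (k : Fin 2) : Prop :=
  ∀ ε : ℝ, 0 < ε → ∃ K : ℕ, ∀ t : ℝ, 0 ≤ t → P.real {ω | K < orbit (pathAt U ω) 0 k t} ≤ ε

/-- In the initially empty system, orbit `k` tends to infinity in probability as `t → ∞`. -/
def OrbitTendsToInfinity (k : Fin 2) : Prop :=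
  ∀ K : ℕ, Tendsto (fun t : ℝ => P.real {ω | orbit (pathAt U ω) 0 k t ≤ K}) atTop (𝓝 0)

end Chain

end Retrial

/-! At a departure the server is idle. Arrivals and retrials are Poisson, so what drives the future
is then independent of the past and distributed as at time zero (`lintegral_regeneration`,
`lintegral_run`). Departure instants and orbits therefore form a Markov chain whose increments
depend on the state only through the set of empty orbits. There are only four increment laws, so an
estimate proved state by state is automatically uniform. Class `ClassD` gives the services, hence
the increments, exponential moments (`ClassD.exists_lintegral_exp_lt_top`), and a variable `D` of
negative mean with such moments has `E exp(θ D) < 1` for small `θ > 0`. Everything is thus reduced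
to the signs of `drift`, which is explicit.

With indices as in `Fin 2`, the conditions have two consequences. Orbit `0` has negative drift
whenever it is non-empty (`drift_zero_neg`). For some `c > 0` the combination `c X₀ + X₁` has
positive drift in all four regions (`exists_weight`). The second fact makes `E exp(-θ (c X₀ + X₁))`
decay geometrically in the number of departures, and transience follows by summation, with no appeal
to the general classification of random walks in the quarter plane. Combined with the uniform
exponential moments of `X₀`, it also makes the probabilities of `X₁ ≤ L` summable over the
departures.

Passing to a fixed time `t` needs care, since the cycle containing `t` has a random index. For orbit
`0` all indices are summed, using the functional `exp(θ (X₀ + ε (D - t)))` with `D` the departure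
instant: it contracts while orbit `0` is non-empty, and the contribution of the states where it is
empty is controlled by a renewal bound uniform in `t` (`exists_tsum_discounted_le`,
`exists_tsum_exp_run_succ_le`). For orbit `1` the summable probabilities give a union bound over all
late departures (`tendsto_measure_orbit_one_le`).

Part (ii) is algebra: the determinant of the drifts factors, and the inequality `0 ≤ M11 1` is
implied by the conditions (`second_drift_numerator_pos`, `drift_conditions_iff`). -/

namespace Retrial

open scoped ENNReal

/-! ### Gap sequences -/

/-- Number of epochs up to time `t`. -/
noncomputable def count (g : ℕ → ℝ) (t : ℝ) : ℕ := {m | epoch g m ≤ t}.ncard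

/-- The gaps of the point process as seen from time `t`. -/
noncomputable def restart (g : ℕ → ℝ) (t : ℝ) : ℕ → ℝ
  | 0 => nextEpoch g t - t
  | m + 1 => g (count g t + (m + 1))

/-- Adds a gap in front. -/
def consGap (a : ℝ) (g : ℕ → ℝ) : ℕ → ℝ
  | 0 => a
  | m + 1 => g m

/-- Positive gaps with unbounded sums. -/
structure Regular (g : ℕ → ℝ) : Prop where
  pos : ∀ m, 0 < g m
  unbounded : ∀ t, ∃ m, t < epoch g m

lemma nextEpoch_eq (g : ℕ → ℝ) (t : ℝ) : nextEpoch g t = epoch g (count g t) := rfl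

lemma epoch_zero (g : ℕ → ℝ) : epoch g 0 = g 0 := by simp [epoch]

lemma epoch_succ (g : ℕ → ℝ) (m : ℕ) : epoch g (m + 1) = epoch g m + g (m + 1) := by
  simp [epoch, Finset.sum_range_succ]

lemma epoch_consGap_succ (a : ℝ) (g : ℕ → ℝ) (m : ℕ) :
    epoch (consGap a g) (m + 1) = a + epoch g m := by
  rw [epoch, Finset.sum_range_succ', add_comm]; rfl

namespace Regular

variable {g : ℕ → ℝ} (hg : Regular g)

include hg

lemma strictMono : StrictMono (epoch g) :=
  strictMono_nat_of_lt_succ fun m => by rw [epoch_succ]; linarith [hg.pos (m + 1)]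

lemma epoch_pos (m : ℕ) : 0 < epoch g m := Finset.sum_pos (fun i _ => hg.pos i) (by simp)

omit hg in
lemma count_eq_of {t : ℝ} {n : ℕ} (h : ∀ m, epoch g m ≤ t ↔ m < n) : count g t = n := by
  have : {m | epoch g m ≤ t} = (Finset.range n : Set ℕ) := by ext m; simp [h]
  rw [count, this, Set.ncard_coe_finset, Finset.card_range]

lemma epoch_le_iff (t : ℝ) (m : ℕ) : epoch g m ≤ t ↔ m < count g t := by
  classical
  have hex := hg.unbounded t
  have key : ∀ m, epoch g m ≤ t ↔ m < Nat.find hex := by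
    intro m
    rw [Nat.lt_find_iff]
    constructor
    · intro h k hk
      exact not_lt.2 ((hg.strictMono.monotone hk).trans h)
    · intro h; exact not_lt.1 (h m le_rfl)
  rw [count_eq_of key, key]

lemma lt_epoch_iff (t : ℝ) (m : ℕ) : t < epoch g m ↔ count g t ≤ m := by
  rw [← not_le, hg.epoch_le_iff, not_lt]

lemma lt_nextEpoch (t : ℝ) : t < nextEpoch g t := by
  rw [nextEpoch_eq, hg.lt_epoch_iff]

lemma count_eq_zero {t : ℝ} (h : t < g 0) : count g t = 0 := by
  rw [← epoch_zero g, hg.lt_epoch_iff] at h; omega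

lemma count_eq_zero_iff {t : ℝ} : count g t = 0 ↔ t < g 0 := by
  rw [← epoch_zero g, hg.lt_epoch_iff]; omega

lemma nextEpoch_zero : nextEpoch g 0 = g 0 := by
  rw [nextEpoch_eq, hg.count_eq_zero (hg.pos 0), epoch_zero]

lemma restart_zero : restart g 0 = g := by
  funext m
  cases m with
  | zero => simp [restart, hg.nextEpoch_zero]
  | succ m => simp [restart, hg.count_eq_zero (hg.pos 0)]

omit hg in
lemma epoch_restart (t : ℝ) (m : ℕ) : epoch (restart g t) m = epoch g (count g t + m) - t := by
  induction m with
  | zero => simp [epoch_zero, restart, nextEpoch_eq]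
  | succ m ih => rw [epoch_succ, ih, ← add_assoc, epoch_succ]; simp only [restart]; ring_nf

lemma restart (t : ℝ) : Regular (restart g t) where
  pos m := by
    cases m with
    | zero => simp only [Retrial.restart]; linarith [hg.lt_nextEpoch t]
    | succ m => exact hg.pos _
  unbounded s := by
    obtain ⟨m, hm⟩ := hg.unbounded (t + s)
    refine ⟨m, ?_⟩
    rw [epoch_restart]
    have := hg.strictMono.monotone (Nat.le_add_left m (count g t))
    linarith

lemma count_mono {s t : ℝ} (h : s ≤ t) : count g s ≤ count g t := by
  rw [← hg.lt_epoch_iff]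
  exact h.trans_lt (hg.lt_nextEpoch t)

lemma count_add {t s : ℝ} (hs : 0 ≤ s) :
    count g (t + s) = count g t + count (Retrial.restart g t) s := by
  have h1 := hg.count_mono (show t ≤ t + s by linarith)
  have : count (Retrial.restart g t) s = count g (t + s) - count g t := by
    refine count_eq_of fun m => ?_
    rw [epoch_restart, sub_le_iff_le_add, add_comm s t, hg.epoch_le_iff]; omega
  omega

lemma nextEpoch_restart {t s : ℝ} (hs : 0 ≤ s) :
    nextEpoch (Retrial.restart g t) s = nextEpoch g (t + s) - t := by
  rw [nextEpoch_eq, epoch_restart, ← hg.count_add hs, nextEpoch_eq]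

lemma restart_restart {t s : ℝ} (hs : 0 ≤ s) :
    Retrial.restart (Retrial.restart g t) s = Retrial.restart g (t + s) := by
  funext m
  cases m with
  | zero => simp only [Retrial.restart, hg.nextEpoch_restart hs]; ring
  | succ m =>
    rw [Retrial.restart, Retrial.restart, ← add_assoc, Retrial.restart, hg.count_add hs]
    ring_nf

lemma ncard_Ioc {s t : ℝ} (h : s ≤ t) :
    {m | s < epoch g m ∧ epoch g m ≤ t}.ncard = count (Retrial.restart g s) (t - s) := by
  have h1 := hg.count_add (t := s) (s := t - s) (by linarith)
  rw [show s + (t - s) = t by ring] at h1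
  have : {m | s < epoch g m ∧ epoch g m ≤ t} = (Finset.Ico (count g s) (count g t) : Set ℕ) := by
    ext m; simp [hg.epoch_le_iff, hg.lt_epoch_iff]
  rw [this, Set.ncard_coe_finset, Nat.card_Ico]; omega

lemma ncard_Ioo_le {s t t' : ℝ} (h : t ≤ t') :
    {m | s < epoch g m ∧ epoch g m < t}.ncard ≤ {m | s < epoch g m ∧ epoch g m ≤ t'}.ncard := by
  refine Set.ncard_le_ncard (fun m hm => ⟨hm.1, hm.2.le.trans h⟩) ?_
  exact (Finset.finite_toSet (Finset.range (count g t'))).subset fun m hm => by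
    simpa using (hg.epoch_le_iff _ _).1 hm.2

lemma consGap {a : ℝ} (ha : 0 < a) : Regular (consGap a g) where
  pos m := by cases m with
    | zero => exact ha
    | succ m => exact hg.pos m
  unbounded t := by
    obtain ⟨m, hm⟩ := hg.unbounded (t - a)
    exact ⟨m + 1, by rw [epoch_consGap_succ]; linarith⟩

lemma count_consGap_self {a : ℝ} (_ha : 0 < a) : count (Retrial.consGap a g) a = 1 := by
  refine count_eq_of fun m => ?_
  cases m with
  | zero => simp [epoch_zero, Retrial.consGap]
  | succ m => rw [epoch_consGap_succ]; simpa using hg.epoch_pos m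

lemma restart_consGap_self {a : ℝ} (ha : 0 < a) :
    Retrial.restart (Retrial.consGap a g) a = g := by
  funext m
  cases m with
  | zero =>
    simp [Retrial.restart, nextEpoch_eq, hg.count_consGap_self ha, epoch_consGap_succ, epoch_zero]
  | succ m => rw [Retrial.restart, hg.count_consGap_self ha, add_comm]; rfl

lemma count_consGap {a t : ℝ} (ha : 0 < a) (h : a ≤ t) :
    count (Retrial.consGap a g) t = count g (t - a) + 1 := by
  have := (hg.consGap ha).count_add (t := a) (s := t - a) (by linarith)
  rw [hg.count_consGap_self ha, hg.restart_consGap_self ha] at this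
  rw [add_comm, ← this]; ring_nf

lemma restart_consGap {a t : ℝ} (ha : 0 < a) (h : a ≤ t) :
    Retrial.restart (Retrial.consGap a g) t = Retrial.restart g (t - a) := by
  have := (hg.consGap ha).restart_restart (t := a) (s := t - a) (by linarith)
  rw [hg.restart_consGap_self ha] at this
  rw [this]; ring_nf

lemma restart_consGap_of_lt {a t : ℝ} (ha : 0 < a) (h : t < a) :
    Retrial.restart (Retrial.consGap a g) t = Retrial.consGap (a - t) g := by
  have h0 : count (Retrial.consGap a g) t = 0 := (hg.consGap ha).count_eq_zero h
  funext m
  cases m with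
  | zero => simp [Retrial.restart, nextEpoch_eq, h0, epoch_zero, Retrial.consGap]
  | succ m => rw [Retrial.restart, h0, zero_add]; rfl

end Regular

/-! ### Measurability of epochs, counts and restarted gap sequences. -/

lemma measurable_epoch (m : ℕ) : Measurable fun g : ℕ → ℝ => epoch g m := by
  unfold epoch; fun_prop

lemma measurable_ncard {α : Type*} [MeasurableSpace α] {Q : α → ℕ → Prop}
    (hQ : ∀ m, MeasurableSet {p | Q p m}) : Measurable fun p => {m | Q p m}.ncard := by
  classical
  -- The formula is also right for infinite sets: `toReal` sends `⊤` to zero, which is the value of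
  -- `ncard` there.
  have h : ∀ p, {m | Q p m}.ncard =
      ⌊(∑' m : ℕ, if Q p m then (1 : ENNReal) else 0).toReal⌋₊ := by
    intro p
    have h2 : (∑' m : ℕ, if Q p m then (1 : ENNReal) else 0) = ({m | Q p m}.encard : ENNReal) := by
      rw [← Measure.count_apply (MeasurableSet.of_discrete), ← lintegral_indicator_one
        (MeasurableSet.of_discrete), lintegral_count]
      simp [Set.indicator_apply]
    rw [h2]
    have h3 : (({m | Q p m}.encard : ENNReal)).toReal = ({m | Q p m}.ncard : ℝ) := by
      rw [Set.ncard_def]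
      cases h : {m | Q p m}.encard <;> simp
    rw [h3, Nat.floor_natCast]
  simp_rw [h]
  refine Nat.measurable_floor.comp (ENNReal.measurable_toReal.comp (Measurable.tsum ?_))
  intro m
  exact Measurable.ite (hQ m) measurable_const measurable_const

lemma measurable_count : Measurable fun p : (ℕ → ℝ) × ℝ => count p.1 p.2 :=
  measurable_ncard fun m =>
    measurableSet_le ((measurable_epoch m).comp measurable_fst) measurable_snd

lemma measurable_nextEpoch : Measurable fun p : (ℕ → ℝ) × ℝ => nextEpoch p.1 p.2 := by
  have h : Measurable fun q : ((ℕ → ℝ) × ℝ) × ℕ => epoch q.1.1 q.2 :=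
    measurable_from_prod_countable_left fun m => (measurable_epoch m).comp measurable_fst
  exact h.comp (measurable_id.prodMk measurable_count)

lemma measurable_restart : Measurable fun p : (ℕ → ℝ) × ℝ => restart p.1 p.2 := by
  refine measurable_pi_lambda _ fun m => ?_
  cases m with
  | zero => exact measurable_nextEpoch.sub measurable_snd
  | succ m =>
    have h : Measurable fun q : ((ℕ → ℝ) × ℝ) × ℕ => q.1.1 (q.2 + (m + 1)) :=
      measurable_from_prod_countable_left fun k =>
        (measurable_pi_apply (k + (m + 1))).comp measurable_fst
    exact h.comp (measurable_id.prodMk measurable_count)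

lemma measurable_consGap : Measurable fun p : ℝ × (ℕ → ℝ) => consGap p.1 p.2 := by
  refine measurable_pi_lambda _ fun m => ?_
  cases m with
  | zero => exact measurable_fst
  | succ m => exact (measurable_pi_apply m).comp measurable_snd

/-! ### Sequences of independent exponential gaps -/

/-- The law of an i.i.d. sequence. -/
noncomputable def iidLaw (ν : Measure ℝ) : Measure (ℕ → ℝ) :=
  Measure.infinitePi fun _ => ν

instance (ν : Measure ℝ) [IsProbabilityMeasure ν] : IsProbabilityMeasure (iidLaw ν) := by
  unfold iidLaw; infer_instance

/-- This is what permits conditioning on the first gap, the basis of the inductions over epochs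
below. -/
lemma map_consGap_iidLaw (ν : Measure ℝ) [IsProbabilityMeasure ν] :
    (ν.prod (iidLaw ν)).map (fun p => consGap p.1 p.2) = iidLaw ν := by
  refine Measure.eq_infinitePi _ fun s t ht => ?_
  classical
  obtain ⟨N, hN⟩ : ∃ N, s ⊆ Finset.range (N + 1) :=
    ⟨s.sup id, fun i hi => Finset.mem_range_succ_iff.2 (Finset.le_sup (f := id) hi)⟩
  set t' : ℕ → Set ℝ := fun i => if i ∈ s then t i else Set.univ with ht'
  have hmt : ∀ i, MeasurableSet (t' i) := fun i => by
    simp only [ht']; split_ifs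
    exacts [ht i, MeasurableSet.univ]
  have h1 : ∏ i ∈ s, ν (t i) = ∏ i ∈ Finset.range (N + 1), ν (t' i) := by
    rw [← Finset.prod_subset hN (f := fun i => ν (t' i)) fun i _ hi => by simp [ht', hi]]
    exact Finset.prod_congr rfl fun i hi => by simp [ht', hi]
  have h2 : (fun p : ℝ × (ℕ → ℝ) => consGap p.1 p.2) ⁻¹' ((s : Set ℕ).pi t) =
      t' 0 ×ˢ ((Finset.range N : Set ℕ).pi fun i => t' (i + 1)) := by
    ext ⟨a, g⟩
    simp only [Set.mem_preimage, Set.mem_pi, Finset.mem_coe, Set.mem_prod, Finset.mem_range]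
    constructor
    · intro h
      refine ⟨?_, fun i _ => ?_⟩
      · simp only [ht']; split_ifs with hi
        exacts [h 0 hi, trivial]
      · simp only [ht']; split_ifs with hi
        exacts [h (i + 1) hi, trivial]
    · rintro ⟨h0, h⟩ i hi
      cases i with
      | zero => simpa [ht', hi, consGap] using h0
      | succ i =>
        have := h i (by have := Finset.mem_range.1 (hN hi); omega)
        simpa [ht', hi, consGap] using this
  rw [Measure.map_apply measurable_consGap (MeasurableSet.pi s.countable_toSet fun i _ => ht i), h2,
    Measure.prod_prod, iidLaw, Measure.infinitePi_pi _ (fun i _ => hmt _), h1,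
    Finset.prod_range_succ', mul_comm]

lemma lintegral_iidLaw (ν : Measure ℝ) [IsProbabilityMeasure ν] {Φ : (ℕ → ℝ) → ℝ≥0∞}
    (hΦ : Measurable Φ) :
    ∫⁻ g, Φ g ∂iidLaw ν = ∫⁻ a, ∫⁻ g, Φ (consGap a g) ∂iidLaw ν ∂ν := by
  conv_lhs => rw [← map_consGap_iidLaw, lintegral_map hΦ measurable_consGap]
  exact lintegral_prod _ (hΦ.comp measurable_consGap).aemeasurable

lemma ae_iidLaw (ν : Measure ℝ) [IsProbabilityMeasure ν] {p : ℝ → Prop} (h : ∀ᵐ a ∂ν, p a) :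
    ∀ᵐ g ∂iidLaw ν, ∀ m, p (g m) :=
  ae_all_iff.2 fun m =>
    (measurePreserving_eval_infinitePi (fun _ : ℕ => ν) m).quasiMeasurePreserving.ae h

lemma lintegral_expMeasure {r : ℝ} {f : ℝ → ℝ≥0∞} (hf : Measurable f) :
    ∫⁻ a, f a ∂expMeasure r =
      ∫⁻ a in Set.Ioi 0, ENNReal.ofReal (r * Real.exp (-(r * a))) * f a := by
  have h : expMeasure r = volume.withDensity (exponentialPDF r) := rfl
  have hm : Measurable (exponentialPDF r) := (measurable_exponentialPDFReal r).ennreal_ofReal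
  rw [h, lintegral_withDensity_eq_lintegral_mul _ hm hf, ← lintegral_indicator measurableSet_Ioi]
  refine lintegral_congr_ae ?_
  filter_upwards [Measure.ae_ne volume (0 : ℝ)] with a ha
  simp only [Pi.mul_apply, Set.indicator_apply, Set.mem_Ioi, exponentialPDF_eq]
  rcases lt_or_gt_of_ne ha with h0 | h0
  · simp [h0.not_ge, h0.not_gt]
  · simp [h0.le, h0]

lemma ae_expMeasure_pos {r : ℝ} : ∀ᵐ a ∂expMeasure r, 0 < a := by
  have h := lintegral_expMeasure (r := r) (f := (Set.Iic (0 : ℝ)).indicator 1)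
    (measurable_one.indicator measurableSet_Iic)
  rw [lintegral_indicator_one measurableSet_Iic] at h
  rw [ae_iff]
  simp only [not_lt]
  change expMeasure r (Set.Iic 0) = 0
  rw [h]
  refine (setLIntegral_congr_fun measurableSet_Ioi fun a ha => ?_).trans lintegral_zero
  have : ¬ a ≤ 0 := not_le.2 ha
  simp [this]

lemma lintegral_exp_mul_expMeasure {r κ : ℝ} (hr : 0 < r) (hκ : κ < r) :
    ∫⁻ a, ENNReal.ofReal (Real.exp (κ * a)) ∂expMeasure r = ENNReal.ofReal (r / (r - κ)) := by
  have h0 : 0 < r - κ := by linarith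
  have hm : Measurable fun a : ℝ => ENNReal.ofReal (Real.exp (κ * a)) := by fun_prop
  have h1 := lintegral_expMeasure (r := r - κ) (f := 1) measurable_one
  have := isProbabilityMeasure_expMeasure h0
  simp only [Pi.one_apply, lintegral_one, measure_univ, mul_one] at h1
  rw [lintegral_expMeasure hm, ← mul_one (ENNReal.ofReal (r / (r - κ))), h1,
    ← lintegral_const_mul _ (by fun_prop)]
  refine lintegral_congr fun a => ?_
  rw [← ENNReal.ofReal_mul (by positivity), ← ENNReal.ofReal_mul (by positivity)]
  congr 1
  rw [mul_assoc, ← Real.exp_add, show -(r * a) + κ * a = -((r - κ) * a) by ring]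
  field_simp

lemma measurable_ofReal_exp_neg_epoch (m : ℕ) :
    Measurable fun g : ℕ → ℝ => ENNReal.ofReal (Real.exp (-epoch g m)) := by
  have := measurable_epoch m
  fun_prop

lemma lintegral_exp_neg_epoch {r : ℝ} (hr : 0 < r) (m : ℕ) :
    ∫⁻ g, ENNReal.ofReal (Real.exp (-epoch g m)) ∂iidLaw (expMeasure r) =
      ENNReal.ofReal (r / (r + 1)) ^ (m + 1) := by
  have := isProbabilityMeasure_expMeasure hr
  have h1 := lintegral_exp_mul_expMeasure hr (show (-1 : ℝ) < r by linarith)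
  rw [sub_neg_eq_add] at h1
  simp only [neg_mul, one_mul] at h1
  induction m with
  | zero =>
    rw [lintegral_iidLaw _ (measurable_ofReal_exp_neg_epoch 0)]
    simp [epoch_zero, consGap, h1]
  | succ m ih =>
    rw [lintegral_iidLaw _ (measurable_ofReal_exp_neg_epoch (m + 1))]
    simp_rw [epoch_consGap_succ, neg_add, Real.exp_add, ENNReal.ofReal_mul (Real.exp_pos _).le]
    simp_rw [lintegral_const_mul _ (measurable_ofReal_exp_neg_epoch m), ih]
    rw [lintegral_mul_const _ (by fun_prop), h1, pow_succ' _ (m + 1)]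

/-- The sum of `exp (-epoch g m)` over `m` has a geometric series as its mean, so it is almost
surely finite. Its terms then tend to zero, which forces the epochs to be unbounded. -/
lemma ae_regular {r : ℝ} (hr : 0 < r) : ∀ᵐ g ∂iidLaw (expMeasure r), Regular g := by
  have := isProbabilityMeasure_expMeasure hr
  have hpos := ae_iidLaw (expMeasure r) ae_expMeasure_pos
  have hq : ENNReal.ofReal (r / (r + 1)) < 1 := by
    rw [ENNReal.ofReal_lt_one, div_lt_one (by linarith)]; linarith
  have hsum : ∑' m, ∫⁻ g, ENNReal.ofReal (Real.exp (-epoch g m)) ∂iidLaw (expMeasure r) ≠ ⊤ := by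
    simp_rw [lintegral_exp_neg_epoch hr]
    have h1 : ∑' m : ℕ, ENNReal.ofReal (r / (r + 1)) ^ m ≠ ⊤ := by
      rw [ENNReal.tsum_geometric]
      exact ENNReal.inv_ne_top.2 (tsub_pos_of_lt hq).ne'
    refine ne_top_of_le_ne_top h1 ?_
    exact ENNReal.tsum_le_tsum fun m => pow_le_pow_of_le_one zero_le hq.le (Nat.le_succ m)
  rw [← lintegral_tsum fun m => (measurable_ofReal_exp_neg_epoch m).aemeasurable] at hsum
  have hfin := ae_lt_top' (Measurable.tsum fun m => measurable_ofReal_exp_neg_epoch m).aemeasurable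
    hsum
  filter_upwards [hpos, hfin] with g hg hs
  refine ⟨hg, fun t => ?_⟩
  have h0 := ENNReal.tendsto_atTop_zero_of_tsum_ne_top hs.ne
  have h2 : ∀ᶠ m in atTop, ENNReal.ofReal (Real.exp (-epoch g m)) < ENNReal.ofReal (Real.exp (-t)) :=
    h0.eventually_lt_const (by simpa using Real.exp_pos _)
  obtain ⟨m, hm⟩ := h2.exists
  refine ⟨m, ?_⟩
  rw [ENNReal.ofReal_lt_ofReal_iff (Real.exp_pos _), Real.exp_lt_exp] at hm
  linarith

/-! ### The Poisson process seen from a fixed time. -/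

lemma measurable_count_restart (t : ℝ) :
    Measurable fun g : ℕ → ℝ => (count g t, restart g t) := by
  have h : Measurable fun g : ℕ → ℝ => (g, t) := measurable_id.prodMk measurable_const
  have h1 := (measurable_count.prodMk measurable_restart).comp h
  simpa only [Function.comp_def] using h1

lemma setLIntegral_erlang {r t : ℝ} (hr : 0 < r) (ht : 0 ≤ t) (n : ℕ) :
    ∫⁻ a in Set.Ioc 0 t, ENNReal.ofReal (r * Real.exp (-(r * a))) *
        ENNReal.ofReal (Real.exp (-(r * (t - a))) * (r * (t - a)) ^ n / n.factorial) =
      ENNReal.ofReal (Real.exp (-(r * t)) * (r * t) ^ (n + 1) / (n + 1).factorial) := by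
  have h1 : ∀ a ∈ Set.Ioc 0 t, ENNReal.ofReal (r * Real.exp (-(r * a))) *
        ENNReal.ofReal (Real.exp (-(r * (t - a))) * (r * (t - a)) ^ n / n.factorial) =
      ENNReal.ofReal (Real.exp (-(r * t)) * r ^ (n + 1) / n.factorial * (t - a) ^ n) := by
    intro a _
    rw [← ENNReal.ofReal_mul (by positivity)]
    congr 1
    rw [show -(r * t) = -(r * a) + -(r * (t - a)) by ring, Real.exp_add, mul_pow, pow_succ]
    ring
  rw [setLIntegral_congr_fun measurableSet_Ioc h1, ← ofReal_integral_eq_lintegral_ofReal,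
    ← intervalIntegral.integral_of_le ht, intervalIntegral.integral_const_mul,
    intervalIntegral.integral_comp_sub_left (fun x => x ^ n), integral_pow]
  · congr 1
    rw [Nat.factorial_succ]
    push_cast
    field_simp
    ring
  · have : Continuous fun a : ℝ => Real.exp (-(r * t)) * r ^ (n + 1) / n.factorial * (t - a) ^ n := by
      fun_prop
    exact (this.integrableOn_Icc (a := 0) (b := t)).mono_set Set.Ioc_subset_Icc_self
  · refine (ae_restrict_iff' measurableSet_Ioc).2 (ae_of_all _ fun a ha => ?_)
    have : 0 ≤ t - a := by linarith [ha.2]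
    positivity

/-- Induction on `n` by conditioning on the first gap `a`. For `n = 0` the gap exceeds `t`, and
translating `a` by `t` in the exponential density is the memoryless property. For `n + 1` the gap
ends before `t` and the process after it has to place `n` epochs in the remaining time `t - a`;
integrating over `a` is the Erlang recursion `setIntegral`-style computation of
`setLIntegral_erlang`. -/
lemma lintegral_count_restart {r : ℝ} (hr : 0 < r) (n : ℕ) {t : ℝ} (ht : 0 ≤ t)
    {Φ : (ℕ → ℝ) → ℝ≥0∞} (hΦ : Measurable Φ) :
    ∫⁻ g, (if count g t = n then Φ (restart g t) else 0) ∂iidLaw (expMeasure r) =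
      ENNReal.ofReal (Real.exp (-(r * t)) * (r * t) ^ n / n.factorial) *
        ∫⁻ g, Φ g ∂iidLaw (expMeasure r) := by
  have := isProbabilityMeasure_expMeasure hr
  have hm : ∀ (n : ℕ) (t : ℝ), Measurable fun g => if count g t = n then Φ (restart g t) else 0 := by
    intro n t
    have h : Measurable fun p : ℕ × (ℕ → ℝ) => if p.1 = n then Φ p.2 else 0 :=
      Measurable.ite (measurable_fst (measurableSet_singleton n)) (hΦ.comp measurable_snd)
        measurable_const
    exact h.comp (measurable_count_restart t)
  have hH : Measurable fun a => ∫⁻ g, Φ (consGap a g) ∂iidLaw (expMeasure r) :=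
    (hΦ.comp measurable_consGap).lintegral_prod_right'
  rw [lintegral_iidLaw _ (hm n t)]
  induction n generalizing t with
  | zero =>
    have h1 : ∀ᵐ a ∂expMeasure r, ∫⁻ g, (if count (consGap a g) t = 0 then
          Φ (restart (consGap a g) t) else 0) ∂iidLaw (expMeasure r) =
        (Set.Ioi t).indicator (fun a => ∫⁻ g, Φ (consGap (a - t) g) ∂iidLaw (expMeasure r)) a := by
      filter_upwards [ae_expMeasure_pos] with a ha
      by_cases h : t < a
      · rw [Set.indicator_of_mem (by exact h)]
        refine lintegral_congr_ae ?_
        filter_upwards [ae_regular hr] with g hg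
        rw [if_pos ((hg.consGap ha).count_eq_zero h), hg.restart_consGap_of_lt ha h]
      · rw [Set.indicator_of_notMem (by exact h)]
        refine (lintegral_congr_ae ?_).trans lintegral_zero
        filter_upwards [ae_regular hr] with g hg
        refine if_neg ?_
        rw [hg.count_consGap ha (not_lt.1 h)]; omega
    have hH' : Measurable fun a => ∫⁻ g, Φ (consGap (a - t) g) ∂iidLaw (expMeasure r) :=
      hH.comp (measurable_id.sub_const t)
    rw [lintegral_congr_ae h1, lintegral_expMeasure (hH'.indicator measurableSet_Ioi),
      ← lintegral_indicator measurableSet_Ioi, ← lintegral_add_right_eq_self _ t,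
      lintegral_iidLaw _ hΦ, lintegral_expMeasure hH, ← lintegral_const_mul _ (by fun_prop),
      ← lintegral_indicator measurableSet_Ioi]
    refine lintegral_congr fun a => ?_
    by_cases h : 0 < a
    · rw [Set.indicator_of_mem (by simp; linarith), Set.indicator_of_mem (by simpa using h),
        Set.indicator_of_mem (by simpa using h), ← mul_assoc, ← ENNReal.ofReal_mul (by positivity),
        add_sub_cancel_right]
      congr 2
      simp only [pow_zero, Nat.factorial_zero, Nat.cast_one, div_one, mul_one]
      rw [show -(r * (a + t)) = -(r * t) + -(r * a) by ring, Real.exp_add]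
      ring
    · rw [Set.indicator_of_notMem (s := Set.Ioi 0) (a := a) (by simpa using h)]
      by_cases h2 : 0 < a + t
      · rw [Set.indicator_of_mem (by simpa using h2), Set.indicator_of_notMem, mul_zero]
        simp; linarith
      · rw [Set.indicator_of_notMem (by simpa using h2)]
  | succ n ih =>
    have h1 : ∀ᵐ a ∂expMeasure r, ∫⁻ g, (if count (consGap a g) t = n + 1 then
          Φ (restart (consGap a g) t) else 0) ∂iidLaw (expMeasure r) =
        (Set.Iic t).indicator (fun a =>
          ENNReal.ofReal (Real.exp (-(r * (t - a))) * (r * (t - a)) ^ n / n.factorial)) a *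
            ∫⁻ g, Φ g ∂iidLaw (expMeasure r) := by
      filter_upwards [ae_expMeasure_pos] with a ha
      by_cases h : a ≤ t
      · rw [Set.indicator_of_mem (by exact h), ← ih (sub_nonneg.2 h),
          ← lintegral_iidLaw _ (hm n (t - a))]
        refine lintegral_congr_ae ?_
        filter_upwards [ae_regular hr] with g hg
        rw [hg.count_consGap ha h, hg.restart_consGap ha h]
        simp
      · rw [Set.indicator_of_notMem (by exact h), zero_mul]
        refine (lintegral_congr_ae ?_).trans lintegral_zero
        filter_upwards [ae_regular hr] with g hg
        refine if_neg ?_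
        rw [(hg.consGap ha).count_eq_zero (not_le.1 h)]; omega
    have hm2 : Measurable ((Set.Iic t).indicator (fun a =>
          ENNReal.ofReal (Real.exp (-(r * (t - a))) * (r * (t - a)) ^ n / n.factorial))) :=
      Measurable.indicator (by fun_prop) measurableSet_Iic
    rw [lintegral_congr_ae h1, lintegral_mul_const _ hm2, lintegral_expMeasure hm2,
      ← setLIntegral_erlang hr ht]
    congr 1
    rw [← lintegral_indicator measurableSet_Ioi, ← lintegral_indicator measurableSet_Ioc]
    refine lintegral_congr fun a => ?_
    by_cases h0 : 0 < a <;> by_cases h2 : a ≤ t <;> simp [Set.indicator_apply, h0, h2]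

lemma map_count_restart {r : ℝ} (hr : 0 < r) {t : ℝ} (ht : 0 ≤ t) :
    (iidLaw (expMeasure r)).map (fun g => (count g t, restart g t)) =
      (poissonMeasure (r * t).toNNReal).prod (iidLaw (expMeasure r)) := by
  have := isProbabilityMeasure_expMeasure hr
  refine Measure.ext_of_lintegral _ fun f hf => ?_
  have hfn : ∀ n : ℕ, Measurable fun g : ℕ → ℝ => f (n, g) := fun n =>
    hf.comp measurable_prodMk_left
  have h1 : ∀ g : ℕ → ℝ, f (count g t, restart g t) =
      ∑' n, if count g t = n then f (n, restart g t) else 0 := by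
    intro g
    rw [tsum_eq_single (count g t)]
    · simp
    · intro n hn; rw [if_neg hn.symm]
  rw [lintegral_map hf (measurable_count_restart t), lintegral_congr h1, lintegral_tsum,
    lintegral_prod _ hf.aemeasurable, lintegral_countable']
  · refine tsum_congr fun n => ?_
    rw [lintegral_count_restart hr n ht (hfn n), poissonMeasure_singleton, mul_comm,
      Real.coe_toNNReal _ (by positivity)]
  · intro n
    have h : Measurable fun p : ℕ × (ℕ → ℝ) => if p.1 = n then f (n, p.2) else 0 :=
      Measurable.ite (measurable_fst (measurableSet_singleton n)) ((hfn n).comp measurable_snd)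
        measurable_const
    exact (h.comp (measurable_count_restart t)).aemeasurable

/-! ### Several independent clocks -/

section Clocks

variable {ι : Type*} [Fintype ι] [DecidableEq ι]

omit [Fintype ι] in
lemma measurable_update_prod {X : Type*} [MeasurableSpace X] (j : ι) :
    Measurable fun p : (ι → X) × X => Function.update p.1 j p.2 := by
  refine measurable_pi_lambda _ fun i => ?_
  by_cases h : i = j
  · subst h; simpa using measurable_snd
  · simp only [Function.update_of_ne h]; fun_prop

/-- Resampling one coordinate independently leaves a product law unchanged. In a race this isolates
the winning clock from the others. -/
lemma map_update_pi {X : Type*} [MeasurableSpace X] (μ : ι → Measure X)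
    [∀ i, IsProbabilityMeasure (μ i)] (j : ι) :
    ((Measure.pi μ).prod (μ j)).map (fun p => Function.update p.1 j p.2) = Measure.pi μ := by
  symm
  refine Measure.pi_eq fun s hs => ?_
  have hpre : (fun p : (ι → X) × X => Function.update p.1 j p.2) ⁻¹' (Set.univ.pi s) =
      (Set.univ.pi (Function.update s j Set.univ)) ×ˢ s j := by
    ext ⟨c, g⟩
    simp only [Set.mem_preimage, Set.mem_pi, Set.mem_univ, true_implies, Set.mem_prod]
    constructor
    · intro h
      refine ⟨fun i => ?_, by simpa using h j⟩
      by_cases hi : i = j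
      · subst hi; simp
      · simpa [Function.update_of_ne hi] using h i
    · rintro ⟨h1, h2⟩ i
      by_cases hi : i = j
      · subst hi; simpa using h2
      · simpa [Function.update_of_ne hi] using h1 i
  rw [Measure.map_apply (measurable_update_prod j) (MeasurableSet.univ_pi hs), hpre,
    Measure.prod_prod, Measure.pi_pi,
    ← Finset.mul_prod_erase _ _ (Finset.mem_univ j),
    ← Finset.mul_prod_erase Finset.univ (fun i => μ i (s i)) (Finset.mem_univ j)]
  simp only [Function.update_self, measure_univ, one_mul]
  rw [mul_comm]
  congr 1
  refine Finset.prod_congr rfl fun i hi => ?_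
  rw [Function.update_of_ne (Finset.ne_of_mem_erase hi)]

lemma lintegral_pi_update {X : Type*} [MeasurableSpace X] (μ : ι → Measure X)
    [∀ i, IsProbabilityMeasure (μ i)] (j : ι) {Φ : (ι → X) → ℝ≥0∞} (hΦ : Measurable Φ) :
    ∫⁻ c, ∫⁻ g, Φ (Function.update c j g) ∂μ j ∂Measure.pi μ = ∫⁻ c, Φ c ∂Measure.pi μ := by
  conv_rhs => rw [← map_update_pi μ j, lintegral_map hΦ (measurable_update_prod j)]
  exact (lintegral_prod _ (hΦ.comp (measurable_update_prod j)).aemeasurable).symm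

/-- The joint law of independent Poisson processes, given by their gaps. -/
noncomputable def clockLaw (r : ι → ℝ) : Measure (ι → ℕ → ℝ) :=
  Measure.pi fun i => iidLaw (expMeasure (r i))

variable {r : ι → ℝ}

omit [DecidableEq ι] in
lemma isProbabilityMeasure_clockLaw (hr : ∀ i, 0 < r i) : IsProbabilityMeasure (clockLaw r) := by
  have := fun i => isProbabilityMeasure_expMeasure (hr i)
  unfold clockLaw; infer_instance

omit [DecidableEq ι] in
lemma ae_regular_clockLaw (hr : ∀ i, 0 < r i) : ∀ᵐ c ∂clockLaw r, ∀ i, Regular (c i) := by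
  have := fun i => isProbabilityMeasure_expMeasure (hr i)
  refine ae_all_iff.2 fun i => ?_
  exact (Measure.quasiMeasurePreserving_eval (fun i => iidLaw (expMeasure (r i))) i).ae
    (ae_regular (hr i))

omit [Fintype ι] [DecidableEq ι] in
lemma measurable_restarts :
    Measurable fun p : (ι → ℕ → ℝ) × ℝ => fun i => restart (p.1 i) p.2 := by
  refine measurable_pi_lambda _ fun i => ?_
  have h : Measurable fun p : (ι → ℕ → ℝ) × ℝ => (p.1 i, p.2) := by fun_prop
  have := measurable_restart.comp h
  simpa only [Function.comp_def] using this

omit [Fintype ι] [DecidableEq ι] in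
lemma measurable_counts :
    Measurable fun p : (ι → ℕ → ℝ) × ℝ => fun i => count (p.1 i) p.2 := by
  refine measurable_pi_lambda _ fun i => ?_
  have h : Measurable fun p : (ι → ℕ → ℝ) × ℝ => (p.1 i, p.2) := by fun_prop
  have := measurable_count.comp h
  simpa only [Function.comp_def] using this

omit [DecidableEq ι] in
lemma map_counts_restarts (hr : ∀ i, 0 < r i) {t : ℝ} (ht : 0 ≤ t) :
    (clockLaw r).map (fun c => (fun i => count (c i) t, fun i => restart (c i) t)) =
      (Measure.pi fun i => poissonMeasure (r i * t).toNNReal).prod (clockLaw r) := by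
  have := fun i => isProbabilityMeasure_expMeasure (hr i)
  have h1 := Measure.pi_map_pi (μ := fun i => iidLaw (expMeasure (r i)))
    (f := fun (_ : ι) (g : ℕ → ℝ) => (count g t, restart g t))
    (hμ := fun i => by rw [map_count_restart (hr i) ht]; infer_instance)
    (fun i => (measurable_count_restart t).aemeasurable)
  simp_rw [map_count_restart (hr _) ht] at h1
  have h2 := (measurePreserving_arrowProdEquivProdArrow ℕ (ℕ → ℝ) ι
    (fun i => poissonMeasure (r i * t).toNNReal) (fun i => iidLaw (expMeasure (r i)))).map_eq
  rw [← h1, Measure.map_map (MeasurableEquiv.measurable _)] at h2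
  · exact h2
  · refine measurable_pi_lambda _ fun i => ?_
    have := (measurable_count_restart t).comp (measurable_pi_apply (X := fun _ : ι => ℕ → ℝ) i)
    simpa only [Function.comp_def] using this

omit [DecidableEq ι] in
lemma lintegral_counts_restarts (hr : ∀ i, 0 < r i) {t : ℝ} (ht : 0 ≤ t)
    {Φ : (ι → ℕ) × (ι → ℕ → ℝ) → ℝ≥0∞} (hΦ : Measurable Φ) :
    ∫⁻ c, Φ (fun i => count (c i) t, fun i => restart (c i) t) ∂clockLaw r =
      ∫⁻ n, ∫⁻ c, Φ (n, c) ∂clockLaw r ∂Measure.pi fun i => poissonMeasure (r i * t).toNNReal := by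
  have := isProbabilityMeasure_clockLaw hr
  have h : Measurable fun c : ι → ℕ → ℝ => (c, t) := measurable_id.prodMk measurable_const
  have h1 := (measurable_counts.prodMk measurable_restarts).comp h
  rw [← lintegral_prod _ hΦ.aemeasurable, ← map_counts_restarts hr ht, lintegral_map hΦ]
  simpa only [Function.comp_def] using h1

lemma pi_poisson_zero (A : Finset ι) (r : ι → ℝ) (hr : ∀ i, 0 < r i) {t : ℝ} (ht : 0 ≤ t) :
    (Measure.pi fun i => poissonMeasure (r i * t).toNNReal) {n | ∀ i ∈ A, n i = 0} =
      ENNReal.ofReal (Real.exp (-((∑ i ∈ A, r i) * t))) := by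
  have h : {n : ι → ℕ | ∀ i ∈ A, n i = 0} =
      Set.univ.pi fun i => if i ∈ A then {0} else Set.univ := by
    ext n
    simp only [Set.mem_ofPred_eq, Set.mem_pi, Set.mem_univ, true_implies]
    refine forall_congr' fun i => ?_
    by_cases hi : i ∈ A <;> simp [hi]
  rw [h, Measure.pi_pi, Finset.sum_mul, ← Finset.sum_neg_distrib, Real.exp_sum,
    ENNReal.ofReal_prod_of_nonneg fun i _ => (Real.exp_pos _).le,
    ← Finset.prod_subset (Finset.subset_univ A)]
  · refine Finset.prod_congr rfl fun i hi => ?_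
    rw [if_pos hi, poissonMeasure_singleton]
    have := (hr i).le
    rw [Real.coe_toNNReal _ (by positivity)]
    simp
  · intro i _ hi
    simp [hi]

/-- Clock `j` rings before the other clocks of `A`. -/
def Wins (A : Finset ι) (c : ι → ℕ → ℝ) (j : ι) : Prop := ∀ i ∈ A, i ≠ j → c j 0 < c i 0

omit [Fintype ι] [DecidableEq ι] in
lemma measurableSet_wins (A : Finset ι) (j : ι) : MeasurableSet {c : ι → ℕ → ℝ | Wins A c j} := by
  unfold Wins
  have : {c : ι → ℕ → ℝ | ∀ i ∈ A, i ≠ j → c j 0 < c i 0} =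
      ⋂ i ∈ A, {c : ι → ℕ → ℝ | i ≠ j → c j 0 < c i 0} := by ext; simp
  rw [this]
  refine Finset.measurableSet_biInter _ fun i _ => ?_
  by_cases h : i = j
  · simp [h]
  · simp only [ne_eq, h, not_false_eq_true, true_implies]
    exact measurableSet_lt (by fun_prop) (by fun_prop)

open Classical in
-- A strong Markov property at the ringing time of the winner. Clock `j` is resampled and split into
-- its first gap `a` and the remaining gaps. Since `a` is independent of the other clocks, it acts
-- on them as a fixed time: those in `A` must have no epoch up to `a`, which has probability `exp(-a
-- ∑ r i)` over `A.erase j`, and by `lintegral_counts_restarts` all other clocks restart afresh.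
-- Clocks outside `A` may ring before `a` without effect.
lemma lintegral_race (hr : ∀ i, 0 < r i) (A : Finset ι) {j : ι} (hj : j ∈ A)
    {Φ : ℝ × (ι → ℕ → ℝ) → ℝ≥0∞} (hΦ : Measurable Φ) :
    ∫⁻ c, (if Wins A c j then Φ (c j 0, fun i => restart (c i) (c j 0)) else 0) ∂clockLaw r =
      ∫⁻ s in Set.Ioi 0, ENNReal.ofReal (r j * Real.exp (-((∑ i ∈ A, r i) * s))) *
        ∫⁻ c, Φ (s, c) ∂clockLaw r := by
  have := fun i => isProbabilityMeasure_expMeasure (hr i)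
  have := isProbabilityMeasure_clockLaw hr
  have hjm : Measurable fun c : ι → ℕ → ℝ => (c j 0, fun i => restart (c i) (c j 0)) := by
    have h : Measurable fun c : ι → ℕ → ℝ => (c, c j 0) := by fun_prop
    have h1 := (measurable_snd.prodMk measurable_restarts).comp h
    simpa only [Function.comp_def] using h1
  have hΨ : Measurable fun c : ι → ℕ → ℝ =>
      if Wins A c j then Φ (c j 0, fun i => restart (c i) (c j 0)) else 0 :=
    Measurable.ite (measurableSet_wins A j) (hΦ.comp hjm) measurable_const
  set Ψ := fun c : ι → ℕ → ℝ =>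
      if Wins A c j then Φ (c j 0, fun i => restart (c i) (c j 0)) else 0 with hΨdef
  have hK : Measurable fun p : (ι → ℕ → ℝ) × ℝ × (ℕ → ℝ) =>
      Ψ (Function.update p.1 j (consGap p.2.1 p.2.2)) := by
    have h1 : Measurable fun p : (ι → ℕ → ℝ) × ℝ × (ℕ → ℝ) => (p.1, consGap p.2.1 p.2.2) :=
      measurable_fst.prodMk (measurable_consGap.comp measurable_snd)
    exact hΨ.comp ((measurable_update_prod j).comp h1)
  have step1 : ∫⁻ c, Ψ c ∂clockLaw r = ∫⁻ a, ∫⁻ g, ∫⁻ c,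
      Ψ (Function.update c j (consGap a g)) ∂clockLaw r ∂iidLaw (expMeasure (r j))
        ∂expMeasure (r j) := by
    have e1 : ∫⁻ c, Ψ c ∂clockLaw r = ∫⁻ c, ∫⁻ g, Ψ (Function.update c j g)
        ∂iidLaw (expMeasure (r j)) ∂clockLaw r := (lintegral_pi_update _ j hΨ).symm
    have e2 : ∀ c : ι → ℕ → ℝ, ∫⁻ g, Ψ (Function.update c j g) ∂iidLaw (expMeasure (r j)) =
        ∫⁻ p, Ψ (Function.update c j (consGap p.1 p.2))
          ∂((expMeasure (r j)).prod (iidLaw (expMeasure (r j)))) := by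
      intro c
      have hc : Measurable fun g : ℕ → ℝ => Ψ (Function.update c j g) :=
        hΨ.comp ((measurable_update_prod j).comp measurable_prodMk_left)
      rw [lintegral_iidLaw _ hc]
      exact (lintegral_prod _ (hc.comp measurable_consGap).aemeasurable).symm
    rw [e1, lintegral_congr e2, lintegral_lintegral_swap hK.aemeasurable,
      lintegral_prod _ hK.lintegral_prod_left'.aemeasurable]
  have step2 : ∀ᵐ a ∂expMeasure (r j), ∫⁻ g, ∫⁻ c,
      Ψ (Function.update c j (consGap a g)) ∂clockLaw r ∂iidLaw (expMeasure (r j)) =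
      ENNReal.ofReal (Real.exp (-((∑ i ∈ A.erase j, r i) * a))) * ∫⁻ c, Φ (a, c) ∂clockLaw r := by
    filter_upwards [ae_expMeasure_pos] with a ha
    have hΦa : Measurable fun c => Φ (a, c) := hΦ.comp measurable_prodMk_left
    have hΦu : Measurable fun p : (ι → ℕ → ℝ) × (ℕ → ℝ) => Φ (a, Function.update p.1 j p.2) :=
      hΦa.comp (measurable_update_prod j)
    -- Restarting the winner at its own first epoch returns exactly its remaining gaps `g`; for the
    -- other clocks the event of the win is expressed by their counts at time `a`.
    have inner : ∀ᵐ g ∂iidLaw (expMeasure (r j)), ∫⁻ c,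
        Ψ (Function.update c j (consGap a g)) ∂clockLaw r =
        ENNReal.ofReal (Real.exp (-((∑ i ∈ A.erase j, r i) * a))) *
          ∫⁻ c, Φ (a, Function.update c j g) ∂clockLaw r := by
      filter_upwards [ae_regular (hr j)] with g hg
      have hΦg : Measurable fun c : ι → ℕ → ℝ => Φ (a, Function.update c j g) :=
        hΦu.comp measurable_prodMk_right
      have hset : MeasurableSet {n : ι → ℕ | ∀ i ∈ A.erase j, n i = 0} :=
        (Set.to_countable _).measurableSet
      have hmeas : Measurable fun p : (ι → ℕ) × (ι → ℕ → ℝ) =>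
          if (∀ i ∈ A.erase j, p.1 i = 0) then Φ (a, Function.update p.2 j g) else 0 :=
        Measurable.ite (measurable_fst hset) (hΦg.comp measurable_snd) measurable_const
      have h1 : ∀ᵐ c ∂clockLaw r, Ψ (Function.update c j (consGap a g)) =
          if (∀ i ∈ A.erase j, count (c i) a = 0) then
            Φ (a, Function.update (fun i => restart (c i) a) j g) else 0 := by
        filter_upwards [ae_regular_clockLaw hr] with c hc
        simp only [hΨdef, Wins, Function.update_self]
        have hiff : (∀ i ∈ A, i ≠ j → consGap a g 0 < Function.update c j (consGap a g) i 0) ↔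
            ∀ i ∈ A.erase j, count (c i) a = 0 := by
          constructor
          · intro h i hi
            rw [Finset.mem_erase] at hi
            have := h i hi.2 hi.1
            rw [Function.update_of_ne hi.1] at this
            exact (hc i).count_eq_zero this
          · intro h i hi hij
            rw [Function.update_of_ne hij]
            exact (hc i).count_eq_zero_iff.1 (h i (Finset.mem_erase.2 ⟨hij, hi⟩))
        have hfun : (fun i => restart (Function.update c j (consGap a g) i) (consGap a g 0)) =
            Function.update (fun i => restart (c i) a) j g := by
          funext i
          by_cases hi : i = j
          · subst hi
            rw [Function.update_self, Function.update_self]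
            exact hg.restart_consGap_self ha
          · rw [Function.update_of_ne hi, Function.update_of_ne hi]; rfl
        rw [hfun]
        by_cases h : ∀ i ∈ A.erase j, count (c i) a = 0
        · rw [if_pos h, if_pos (hiff.2 h)]; rfl
        · rw [if_neg h, if_neg fun h' => h (hiff.1 h')]
      rw [lintegral_congr_ae h1, lintegral_counts_restarts hr ha.le hmeas,
        ← pi_poisson_zero (A.erase j) r hr ha.le, ← lintegral_indicator_one hset,
        ← lintegral_mul_const _ (measurable_one.indicator hset)]
      refine lintegral_congr fun n => ?_
      by_cases h : ∀ i ∈ A.erase j, n i = 0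
      · rw [Set.indicator_of_mem (by exact h)]; simp only [if_pos h, Pi.one_apply, one_mul]
      · rw [Set.indicator_of_notMem (by exact h)]; simp only [if_neg h, zero_mul, lintegral_zero]
    rw [lintegral_congr_ae inner, lintegral_const_mul _ hΦu.lintegral_prod_left',
      lintegral_lintegral_swap (by exact (hΦu.comp measurable_swap).aemeasurable)]
    congr 1
    exact lintegral_pi_update _ j hΦa
  have hm : Measurable fun a => ENNReal.ofReal (Real.exp (-((∑ i ∈ A.erase j, r i) * a))) *
      ∫⁻ c, Φ (a, c) ∂clockLaw r :=
    Measurable.mul (by fun_prop) hΦ.lintegral_prod_right'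
  rw [step1, lintegral_congr_ae step2, lintegral_expMeasure hm]
  refine lintegral_congr fun s => ?_
  have := (hr j).le
  rw [← mul_assoc, ← ENNReal.ofReal_mul (by positivity), mul_assoc, ← Real.exp_add,
    ← Finset.add_sum_erase _ _ hj]
  congr 4
  ring

end Clocks

/-! ### One cycle of the system -/

/-- The clocks (`(false, k)` for the class-`k` arrivals, `(true, k)` for the retrials of orbit `k`)
together with the sequences of service times. -/
abbrev World : Type := (Bool × Fin 2 → ℕ → ℝ) × (Fin 2 → ℕ → ℝ)

/-- The sample path encoded by a world. -/
def toPath (w : World) : Path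
  | .arrival, k => w.1 (false, k)
  | .retrial, k => w.1 (true, k)
  | .service, k => w.2 k

/-- The world encoding a sample path. -/
def ofPath (u : Path) : World :=
  (fun i => if i.1 then u .retrial i.2 else u .arrival i.2, fun k => u .service k)

lemma toPath_ofPath (u : Path) : toPath (ofPath u) = u := by
  funext a k
  cases a <;> rfl

/-- Regular clocks and non-negative service times. -/
structure Good (w : World) : Prop where
  clock : ∀ i, Regular (w.1 i)
  service : ∀ k n, 0 ≤ w.2 k n

/-- The world seen from time `t`, after `n` services. -/
noncomputable def advance (w : World) (t : ℝ) (n : ℕ) : World :=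
  (fun i => restart (w.1 i) t, fun k m => w.2 k (n + m))

/-- Duration of the first cycle. -/
noncomputable def stepDuration (w : World) (x : Orbits) : ℝ := endTime (toPath w) 0 x 0

/-- Orbits after the first cycle. -/
noncomputable def stepOrbits (w : World) (x : Orbits) : Orbits := orbitsAtEnd (toPath w) 0 x 0

/-- The world seen from the end of the first cycle. -/
noncomputable def stepWorld (w : World) (x : Orbits) : World := advance w (stepDuration w x) 1

/-- The clocks that can end an idle period. -/
def active (x : Orbits) : Finset (Bool × Fin 2) := Finset.univ.filter fun i => i.1 = true → 0 < x i.2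

lemma arrival_mem_active (x : Orbits) (k : Fin 2) : (false, k) ∈ active x := by simp [active]

lemma retrial_mem_active {x : Orbits} {k : Fin 2} : (true, k) ∈ active x ↔ 0 < x k := by
  simp [active]

/-- Orbits at the end of a cycle whose idle period is ended by clock `j`, with `n (false, k)`
class-`k` arrivals during the service. -/
def afterService (j : Bool × Fin 2) (x : Orbits) (n : Bool × Fin 2 → ℕ) : Orbits :=
  fun k => (if j = (true, k) then x k - 1 else x k) + n (false, k)

/-! ### Shift invariance of a cycle, and its description by the winning clock. -/

section Deterministic

variable {w : World} (hw : Good w)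

include hw

lemma Good.advance {t : ℝ} {n : ℕ} : Good (advance w t n) where
  clock i := (hw.clock i).restart t
  service k m := hw.service k (n + m)

lemma attemptTime_advance {d : ℝ} (x : Orbits) (k : Fin 2) (n : ℕ) :
    attemptTime (toPath w) d x k = d + attemptTime (toPath (advance w d n)) 0 x k := by
  have h : ∀ i, nextEpoch ((advance w d n).1 i) 0 = nextEpoch (w.1 i) d - d := fun i => by
    simpa [advance] using (hw.clock i).nextEpoch_restart (t := d) le_rfl
  simp only [attemptTime, toPath, h]
  split_ifs
  · rw [← min_add_add_left]; ring_nf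
  · ring

lemma startTime_advance {d : ℝ} (x : Orbits) (n : ℕ) :
    startTime (toPath w) d x = d + startTime (toPath (advance w d n)) 0 x := by
  simp only [startTime, attemptTime_advance hw (d := d) x _ n, min_add_add_left]

lemma servedClass_advance {d : ℝ} (x : Orbits) (n : ℕ) :
    servedClass (toPath w) d x = servedClass (toPath (advance w d n)) 0 x := by
  simp only [servedClass, attemptTime_advance hw (d := d) x _ n, add_le_add_iff_left]

lemma fromOrbit_advance {d : ℝ} (x : Orbits) (n : ℕ) (k : Fin 2) :
    FromOrbit (toPath w) d x k ↔ FromOrbit (toPath (advance w d n)) 0 x k := by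
  have h : ∀ i, nextEpoch ((advance w d n).1 i) 0 = nextEpoch (w.1 i) d - d := fun i => by
    simpa [advance] using (hw.clock i).nextEpoch_restart (t := d) le_rfl
  simp only [FromOrbit, servedClass_advance hw (d := d) x n, toPath, h, sub_lt_sub_iff_right]

lemma endTime_advance {d : ℝ} (x : Orbits) (n : ℕ) :
    endTime (toPath w) d x n = d + stepDuration (advance w d n) x := by
  simp only [stepDuration, endTime, startTime_advance hw (d := d) x n,
    servedClass_advance hw (d := d) x n, toPath, advance, add_zero, add_assoc]

lemma attemptTime_zero (x : Orbits) (k : Fin 2) :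
    attemptTime (toPath w) 0 x k =
      if 0 < x k then min (w.1 (false, k) 0) (w.1 (true, k) 0) else w.1 (false, k) 0 := by
  simp only [attemptTime, toPath, (hw.clock _).nextEpoch_zero]

lemma attemptTime_pos (x : Orbits) (k : Fin 2) : 0 < attemptTime (toPath w) 0 x k := by
  rw [attemptTime_zero hw]
  split_ifs
  · exact lt_min ((hw.clock _).pos 0) ((hw.clock _).pos 0)
  · exact (hw.clock _).pos 0

lemma startTime_pos (x : Orbits) : 0 < startTime (toPath w) 0 x :=
  lt_min (attemptTime_pos hw x 0) (attemptTime_pos hw x 1)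

lemma startTime_le_endTime (d : ℝ) (x : Orbits) (n : ℕ) :
    startTime (toPath w) d x ≤ endTime (toPath w) d x n := by
  have := hw.service (servedClass (toPath w) d x) n
  simp only [endTime, toPath]
  linarith

lemma stepDuration_pos (x : Orbits) : 0 < stepDuration w x :=
  (startTime_pos hw x).trans_le (startTime_le_endTime hw 0 x 0)

lemma orbitsAtEnd_advance {d : ℝ} (x : Orbits) (n : ℕ) :
    orbitsAtEnd (toPath w) d x n = stepOrbits (advance w d n) x := by
  funext k
  have hA := hw.advance (t := d) (n := n)
  have h1 := ((hw.clock (false, k)).ncard_Ioc (startTime_le_endTime hw d x n))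
  have h2 := ((hA.clock (false, k)).ncard_Ioc (startTime_le_endTime hA 0 x 0))
  simp only [stepOrbits, orbitsAtEnd]
  congr 1
  · classical exact if_congr (fromOrbit_advance hw x n k) rfl rfl
  · rw [show toPath w .arrival k = w.1 (false, k) from rfl, h1,
      show toPath (advance w d n) .arrival k = (advance w d n).1 (false, k) from rfl, h2]
    have h3 : endTime (toPath (advance w d n)) 0 x 0 = stepDuration (advance w d n) x := rfl
    have h4 : (advance w d n).1 (false, k) = restart (w.1 (false, k)) d := rfl
    rw [endTime_advance hw, h3, startTime_advance hw (d := d) x n, h4,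
      (hw.clock (false, k)).restart_restart (startTime_pos hA x).le]
    congr 1
    ring

lemma advance_advance {d t : ℝ} (ht : 0 ≤ t) (n m : ℕ) :
    advance (advance w d n) t m = advance w (d + t) (n + m) := by
  refine Prod.ext ?_ ?_
  · funext i
    exact (hw.clock i).restart_restart ht
  · funext k l
    simp only [advance, add_assoc]

/-- Winning is a strict inequality, so the rule by which `servedClass` breaks ties plays no role. -/
lemma startTime_of_wins {x : Orbits} {j : Bool × Fin 2} (hj : j ∈ active x)
    (h : Wins (active x) w.1 j) :
    startTime (toPath w) 0 x = w.1 j 0 ∧ servedClass (toPath w) 0 x = j.2 ∧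
      ∀ k, FromOrbit (toPath w) 0 x k ↔ j = (true, k) := by
  have hne : ∀ k, (false, k) ≠ j → w.1 j 0 < w.1 (false, k) 0 := fun k =>
    h (false, k) (arrival_mem_active x k)
  have hne' : ∀ k, 0 < x k → (true, k) ≠ j → w.1 j 0 < w.1 (true, k) 0 := fun k hx =>
    h (true, k) (retrial_mem_active.2 hx)
  have hself : attemptTime (toPath w) 0 x j.2 = w.1 j 0 := by
    rw [attemptTime_zero hw]
    obtain ⟨b, k⟩ := j
    cases b
    · split_ifs with hx
      · exact min_eq_left (hne' k hx (by simp)).le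
      · rfl
    · rw [if_pos (retrial_mem_active.1 hj)]
      exact min_eq_right (hne k (by simp)).le
  have hother : ∀ k, k ≠ j.2 → w.1 j 0 < attemptTime (toPath w) 0 x k := by
    intro k hk
    have h1 : ∀ b, (b, k) ≠ j := fun b hb => hk (by rw [← hb])
    rw [attemptTime_zero hw]
    split_ifs with hx
    · exact lt_min (hne k (h1 _)) (hne' k hx (h1 _))
    · exact hne k (h1 _)
  have hserved : servedClass (toPath w) 0 x = j.2 ∧ startTime (toPath w) 0 x = w.1 j 0 := by
    rcases (show j.2 = 0 ∨ j.2 = 1 by omega) with hk | hk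
    · have h1 := hother 1 (by rw [hk]; simp)
      rw [hk] at hself
      rw [servedClass, startTime, hself, if_pos h1.le, min_eq_left h1.le, hk]
      simp
    · have h1 := hother 0 (by rw [hk]; simp)
      rw [hk] at hself
      rw [servedClass, startTime, hself, if_neg (not_le.2 h1), min_eq_right h1.le, hk]
      simp
  refine ⟨hserved.2, hserved.1, fun k => ?_⟩
  simp only [FromOrbit, hserved.1, toPath, (hw.clock _).nextEpoch_zero]
  constructor
  · rintro ⟨hk, hx, hlt⟩
    by_contra hj'
    have h1 := hne' k hx (Ne.symm hj')
    obtain ⟨b, l⟩ := j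
    simp only at hk
    subst hk
    cases b
    · exact lt_asymm h1 hlt
    · exact hj' rfl
  · rintro rfl
    exact ⟨rfl, retrial_mem_active.1 hj, hne k (by simp)⟩

lemma stepDuration_of_wins {x : Orbits} {j : Bool × Fin 2} (hj : j ∈ active x)
    (h : Wins (active x) w.1 j) : stepDuration w x = w.1 j 0 + w.2 j.2 0 := by
  obtain ⟨h1, h2, -⟩ := startTime_of_wins hw hj h
  rw [stepDuration, endTime, h1, h2]; rfl

lemma stepOrbits_of_wins {x : Orbits} {j : Bool × Fin 2} (hj : j ∈ active x)
    (h : Wins (active x) w.1 j) :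
    stepOrbits w x =
      afterService j x fun i => count (restart (w.1 i) (w.1 j 0)) (w.2 j.2 0) := by
  obtain ⟨h1, h2, h3⟩ := startTime_of_wins hw hj h
  have h4 := stepDuration_of_wins hw hj h
  rw [stepDuration] at h4
  funext k
  have h5 := ((hw.clock (false, k)).ncard_Ioc (startTime_le_endTime hw 0 x 0))
  rw [h1, h4] at h5
  simp only [stepOrbits, orbitsAtEnd, afterService, orbitAtStart, h1, h4]
  rw [show toPath w .arrival k = w.1 (false, k) from rfl, h5, add_sub_cancel_left]
  congr 1
  classical exact if_congr (h3 k) rfl rfl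

lemma stepWorld_of_wins {x : Orbits} {j : Bool × Fin 2} (hj : j ∈ active x)
    (h : Wins (active x) w.1 j) :
    stepWorld w x = (fun i => restart (restart (w.1 i) (w.1 j 0)) (w.2 j.2 0),
      fun k m => w.2 k (m + 1)) := by
  rw [stepWorld, stepDuration_of_wins hw hj h]
  refine Prod.ext ?_ ?_
  · funext i
    exact ((hw.clock i).restart_restart (hw.service _ _)).symm
  · funext k m
    simp only [advance, add_comm]

lemma stepWorld_good (x : Orbits) : Good (stepWorld w x) := hw.advance

end Deterministic

/-! ### The chain at departures -/

/-- Departure instant, orbits and remaining world after `n` cycles. -/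
noncomputable def run (x₀ : Orbits) (w : World) : ℕ → (ℝ × Orbits) × World
  | 0 => ((0, x₀), w)
  | n + 1 =>
    let s := run x₀ w n
    ((s.1.1 + stepDuration s.2 s.1.2, stepOrbits s.2 s.1.2), stepWorld s.2 s.1.2)

lemma run_good {w : World} (hw : Good w) (x₀ : Orbits) (n : ℕ) : Good (run x₀ w n).2 := by
  induction n with
  | zero => exact hw
  | succ n ih => exact stepWorld_good ih _

lemma run_time_nonneg {w : World} (hw : Good w) (x₀ : Orbits) (n : ℕ) :
    0 ≤ (run x₀ w n).1.1 := by
  induction n with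
  | zero => exact le_rfl
  | succ n ih => exact add_nonneg ih (stepDuration_pos (run_good hw x₀ n) _).le

/-- Identifies the recursion in absolute time with one that restarts the clocks at every departure;
only the latter exhibits the regenerative structure. -/
lemma departure_eq_run {w : World} (hw : Good w) (x₀ : Orbits) (n : ℕ) :
    departure (toPath w) x₀ n = (run x₀ w n).1 ∧
      (run x₀ w n).2 = advance w (run x₀ w n).1.1 n := by
  induction n with
  | zero =>
    refine ⟨rfl, Prod.ext ?_ ?_⟩
    · funext i
      exact ((hw.clock i).restart_zero).symm
    · funext k m
      simp [run, advance]
  | succ n ih =>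
    obtain ⟨h1, h2⟩ := ih
    refine ⟨?_, ?_⟩
    · simp only [departure, h1, run]
      rw [endTime_advance hw, orbitsAtEnd_advance hw, ← h2]
    · simp only [run]
      rw [stepWorld]
      conv_lhs => rw [h2]
      rw [advance_advance hw (stepDuration_pos hw.advance _).le, h2]

section Measurability

lemma measurable_toPath (a : Source) (k : Fin 2) : Measurable fun w : World => toPath w a k := by
  cases a <;> simp only [toPath] <;> fun_prop

lemma measurable_nextEpoch_zero (a : Source) (k : Fin 2) :
    Measurable fun w : World => nextEpoch (toPath w a k) 0 := by
  have h : Measurable fun w : World => (toPath w a k, (0 : ℝ)) :=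
    (measurable_toPath a k).prodMk measurable_const
  have := measurable_nextEpoch.comp h
  simpa only [Function.comp_def] using this

lemma measurable_attemptTime (x : Orbits) (k : Fin 2) :
    Measurable fun w : World => attemptTime (toPath w) 0 x k := by
  unfold attemptTime
  split_ifs
  · exact (measurable_nextEpoch_zero _ _).min (measurable_nextEpoch_zero _ _)
  · exact measurable_nextEpoch_zero _ _

lemma measurable_startTime (x : Orbits) : Measurable fun w : World => startTime (toPath w) 0 x :=
  (measurable_attemptTime x 0).min (measurable_attemptTime x 1)

lemma measurable_servedClass (x : Orbits) :
    Measurable fun w : World => servedClass (toPath w) 0 x :=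
  Measurable.ite (measurableSet_le (measurable_attemptTime x 0) (measurable_attemptTime x 1))
    measurable_const measurable_const

lemma measurable_stepDuration (x : Orbits) : Measurable fun w : World => stepDuration w x := by
  refine (measurable_startTime x).add ?_
  have h : Measurable fun q : World × Fin 2 => toPath q.1 .service q.2 0 :=
    measurable_from_prod_countable_left fun k =>
      (measurable_pi_apply 0).comp (measurable_toPath .service k)
  have := h.comp (measurable_id.prodMk (measurable_servedClass x))
  simpa only [Function.comp_def, id_eq] using this

lemma measurable_stepOrbits (x : Orbits) : Measurable fun w : World => stepOrbits w x := by
  refine measurable_pi_lambda _ fun k => ?_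
  have h1 : Measurable fun w : World => orbitAtStart (toPath w) 0 x k := by
    classical
    refine Measurable.ite ?_ measurable_const measurable_const
    have h2 : MeasurableSet {w : World | servedClass (toPath w) 0 x = k} :=
      measurable_servedClass x (measurableSet_singleton k)
    have h3 : MeasurableSet {w : World | nextEpoch (toPath w .retrial k) 0 <
        nextEpoch (toPath w .arrival k) 0} :=
      measurableSet_lt (measurable_nextEpoch_zero _ _) (measurable_nextEpoch_zero _ _)
    exact h2.inter ((MeasurableSet.const (0 < x k)).inter h3)
  refine h1.add (measurable_ncard fun m => ?_)
  have h4 : Measurable fun w : World => epoch (toPath w .arrival k) m :=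
    (measurable_epoch m).comp (measurable_toPath .arrival k)
  exact (measurableSet_lt (measurable_startTime x) h4).inter
    (measurableSet_le h4 (measurable_stepDuration x))

lemma measurable_advance (n : ℕ) : Measurable fun p : World × ℝ => advance p.1 p.2 n := by
  refine Measurable.prodMk ?_ ?_
  · have h : Measurable fun p : World × ℝ => (p.1.1, p.2) := by fun_prop
    have := (measurable_restarts (ι := Bool × Fin 2)).comp h
    simpa only [Function.comp_def] using this
  · fun_prop

lemma measurable_stepWorld (x : Orbits) : Measurable fun w : World => stepWorld w x := by
  unfold stepWorld
  have := (measurable_advance 1).comp (measurable_id.prodMk (measurable_stepDuration x))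
  simpa only [Function.comp_def, id_eq] using this

/-- One cycle, as a function of the state and the remaining world. -/
noncomputable def cycleMap (s : (ℝ × Orbits) × World) : (ℝ × Orbits) × World :=
  ((s.1.1 + stepDuration s.2 s.1.2, stepOrbits s.2 s.1.2), stepWorld s.2 s.1.2)

lemma run_succ (x₀ : Orbits) (w : World) (n : ℕ) : run x₀ w (n + 1) = cycleMap (run x₀ w n) := rfl

lemma measurable_cycleMap : Measurable cycleMap := by
  have h : Measurable fun q : (ℝ × World) × Orbits =>
      ((q.1.1 + stepDuration q.1.2 q.2, stepOrbits q.1.2 q.2), stepWorld q.1.2 q.2) :=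
    measurable_from_prod_countable_left fun x =>
      ((measurable_fst.add ((measurable_stepDuration x).comp measurable_snd)).prodMk
        ((measurable_stepOrbits x).comp measurable_snd)).prodMk
        ((measurable_stepWorld x).comp measurable_snd)
  have h2 : Measurable fun s : (ℝ × Orbits) × World => ((s.1.1, s.2), s.1.2) := by fun_prop
  have := h.comp h2
  exact this

lemma measurable_run (x₀ : Orbits) (n : ℕ) : Measurable fun w => run x₀ w n := by
  induction n with
  | zero => exact measurable_const.prodMk measurable_id
  | succ n ih => exact measurable_cycleMap.comp ih

end Measurability

/-! ### Law of one cycle -/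

/-- The rates of the four clocks. -/
def rate (lam alpha : Fin 2 → ℝ) (i : Bool × Fin 2) : ℝ := if i.1 then alpha i.2 else lam i.2

/-- The law of the services. -/
noncomputable def serviceLaw (F : Fin 2 → Measure ℝ) : Measure (Fin 2 → ℕ → ℝ) :=
  Measure.pi fun k => iidLaw (F k)

/-- The law of the driving variables. -/
noncomputable def worldLaw (lam alpha : Fin 2 → ℝ) (F : Fin 2 → Measure ℝ) : Measure World :=
  (clockLaw (rate lam alpha)).prod (serviceLaw F)

lemma map_uncons_iidLaw (ν : Measure ℝ) [IsProbabilityMeasure ν] :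
    (iidLaw ν).map (fun g => (g 0, fun n => g (n + 1))) = ν.prod (iidLaw ν) := by
  have h : Measurable fun g : ℕ → ℝ => (g 0, fun n => g (n + 1)) := by fun_prop
  conv_lhs => rw [← map_consGap_iidLaw ν, Measure.map_map h measurable_consGap]
  exact Measure.map_id

/-- Each cycle consumes the first entry of both service sequences, also for the class that is not
served. Only entry `k` is used; the discarded one integrates out. -/
lemma lintegral_serviceLaw (F : Fin 2 → Measure ℝ) [∀ k, IsProbabilityMeasure (F k)] (k : Fin 2)
    {H : ℝ × (Fin 2 → ℕ → ℝ) → ℝ≥0∞} (hH : Measurable H) :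
    ∫⁻ σ, H (σ k 0, fun l n => σ l (n + 1)) ∂serviceLaw F =
      ∫⁻ s, ∫⁻ σ, H (s, σ) ∂serviceLaw F ∂F k := by
  have hprob : IsProbabilityMeasure (serviceLaw F) := by unfold serviceLaw; infer_instance
  have h1 := Measure.pi_map_pi (μ := fun k => iidLaw (F k))
    (f := fun (_ : Fin 2) (g : ℕ → ℝ) => (g 0, fun n => g (n + 1)))
    (hμ := fun i => by rw [map_uncons_iidLaw]; infer_instance)
    (fun i => (by fun_prop : Measurable fun g : ℕ → ℝ => (g 0, fun n => g (n + 1))).aemeasurable)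
  simp_rw [map_uncons_iidLaw] at h1
  have h2 := (measurePreserving_arrowProdEquivProdArrow ℝ (ℕ → ℝ) (Fin 2)
    (fun i => F i) (fun i => iidLaw (F i))).map_eq
  rw [← h1, Measure.map_map (MeasurableEquiv.measurable _) (by fun_prop)] at h2
  have h3 : ((Measure.pi fun i => F i).prod (serviceLaw F)).map (fun p => (p.1 k, p.2)) =
      (F k).prod (serviceLaw F) := by
    have := Measure.map_prod_map (Measure.pi fun i => F i) (serviceLaw F)
      (f := fun p => p k) (g := id) (by fun_prop) (by fun_prop)
    rw [Measure.map_id, (measurePreserving_eval F k).map_eq] at this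
    exact this.symm
  have hm : Measurable fun p : (Fin 2 → ℝ) × (Fin 2 → ℕ → ℝ) => H (p.1 k, p.2) :=
    hH.comp (by fun_prop)
  have hm2 : Measurable fun σ : Fin 2 → ℕ → ℝ => fun i => (σ i 0, fun n => σ i (n + 1)) := by
    fun_prop
  rw [← lintegral_prod _ hH.aemeasurable, ← h3, lintegral_map hH (by fun_prop)]
  conv_rhs => rw [serviceLaw, ← h2, lintegral_map hm ((MeasurableEquiv.measurable _).comp hm2)]
  rfl

section Race

variable {ι : Type*} [Fintype ι] [DecidableEq ι] {r : ι → ℝ}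

open Classical in
lemma lintegral_race_expMeasure (hr : ∀ i, 0 < r i) (A : Finset ι) {j : ι} (hj : j ∈ A)
    {Φ : ℝ × (ι → ℕ → ℝ) → ℝ≥0∞} (hΦ : Measurable Φ) :
    ∫⁻ c, (if Wins A c j then Φ (c j 0, fun i => restart (c i) (c j 0)) else 0) ∂clockLaw r =
      ENNReal.ofReal (r j / ∑ i ∈ A, r i) *
        ∫⁻ s, ∫⁻ c, Φ (s, c) ∂clockLaw r ∂expMeasure (∑ i ∈ A, r i) := by
  have hR : 0 < ∑ i ∈ A, r i := Finset.sum_pos (fun i _ => hr i) ⟨j, hj⟩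
  have := isProbabilityMeasure_clockLaw hr
  have hm : Measurable fun s => ENNReal.ofReal ((∑ i ∈ A, r i) *
      Real.exp (-((∑ i ∈ A, r i) * s))) * ∫⁻ c, Φ (s, c) ∂clockLaw r :=
    Measurable.mul (by fun_prop) hΦ.lintegral_prod_right'
  rw [lintegral_race hr A hj hΦ, lintegral_expMeasure hΦ.lintegral_prod_right',
    ← lintegral_const_mul _ hm]
  refine lintegral_congr fun s => ?_
  have := (hr j).le
  rw [← mul_assoc, ← ENNReal.ofReal_mul (by positivity)]
  congr 2
  field_simp

/-- The winning events are disjoint and their probabilities `r j / ∑ r i` add up to one, so a tie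
for the first ring is a null event. -/
lemma ae_exists_wins (hr : ∀ i, 0 < r i) (A : Finset ι) (hA : A.Nonempty) :
    ∀ᵐ c ∂clockLaw r, ∃ j ∈ A, Wins A c j := by
  classical
  have hR : 0 < ∑ i ∈ A, r i := Finset.sum_pos (fun i _ => hr i) hA
  have := isProbabilityMeasure_clockLaw hr
  have := isProbabilityMeasure_expMeasure hR
  have h1 : ∀ j ∈ A, clockLaw r {c | Wins A c j} = ENNReal.ofReal (r j / ∑ i ∈ A, r i) := by
    intro j hj
    have := lintegral_race_expMeasure hr A hj (Φ := fun _ => 1) measurable_const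
    simp only [lintegral_one, measure_univ, mul_one] at this
    rw [← this, ← lintegral_indicator_one (measurableSet_wins A j)]
    rfl
  have h2 : clockLaw r (⋃ j ∈ A, {c | Wins A c j}) = 1 := by
    rw [measure_biUnion_finset _ fun j _ => measurableSet_wins A j, Finset.sum_congr rfl h1,
      ← ENNReal.ofReal_sum_of_nonneg fun j _ => div_nonneg (hr j).le hR.le, ← Finset.sum_div,
      div_self hR.ne', ENNReal.ofReal_one]
    intro i hi j hj hij
    refine Set.disjoint_left.2 fun c hc hc' => ?_
    exact lt_asymm (hc j hj hij.symm) (hc' i hi hij)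
  have h3 := (mem_ae_iff_prob_eq_one (Finset.measurableSet_biUnion A fun j _ =>
    measurableSet_wins A j)).2 h2
  filter_upwards [h3] with c hc
  simpa using hc

omit [Fintype ι] [DecidableEq ι] in
lemma Wins.unique {A : Finset ι} {c : ι → ℕ → ℝ} {i j : ι} (hi : i ∈ A) (hj : j ∈ A)
    (h : Wins A c i) (h' : Wins A c j) : i = j := by
  by_contra hij
  exact lt_asymm (h j hj (Ne.symm hij)) (h' i hi hij)

end Race

section Step

variable {lam alpha : Fin 2 → ℝ} {F : Fin 2 → Measure ℝ}

lemma rate_pos (hlam : ∀ k, 0 < lam k) (halpha : ∀ k, 0 < alpha k) (i : Bool × Fin 2) :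
    0 < rate lam alpha i := by
  unfold rate; split_ifs
  exacts [halpha _, hlam _]

/-- Total rate at which an idle period ends. -/
noncomputable def totalRate (lam alpha : Fin 2 → ℝ) (x : Orbits) : ℝ :=
  ∑ i ∈ active x, rate lam alpha i

lemma totalRate_pos (hlam : ∀ k, 0 < lam k) (halpha : ∀ k, 0 < alpha k) (x : Orbits) :
    0 < totalRate lam alpha x :=
  Finset.sum_pos (fun i _ => rate_pos hlam halpha i) ⟨_, arrival_mem_active x 0⟩

lemma measurable_afterService (j : Bool × Fin 2) (x : Orbits) : Measurable (afterService j x) := by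
  unfold afterService; fun_prop

variable (hlam : ∀ k, 0 < lam k) (halpha : ∀ k, 0 < alpha k) [∀ k, IsProbabilityMeasure (F k)]
  (hF0 : ∀ k, F k (Set.Iio 0) = 0)

instance : IsProbabilityMeasure (serviceLaw F) := by unfold serviceLaw; infer_instance

include hlam halpha in
lemma isProbabilityMeasure_worldLaw : IsProbabilityMeasure (worldLaw lam alpha F) := by
  have := isProbabilityMeasure_clockLaw (rate_pos hlam halpha)
  unfold worldLaw; infer_instance

include hF0 in
lemma ae_service_nonneg : ∀ᵐ σ ∂serviceLaw F, ∀ k n, 0 ≤ σ k n := by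
  refine ae_all_iff.2 fun k => ?_
  refine (Measure.quasiMeasurePreserving_eval (fun k => iidLaw (F k)) k).ae (ae_iidLaw _ ?_)
  rw [ae_iff]
  simp only [not_le]
  exact hF0 k

include hlam halpha hF0 in
lemma ae_good : ∀ᵐ w ∂worldLaw lam alpha F, Good w := by
  have := isProbabilityMeasure_clockLaw (rate_pos hlam halpha)
  have h1 := Measure.quasiMeasurePreserving_fst (μ := clockLaw (rate lam alpha))
    (ν := serviceLaw F) |>.ae (ae_regular_clockLaw (rate_pos hlam halpha))
  have h2 := Measure.quasiMeasurePreserving_snd (μ := clockLaw (rate lam alpha))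
    (ν := serviceLaw F) |>.ae (ae_service_nonneg hF0)
  filter_upwards [h1, h2] with w h1 h2
  exact ⟨h1, h2⟩

include hlam halpha hF0 in
/-- The law of the first cycle and of the world seen from its end. -/
lemma lintegral_step (x : Orbits) {Ψ : (ℝ × Orbits) × World → ℝ≥0∞} (hΨ : Measurable Ψ) :
    ∫⁻ w, Ψ ((stepDuration w x, stepOrbits w x), stepWorld w x) ∂worldLaw lam alpha F =
      ∑ j ∈ active x, ENNReal.ofReal (rate lam alpha j / totalRate lam alpha x) *
        ∫⁻ s, ∫⁻ S, ∫⁻ n, ∫⁻ w, Ψ ((s + S, afterService j x n), w) ∂worldLaw lam alpha F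
          ∂(Measure.pi fun i => poissonMeasure (rate lam alpha i * S).toNNReal)
          ∂F j.2 ∂expMeasure (totalRate lam alpha x) := by
  classical
  have hr := rate_pos hlam halpha
  have := isProbabilityMeasure_clockLaw hr
  have := isProbabilityMeasure_worldLaw hlam halpha (F := F)
  have := isProbabilityMeasure_expMeasure (totalRate_pos hlam halpha x)
  -- The cycle after the race won by `j`: `q.1` holds the idle time and the clocks restarted at its
  -- end, `q.2` the service time and the remaining services. The clocks are restarted a second time
  -- after the service.
  set Θ : Bool × Fin 2 → ((ℝ × (Bool × Fin 2 → ℕ → ℝ)) × (ℝ × (Fin 2 → ℕ → ℝ))) → ℝ≥0∞ :=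
    fun j q => Ψ ((q.1.1 + q.2.1, afterService j x fun i => count (q.1.2 i) q.2.1),
      (fun i => restart (q.1.2 i) q.2.1, q.2.2)) with hΘdef
  have hΘ : ∀ j, Measurable (Θ j) := by
    intro j
    have h1 : Measurable fun q : (ℝ × (Bool × Fin 2 → ℕ → ℝ)) × (ℝ × (Fin 2 → ℕ → ℝ)) =>
        (q.1.2, q.2.1) := by fun_prop
    have h2 := (measurable_counts (ι := Bool × Fin 2)).comp h1
    have h3 := (measurable_restarts (ι := Bool × Fin 2)).comp h1
    simp only [Function.comp_def] at h2 h3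
    have h4 := (measurable_afterService j x).comp h2
    simp only [Function.comp_def] at h4
    refine hΨ.comp (Measurable.prodMk (Measurable.prodMk (by fun_prop) h4) (h3.prodMk (by fun_prop)))
  have hmain : Measurable fun w : World =>
      Ψ ((stepDuration w x, stepOrbits w x), stepWorld w x) :=
    hΨ.comp (((measurable_stepDuration x).prodMk (measurable_stepOrbits x)).prodMk
      (measurable_stepWorld x))
  have hσ : ∀ᵐ σ ∂serviceLaw F,
      ∫⁻ c, Ψ ((stepDuration (c, σ) x, stepOrbits (c, σ) x), stepWorld (c, σ) x)
        ∂clockLaw (rate lam alpha) =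
      ∑ j ∈ active x, ENNReal.ofReal (rate lam alpha j / totalRate lam alpha x) *
        ∫⁻ s, ∫⁻ c, Θ j ((s, c), (σ j.2 0, fun l n => σ l (n + 1))) ∂clockLaw (rate lam alpha)
          ∂expMeasure (totalRate lam alpha x) := by
    filter_upwards [ae_service_nonneg hF0] with σ hσ
    have hΘσ : ∀ j, Measurable fun p : ℝ × (Bool × Fin 2 → ℕ → ℝ) =>
        Θ j (p, (σ j.2 0, fun l n => σ l (n + 1))) := fun j =>
      (hΘ j).comp measurable_prodMk_right
    have h1 : ∀ᵐ c ∂clockLaw (rate lam alpha),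
        Ψ ((stepDuration (c, σ) x, stepOrbits (c, σ) x), stepWorld (c, σ) x) =
        ∑ j ∈ active x, if Wins (active x) c j then
          Θ j ((c j 0, fun i => restart (c i) (c j 0)), (σ j.2 0, fun l n => σ l (n + 1)))
          else 0 := by
      filter_upwards [ae_exists_wins hr (active x) ⟨_, arrival_mem_active x 0⟩,
        ae_regular_clockLaw hr] with c ⟨j, hj, hjw⟩ hc
      have hw : Good (c, σ) := ⟨hc, hσ⟩
      rw [Finset.sum_eq_single_of_mem j hj, if_pos hjw, stepDuration_of_wins hw hj hjw,
        stepOrbits_of_wins hw hj hjw, stepWorld_of_wins hw hj hjw]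
      intro i hi hij
      rw [if_neg]
      exact fun h => hij (h.unique hi hj hjw)
    have hjm : ∀ j : Bool × Fin 2, Measurable fun c : Bool × Fin 2 → ℕ → ℝ =>
        (c j 0, fun i => restart (c i) (c j 0)) := by
      intro j
      have h : Measurable fun c : Bool × Fin 2 → ℕ → ℝ => (c, c j 0) := by fun_prop
      have h1 := (measurable_snd.prodMk measurable_restarts).comp h
      simpa only [Function.comp_def] using h1
    rw [lintegral_congr_ae h1, lintegral_finsetSum]
    · exact Finset.sum_congr rfl fun j hj => lintegral_race_expMeasure hr (active x) hj (hΘσ j)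
    · intro j _
      exact Measurable.ite (measurableSet_wins _ j) ((hΘσ j).comp (hjm j)) measurable_const
  have hH : ∀ j, Measurable fun p : ℝ × (Fin 2 → ℕ → ℝ) =>
      ∫⁻ s, ∫⁻ c, Θ j ((s, c), p) ∂clockLaw (rate lam alpha)
        ∂expMeasure (totalRate lam alpha x) := by
    intro j
    have h1 : Measurable fun q : ((ℝ × (Fin 2 → ℕ → ℝ)) × ℝ) × (Bool × Fin 2 → ℕ → ℝ) =>
        Θ j ((q.1.2, q.2), q.1.1) := (hΘ j).comp (by fun_prop)
    exact h1.lintegral_prod_right'.lintegral_prod_right'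
  have hsh : Measurable fun σ : Fin 2 → ℕ → ℝ => fun l n => σ l (n + 1) := by fun_prop
  have hev : ∀ k : Fin 2, Measurable fun σ : Fin 2 → ℕ → ℝ => (σ k 0, fun l n => σ l (n + 1)) :=
    fun k => Measurable.prodMk (by fun_prop) hsh
  rw [worldLaw, lintegral_prod_symm' _ hmain, lintegral_congr_ae hσ, lintegral_finsetSum]
  swap
  · intro j _
    exact ((hH j).comp (hev j.2)).const_mul _
  refine Finset.sum_congr rfl fun j _ => ?_
  have hHev := (hH j).comp (hev j.2)
  simp only [Function.comp_def] at hHev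
  rw [lintegral_const_mul _ hHev, lintegral_serviceLaw F j.2 (hH j)]
  congr 1
  rw [← lintegral_prod _ (hH j).aemeasurable, lintegral_lintegral_swap]
  swap
  · have h1 : Measurable fun q : ((ℝ × (Fin 2 → ℕ → ℝ)) × ℝ) × (Bool × Fin 2 → ℕ → ℝ) =>
        Θ j ((q.1.2, q.2), q.1.1) := (hΘ j).comp (by fun_prop)
    exact h1.lintegral_prod_right'.aemeasurable
  refine lintegral_congr fun s => ?_
  have h2 : Measurable fun q : (ℝ × (Fin 2 → ℕ → ℝ)) × (Bool × Fin 2 → ℕ → ℝ) =>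
        Θ j ((s, q.2), q.1) := (hΘ j).comp (by fun_prop)
  rw [lintegral_prod _ h2.lintegral_prod_right'.aemeasurable]
  have hS0 : ∀ᵐ S ∂F j.2, 0 ≤ S := by
    rw [ae_iff]; simp only [not_le]; exact hF0 j.2
  refine lintegral_congr_ae ?_
  filter_upwards [hS0] with S hS
  have h3 : Measurable fun q : (Bool × Fin 2 → ℕ) × (Bool × Fin 2 → ℕ → ℝ) × (Fin 2 → ℕ → ℝ) =>
      Ψ ((s + S, afterService j x q.1), q.2) :=
    hΨ.comp (Measurable.prodMk (measurable_const.prodMk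
      ((measurable_afterService j x).comp measurable_fst)) measurable_snd)
  have h4 : Measurable fun q : ((Fin 2 → ℕ → ℝ) × (Bool × Fin 2 → ℕ)) × (Bool × Fin 2 → ℕ → ℝ) =>
      Ψ ((s + S, afterService j x q.1.2), (q.2, q.1.1)) := by
    have h : Measurable fun q : ((Fin 2 → ℕ → ℝ) × (Bool × Fin 2 → ℕ)) × (Bool × Fin 2 → ℕ → ℝ) =>
      (q.1.2, (q.2, q.1.1)) := by fun_prop
    exact h3.comp h
  have h5 : ∀ σ, ∫⁻ c, Θ j ((s, c), (S, σ)) ∂clockLaw (rate lam alpha) =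
      ∫⁻ n, ∫⁻ c, Ψ ((s + S, afterService j x n), (c, σ)) ∂clockLaw (rate lam alpha)
        ∂(Measure.pi fun i => poissonMeasure (rate lam alpha i * S).toNNReal) := by
    intro σ
    have h6 : Measurable fun q : (Bool × Fin 2 → ℕ) × (Bool × Fin 2 → ℕ → ℝ) =>
        Ψ ((s + S, afterService j x q.1), (q.2, σ)) := by
      have h : Measurable fun q : (Bool × Fin 2 → ℕ) × (Bool × Fin 2 → ℕ → ℝ) =>
        (q.1, (q.2, σ)) := by fun_prop
      exact h3.comp h
    exact lintegral_counts_restarts hr hS h6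
  rw [lintegral_congr h5, lintegral_lintegral_swap h4.lintegral_prod_right'.aemeasurable]
  refine lintegral_congr fun n => ?_
  rw [lintegral_prod_symm']
  exact hΨ.comp (Measurable.prodMk measurable_const measurable_id)

include hlam halpha hF0 in
/-- The world seen from the end of the first cycle is independent of that cycle and has the
original law. -/
lemma lintegral_regeneration (x : Orbits) {Ψ : (ℝ × Orbits) × World → ℝ≥0∞} (hΨ : Measurable Ψ) :
    ∫⁻ w, Ψ ((stepDuration w x, stepOrbits w x), stepWorld w x) ∂worldLaw lam alpha F =
      ∫⁻ w, ∫⁻ w', Ψ ((stepDuration w x, stepOrbits w x), w') ∂worldLaw lam alpha F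
        ∂worldLaw lam alpha F := by
  have := isProbabilityMeasure_worldLaw hlam halpha (F := F)
  have h : Measurable fun q : (ℝ × Orbits) × World => ∫⁻ w', Ψ (q.1, w') ∂worldLaw lam alpha F :=
    hΨ.lintegral_prod_right'.comp measurable_fst
  -- In the formula of `lintegral_step` the final world is integrated separately from the cycle.
  -- Hence the same formula results when `Ψ` is first averaged over its last argument.
  rw [lintegral_step hlam halpha hF0 x hΨ]
  have h2 := lintegral_step hlam halpha hF0 x h
  simp only [lintegral_const, measure_univ, mul_one] at h2
  exact h2.symm

include hlam halpha hF0 in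
-- The regeneration of a single cycle propagates by induction: after `n` cycles the remaining world
-- is fresh and independent of the departure instant and orbits reached.
lemma lintegral_run (x₀ : Orbits) (n : ℕ) {Φ : (ℝ × Orbits) × World → ℝ≥0∞} (hΦ : Measurable Φ) :
    ∫⁻ w, Φ (run x₀ w n) ∂worldLaw lam alpha F =
      ∫⁻ w, ∫⁻ w', Φ ((run x₀ w n).1, w') ∂worldLaw lam alpha F ∂worldLaw lam alpha F := by
  have := isProbabilityMeasure_worldLaw hlam halpha (F := F)
  induction n generalizing Φ with
  | zero => simp [run]
  | succ n ih =>
    have h1 : Measurable fun q : (ℝ × Orbits) × World =>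
        ∫⁻ w', Φ ((cycleMap q).1, w') ∂worldLaw lam alpha F :=
      hΦ.lintegral_prod_right'.comp (measurable_fst.comp measurable_cycleMap)
    simp only [run_succ]
    -- The induction hypothesis is applied on both sides, so that cycle `n + 1` is driven by a fresh
    -- world in each; the regeneration of one cycle then compares the integrands.
    have h3 := ih (hΦ.comp measurable_cycleMap)
    simp only [Function.comp_def] at h3
    rw [h3, ih h1]
    refine lintegral_congr fun w => ?_
    have h2 : Measurable fun q : (ℝ × Orbits) × World =>
        Φ (((run x₀ w n).1.1 + q.1.1, q.1.2), q.2) := hΦ.comp (by fun_prop)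
    exact lintegral_regeneration hlam halpha hF0 (run x₀ w n).1.2 h2

include hlam halpha hF0 in
/-- The Markov property at departures. -/
lemma lintegral_run_succ (x₀ : Orbits) (n : ℕ) {Φ : (ℝ × Orbits) × (ℝ × Orbits) → ℝ≥0∞}
    (hΦ : Measurable Φ) :
    ∫⁻ w, Φ ((run x₀ w n).1, (run x₀ w (n + 1)).1) ∂worldLaw lam alpha F =
      ∫⁻ w, ∫⁻ w', Φ ((run x₀ w n).1, ((run x₀ w n).1.1 + stepDuration w' (run x₀ w n).1.2,
        stepOrbits w' (run x₀ w n).1.2)) ∂worldLaw lam alpha F ∂worldLaw lam alpha F :=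
  lintegral_run hlam halpha hF0 x₀ n
    (hΦ.comp (measurable_fst.prodMk (measurable_fst.comp measurable_cycleMap)))

end Step

/-! ### The law of the driving variables -/

section Law

variable {Ω : Type*} [MeasurableSpace Ω] {P : Measure Ω}
  {lam alpha : Fin 2 → ℝ} {F : Fin 2 → Measure ℝ} {U : Source → Fin 2 → ℕ → Ω → ℝ}

/-- The address of a clock or a sequence of services among the driving variables. -/
def address : (Bool × Fin 2) ⊕ Fin 2 → Source × Fin 2
  | .inl (false, k) => (.arrival, k)
  | .inl (true, k) => (.retrial, k)
  | .inr k => (.service, k)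

lemma address_injective : Function.Injective address := by
  rintro (⟨b, k⟩ | k) (⟨b', k'⟩ | k') h <;> try cases b
  all_goals try cases b'
  all_goals simp_all [address]

/-- The law of the gaps of a clock, or of the services. -/
noncomputable def sequenceLaw (lam alpha : Fin 2 → ℝ) (F : Fin 2 → Measure ℝ) :
    (Bool × Fin 2) ⊕ Fin 2 → Measure ℝ
  | .inl i => expMeasure (rate lam alpha i)
  | .inr k => F k

lemma sourceLaw_address (i : (Bool × Fin 2) ⊕ Fin 2) :
    sourceLaw lam alpha F (address i).1 (address i).2 = sequenceLaw lam alpha F i := by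
  rcases i with ⟨b, k⟩ | k
  · cases b <;> rfl
  · rfl

/-- Joint independence of the single variables, reindexed along `address` and curried, makes the six
sequences independent and each of them i.i.d. -/
lemma map_ofPath (hlam : ∀ k, 0 < lam k) (halpha : ∀ k, 0 < alpha k)
    [∀ k, IsProbabilityMeasure (F k)] (hU : Drives P lam alpha F U) :
    P.map (fun ω => ofPath (pathAt U ω)) = worldLaw lam alpha F := by
  have := fun i => isProbabilityMeasure_expMeasure (rate_pos hlam halpha i)
  have hprob : ∀ i, IsProbabilityMeasure (sequenceLaw lam alpha F i) := by
    rintro (i | k) <;> simp only [sequenceLaw] <;> infer_instance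
  set e : ((Bool × Fin 2) ⊕ Fin 2) × ℕ → Source × Fin 2 × ℕ :=
    fun p => ((address p.1).1, (address p.1).2, p.2) with he
  have hinj : Function.Injective e := by
    rintro ⟨i, n⟩ ⟨i', n'⟩ h
    simp only [he, Prod.mk.injEq] at h
    exact Prod.ext (address_injective (Prod.ext h.1 h.2.1)) h.2.2
  have h1 := (hU.indep.precomp hinj).map_fun_eq_infinitePi_map fun p => hU.measurable _ _ _
  simp only [he, hU.law, sourceLaw_address] at h1
  have h2 := Measure.infinitePi_map_curry (X := ℝ)
    (fun (i : (Bool × Fin 2) ⊕ Fin 2) (_ : ℕ) => sequenceLaw lam alpha F i)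
  have hm1 : Measurable fun ω => fun p : ((Bool × Fin 2) ⊕ Fin 2) × ℕ =>
      U (address p.1).1 (address p.1).2 p.2 ω :=
    measurable_pi_lambda _ fun p => hU.measurable _ _ _
  rw [← h1, Measure.map_map (MeasurableEquiv.measurable _) hm1, Measure.infinitePi_eq_pi] at h2
  have h3 := (measurePreserving_sumPiEquivProdPi
    (X := fun _ : (Bool × Fin 2) ⊕ Fin 2 => ℕ → ℝ)
    (fun i => iidLaw (sequenceLaw lam alpha F i))).map_eq
  have h4 : (Measure.pi fun i => iidLaw (sequenceLaw lam alpha F i)) =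
    P.map (MeasurableEquiv.curry _ _ ℝ ∘ fun ω => fun p : ((Bool × Fin 2) ⊕ Fin 2) × ℕ =>
      U (address p.1).1 (address p.1).2 p.2 ω) := h2.symm
  rw [h4, Measure.map_map (MeasurableEquiv.measurable _)
    ((MeasurableEquiv.measurable _).comp hm1)] at h3
  have h5 : (fun ω => ofPath (pathAt U ω)) =
      (MeasurableEquiv.sumPiEquivProdPi fun _ : (Bool × Fin 2) ⊕ Fin 2 => ℕ → ℝ) ∘
      (MeasurableEquiv.curry _ _ ℝ ∘ fun ω => fun p : ((Bool × Fin 2) ⊕ Fin 2) × ℕ =>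
      U (address p.1).1 (address p.1).2 p.2 ω) := by
    funext ω
    refine Prod.ext ?_ ?_
    · funext i n
      obtain ⟨b, k⟩ := i
      cases b <;> rfl
    · funext k n
      rfl
  rw [h5, h3]
  rfl

lemma measurable_ofPath_pathAt (hU : Drives P lam alpha F U) :
    Measurable fun ω => ofPath (pathAt U ω) := by
  have := hU.measurable
  refine Measurable.prodMk (measurable_pi_lambda _ fun i => measurable_pi_lambda _ fun n => ?_)
    (measurable_pi_lambda _ fun k => measurable_pi_lambda _ fun n => this _ _ _)
  split_ifs
  exacts [this _ _ _, this _ _ _]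

end Law

/-! ### Moments of Poisson variables and of services -/

lemma lintegral_natCast_poissonMeasure (r : NNReal) :
    ∫⁻ n : ℕ, (n : ℝ≥0∞) ∂poissonMeasure r = r := by
  have h1 := measure_univ (μ := poissonMeasure r)
  rw [← lintegral_one, lintegral_countable'] at h1
  rw [lintegral_countable', tsum_eq_zero_add' ENNReal.summable]
  simp only [Nat.cast_zero, zero_mul, zero_add]
  conv_rhs => rw [← mul_one (r : ℝ≥0∞), ← h1, ← ENNReal.tsum_mul_left]
  refine tsum_congr fun n => ?_
  rw [poissonMeasure_singleton, poissonMeasure_singleton, one_mul, ← ENNReal.ofReal_natCast,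
    ← ENNReal.ofReal_mul (by positivity), ← ENNReal.ofReal_coe_nnreal,
    ← ENNReal.ofReal_mul (by positivity)]
  congr 1
  rw [Nat.factorial_succ]
  push_cast
  field_simp
  ring

lemma lintegral_exp_poissonMeasure (r : NNReal) (κ : ℝ) :
    ∫⁻ n : ℕ, ENNReal.ofReal (Real.exp (κ * n)) ∂poissonMeasure r =
      ENNReal.ofReal (Real.exp (r * (Real.exp κ - 1))) := by
  -- Exponential tilting: the Poisson weights of parameter `r`, multiplied by `exp(κ n)`, are
  -- proportional to those of parameter `r exp κ`.
  set r' : NNReal := r * (Real.exp κ).toNNReal with hr'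
  have hr'c : (r' : ℝ) = r * Real.exp κ := by
    rw [hr', NNReal.coe_mul, Real.coe_toNNReal _ (Real.exp_pos _).le]
  have h1 := measure_univ (μ := poissonMeasure r')
  rw [← lintegral_one, lintegral_countable'] at h1
  rw [lintegral_countable']
  conv_rhs => rw [← mul_one (ENNReal.ofReal _), ← h1, ← ENNReal.tsum_mul_left]
  refine tsum_congr fun n => ?_
  rw [poissonMeasure_singleton, poissonMeasure_singleton, one_mul,
    ← ENNReal.ofReal_mul (by positivity), ← ENNReal.ofReal_mul (by positivity), hr'c]
  congr 1
  rw [mul_pow, ← Real.exp_nat_mul, show (r : ℝ) * (Real.exp κ - 1) = r * Real.exp κ + -r by ring,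
    Real.exp_add, Real.exp_neg (r * Real.exp κ), mul_comm κ]
  field_simp

/-- A failure rate of at least `c` bounds the tail by the density, `F (x, ∞) ≤ f x / c`. Inserted in
the layer-cake formula for `exp(κ min(s, T))` with `κ = c / 2`, this bounds its mean `M T` by `1 + M
T / 2`. Hence `M T ≤ 2` for all `T`, and monotone convergence removes the truncation. -/
lemma ClassD.exists_lintegral_exp_lt_top {F : Measure ℝ} (hF : ClassD F) :
    ∃ κ > 0, ∫⁻ s, ENNReal.ofReal (Real.exp (κ * s)) ∂F < ⊤ := by
  have := hF.prob
  obtain ⟨f, hfm, hf0, hFf, c, hc, hrate⟩ := hF.rate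
  have hpos : ∀ᵐ s ∂F, 0 ≤ s := by
    rw [ae_iff]; simp only [not_le]; exact hF.nonneg
  have htail : ∀ x, 0 ≤ x → F (Set.Ioi x) ≤ ENNReal.ofReal (f x / c) := by
    intro x hx
    have h1 : F (Set.Ioi x) = ENNReal.ofReal (1 - cdf F x) := by
      rw [← ofReal_measureReal, ← Set.compl_Iic, probReal_compl_eq_one_sub measurableSet_Iic,
        cdf_eq_real]
    rw [h1]
    refine ENNReal.ofReal_le_ofReal ?_
    rcases lt_or_ge 0 (1 - cdf F x) with h | h
    · have h2 := hrate x hx h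
      rw [failureRate, le_div_iff₀ h] at h2
      rw [le_div_iff₀ hc]; linarith
    · exact h.trans (div_nonneg (hf0 x) hc.le)
  set κ := c / 2 with hκ
  have hκ0 : 0 < κ := by positivity
  refine ⟨κ, hκ0, ?_⟩
  set M : ℕ → ℝ≥0∞ := fun T => ∫⁻ s, ENNReal.ofReal (Real.exp (κ * min s T)) ∂F with hM
  have hg : Measurable fun x : ℝ => ENNReal.ofReal (κ * Real.exp (κ * x)) := by fun_prop
  have hbound : ∀ T : ℕ, M T ≤ 2 := by
    intro T
    have hfin : M T ≠ ⊤ := by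
      refine ne_top_of_le_ne_top (b := ENNReal.ofReal (Real.exp (κ * T))) (by simp) ?_
      calc M T ≤ ∫⁻ _, ENNReal.ofReal (Real.exp (κ * T)) ∂F := by
            refine lintegral_mono fun s => ENNReal.ofReal_le_ofReal (Real.exp_le_exp.2 ?_)
            gcongr
            exact min_le_right _ _
        _ = _ := by simp
    have hlayer : ∀ s : ℝ, 0 ≤ s → ENNReal.ofReal (Real.exp (κ * min s T)) =
        1 + ∫⁻ x in Set.Ioc 0 (T : ℝ), (if x < s then ENNReal.ofReal (κ * Real.exp (κ * x)) else 0) := by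
      intro s hs
      have hmin : 0 ≤ min s (T : ℝ) := le_min hs (Nat.cast_nonneg T)
      have h1 : ∫⁻ x in Set.Ioc 0 (T : ℝ), (if x < s then ENNReal.ofReal (κ * Real.exp (κ * x)) else 0)
          = ∫⁻ x in Set.Ioc 0 (min s (T : ℝ)), ENNReal.ofReal (κ * Real.exp (κ * x)) := by
        rw [← lintegral_indicator measurableSet_Ioc, ← lintegral_indicator measurableSet_Ioc]
        refine lintegral_congr_ae ?_
        filter_upwards [Measure.ae_ne volume s] with x hx
        simp only [Set.indicator_apply, Set.mem_Ioc, le_min_iff]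
        rcases lt_or_gt_of_ne hx with h | h
        · simp [h, h.le]
        · simp [h.not_gt, h.not_ge]
      have h2 : ∫ x in (0 : ℝ)..(min s (T : ℝ)), κ * Real.exp (κ * x) =
          Real.exp (κ * min s T) - Real.exp (κ * 0) := by
        refine intervalIntegral.integral_eq_sub_of_hasDerivAt (f := fun x => Real.exp (κ * x)) ?_ ?_
        · intro x _
          have := ((hasDerivAt_id x).const_mul κ).exp
          simpa [mul_comm] using this
        · exact (by fun_prop : Continuous fun x => κ * Real.exp (κ * x)).intervalIntegrable _ _
      rw [h1, ← ofReal_integral_eq_lintegral_ofReal, ← intervalIntegral.integral_of_le hmin, h2,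
        mul_zero, Real.exp_zero, ← ENNReal.ofReal_one, ← ENNReal.ofReal_add zero_le_one]
      · congr 1; ring
      · have : 0 ≤ κ * min s T := by positivity
        linarith [Real.add_one_le_exp (κ * min s T)]
      · exact ((by fun_prop : Continuous fun x => κ * Real.exp (κ * x)).integrableOn_Icc
          (a := 0) (b := min s T)).mono_set Set.Ioc_subset_Icc_self
      · exact ae_of_all _ fun x => by positivity
    have hq : Measurable fun p : ℝ × ℝ =>
        if p.2 < p.1 then ENNReal.ofReal (κ * Real.exp (κ * p.2)) else 0 :=
      Measurable.ite (measurableSet_lt measurable_snd measurable_fst) (by fun_prop)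
        measurable_const
    have hrec : M T ≤ 1 + 2⁻¹ * M T := by
      calc M T = ∫⁻ s, (1 + ∫⁻ x in Set.Ioc 0 (T : ℝ),
              (if x < s then ENNReal.ofReal (κ * Real.exp (κ * x)) else 0)) ∂F :=
            lintegral_congr_ae (by filter_upwards [hpos] with s hs using hlayer s hs)
        _ = 1 + ∫⁻ x in Set.Ioc 0 (T : ℝ), ENNReal.ofReal (κ * Real.exp (κ * x)) *
              F (Set.Ioi x) := by
            rw [lintegral_add_left measurable_const, lintegral_one, measure_univ,
              lintegral_lintegral_swap hq.aemeasurable]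
            congr 1
            refine lintegral_congr fun x => ?_
            rw [← lintegral_indicator_one measurableSet_Ioi,
              ← lintegral_const_mul _ (measurable_one.indicator measurableSet_Ioi)]
            refine lintegral_congr fun s => ?_
            by_cases h : x < s <;> simp [h]
        _ ≤ 1 + ∫⁻ x in Set.Ioc 0 (T : ℝ), ENNReal.ofReal (κ * Real.exp (κ * x)) *
              ENNReal.ofReal (f x / c) := by
            gcongr 1 + ?_
            refine setLIntegral_mono (by fun_prop) fun x hx => ?_
            gcongr
            exact htail x hx.1.le
        _ ≤ 1 + ∫⁻ x, 2⁻¹ * (ENNReal.ofReal (f x) *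
              ENNReal.ofReal (Real.exp (κ * min x T))) := by
            gcongr 1 + ?_
            rw [← lintegral_indicator measurableSet_Ioc]
            refine lintegral_mono fun x => ?_
            by_cases hx : x ∈ Set.Ioc 0 (T : ℝ)
            swap
            · rw [Set.indicator_of_notMem hx]; exact zero_le
            rw [Set.indicator_of_mem hx]
            rw [min_eq_left hx.2, ← ENNReal.ofReal_mul (by positivity),
              ← ENNReal.ofReal_mul (hf0 x), show (2 : ℝ≥0∞)⁻¹ = ENNReal.ofReal (2⁻¹) by
                rw [ENNReal.ofReal_inv_of_pos two_pos, ENNReal.ofReal_ofNat],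
              ← ENNReal.ofReal_mul (by positivity)]
            refine ENNReal.ofReal_le_ofReal (le_of_eq ?_)
            rw [hκ]; field_simp
        _ = 1 + 2⁻¹ * M T := by
            rw [lintegral_const_mul _ (by fun_prop), hM]
            simp only
            conv_rhs => rw [hFf, lintegral_withDensity_eq_lintegral_mul _ (by fun_prop) (by fun_prop)]
            rfl
    -- Half of `M T` is cancelled from both sides, which is legitimate because the truncation at `T`
    -- makes it finite.
    have h2 : M T = 2⁻¹ * M T + 2⁻¹ * M T := by
      rw [← add_mul, ENNReal.inv_two_add_inv_two, one_mul]
    have hfin2 : 2⁻¹ * M T ≠ ⊤ := ENNReal.mul_ne_top (by simp) hfin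
    have h3 : 2⁻¹ * M T ≤ 1 := by
      have h4 : 2⁻¹ * M T + 2⁻¹ * M T ≤ 1 + 2⁻¹ * M T := by rw [← h2]; exact hrec
      exact (ENNReal.add_le_add_iff_right hfin2).1 h4
    calc M T = 2 * (2⁻¹ * M T) := by
          rw [← mul_assoc, ENNReal.mul_inv_cancel two_ne_zero (by simp), one_mul]
      _ ≤ 2 * 1 := by gcongr
      _ = 2 := mul_one 2
  refine lt_of_le_of_lt ?_ (ENNReal.ofNat_lt_top (n := 2))
  have hsup : ∀ s : ℝ, ENNReal.ofReal (Real.exp (κ * s)) ≤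
      ⨆ T : ℕ, ENNReal.ofReal (Real.exp (κ * min s T)) := by
    intro s
    obtain ⟨T, hT⟩ := exists_nat_ge s
    refine le_iSup_of_le T ?_
    rw [min_eq_left hT]
  calc ∫⁻ s, ENNReal.ofReal (Real.exp (κ * s)) ∂F
      ≤ ∫⁻ s, ⨆ T : ℕ, ENNReal.ofReal (Real.exp (κ * min s T)) ∂F := lintegral_mono hsup
    _ = ⨆ T, M T := by
        refine lintegral_iSup (fun T => by fun_prop) fun T T' h s => ?_
        refine ENNReal.ofReal_le_ofReal (Real.exp_le_exp.2 ?_)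
        have : (T : ℝ) ≤ T' := by exact_mod_cast h
        gcongr
    _ ≤ 2 := iSup_le hbound

lemma ClassD.integrable_id {F : Measure ℝ} (hF : ClassD F) : Integrable (fun s => s) F := by
  have := hF.prob
  obtain ⟨κ, hκ, h⟩ := hF.exists_lintegral_exp_lt_top
  have hpos : ∀ᵐ s ∂F, 0 ≤ s := by
    rw [ae_iff]; simp only [not_le]; exact hF.nonneg
  have hint : Integrable (fun s => Real.exp (κ * s)) F := by
    refine ⟨by fun_prop, ?_⟩
    rw [hasFiniteIntegral_iff_ofReal (ae_of_all _ fun s => (Real.exp_pos _).le)]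
    exact h
  refine (hint.const_mul κ⁻¹).mono' (by fun_prop) ?_
  filter_upwards [hpos] with s hs
  rw [Real.norm_eq_abs, abs_of_nonneg hs, inv_mul_eq_div, le_div_iff₀ hκ]
  linarith [Real.add_one_le_exp (κ * s)]

lemma ClassD.mean_pos {F : Measure ℝ} (hF : ClassD F) : 0 < ∫ s, s ∂F := by
  have := hF.prob
  obtain ⟨f, hfm, hf0, hFf, -⟩ := hF.rate
  have hpos : ∀ᵐ s ∂F, 0 < s := by
    rw [ae_iff]
    simp only [not_lt]
    have h1 : F {0} = 0 := by
      rw [hFf]; exact withDensity_absolutelyContinuous _ _ Real.volume_singleton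
    have h2 : {s : ℝ | s ≤ 0} = Set.Iio 0 ∪ {0} := by
      ext s; simp [le_iff_lt_or_eq]
    rw [h2]
    exact measure_union_null hF.nonneg h1
  rw [integral_pos_iff_support_of_nonneg_ae (by filter_upwards [hpos] with s hs using hs.le)
    hF.integrable_id]
  have h3 : F (Function.support fun s : ℝ => s) = 1 := by
    rw [← prob_compl_eq_zero_iff (measurableSet_support (f := fun s : ℝ => s) measurable_id)]
    refine measure_mono_null ?_ (ae_iff.1 hpos)
    intro s hs
    simp only [Set.mem_compl_iff, Function.mem_support, not_not] at hs
    simp [hs]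
  rw [h3]; exact one_pos

/-! ### Moments of the first cycle -/

section Moments

variable {lam alpha : Fin 2 → ℝ} {F : Fin 2 → Measure ℝ}
  (hlam : ∀ k, 0 < lam k) (halpha : ∀ k, 0 < alpha k) (hF : ∀ k, ClassD (F k))

/-- The sum of the class means of services weighted by the rates of the clocks. -/
noncomputable def workRate (lam alpha : Fin 2 → ℝ) (F : Fin 2 → Measure ℝ) (x : Orbits) : ℝ :=
  ∑ j ∈ active x, rate lam alpha j * ∫ s, s ∂F j.2

/-- Mean increment of orbit `k` in a cycle that starts with orbits `x`. -/
noncomputable def drift (lam alpha : Fin 2 → ℝ) (F : Fin 2 → Measure ℝ) (x : Orbits) (k : Fin 2) :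
    ℝ :=
  (lam k * workRate lam alpha F x - if 0 < x k then alpha k else 0) / totalRate lam alpha x

lemma lintegral_pi_eval {ν : Bool × Fin 2 → Measure ℕ} [∀ i, IsProbabilityMeasure (ν i)]
    (i : Bool × Fin 2) (f : ℕ → ℝ≥0∞) :
    ∫⁻ n, f (n i) ∂Measure.pi ν = ∫⁻ m, f m ∂ν i := by
  rw [← (measurePreserving_eval ν i).map_eq, lintegral_map (by fun_prop) (by fun_prop)]

include hlam halpha hF in
lemma lintegral_step_fst (x : Orbits) {Ψ : ℝ × Orbits → ℝ≥0∞} (hΨ : Measurable Ψ) :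
    ∫⁻ w, Ψ (stepDuration w x, stepOrbits w x) ∂worldLaw lam alpha F =
      ∑ j ∈ active x, ENNReal.ofReal (rate lam alpha j / totalRate lam alpha x) *
        ∫⁻ s, ∫⁻ S, ∫⁻ n, Ψ (s + S, afterService j x n)
          ∂(Measure.pi fun i => poissonMeasure (rate lam alpha i * S).toNNReal)
          ∂F j.2 ∂expMeasure (totalRate lam alpha x) := by
  have := fun k => (hF k).prob
  have := isProbabilityMeasure_worldLaw hlam halpha (F := F)
  have h := lintegral_step hlam halpha (fun k => (hF k).nonneg) x (hΨ.comp measurable_fst)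
  simp only [Function.comp_def, lintegral_const, measure_univ, mul_one] at h
  exact h

include hF in
lemma lintegral_service (k : Fin 2) : ∫⁻ s, ENNReal.ofReal s ∂F k = ENNReal.ofReal (∫ s, s ∂F k) := by
  rw [ofReal_integral_eq_lintegral_ofReal (hF k).integrable_id]
  rw [Filter.EventuallyLE, ae_iff]
  simp only [Pi.zero_apply, not_le]
  exact (hF k).nonneg

include hF in
lemma ae_service_nonneg' (k : Fin 2) : ∀ᵐ s ∂F k, 0 ≤ s := by
  rw [ae_iff]
  simp only [not_le]
  exact (hF k).nonneg

include hlam halpha hF in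
-- The idle period is ended by clock `j` with probability proportional to its rate. Orbit `k` loses
-- a customer exactly when `j` is its retrial clock, and gains a Poisson number of mean `lam k * S`
-- during a service of length `S` of the class of `j`. Working in `ℝ≥0∞` yields integrability
-- together with the value.
lemma lintegral_stepOrbits (x : Orbits) (k : Fin 2) :
    ∫⁻ w, (stepOrbits w x k : ℝ≥0∞) ∂worldLaw lam alpha F =
      ENNReal.ofReal (x k + drift lam alpha F x k) := by
  have := fun k => (hF k).prob
  have hR := totalRate_pos hlam halpha x
  have := isProbabilityMeasure_expMeasure hR
  have hm : Measurable fun p : ℝ × Orbits => (p.2 k : ℝ≥0∞) := by fun_prop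
  have h := lintegral_step_fst hlam halpha hF x hm
  have hpos : ∀ j, 0 < rate lam alpha j := rate_pos hlam halpha
  have hj : ∀ j ∈ active x, ENNReal.ofReal (rate lam alpha j / totalRate lam alpha x) *
        ∫⁻ _, ∫⁻ S, ∫⁻ n, (afterService j x n k : ℝ≥0∞)
          ∂(Measure.pi fun i => poissonMeasure (rate lam alpha i * S).toNNReal)
          ∂F j.2 ∂expMeasure (totalRate lam alpha x) =
      ENNReal.ofReal (rate lam alpha j / totalRate lam alpha x *
        ((x k - if j = (true, k) then 1 else 0) + lam k * ∫ s, s ∂F j.2)) := by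
    intro j hj
    have h1 : ∀ S, ∫⁻ n, (afterService j x n k : ℝ≥0∞)
          ∂(Measure.pi fun i => poissonMeasure (rate lam alpha i * S).toNNReal) =
        ENNReal.ofReal (x k - if j = (true, k) then 1 else 0) + ENNReal.ofReal (lam k * S) := by
      intro S
      have h2 : ((if j = (true, k) then x k - 1 else x k : ℕ) : ℝ≥0∞) =
          ENNReal.ofReal (x k - if j = (true, k) then 1 else 0) := by
        split_ifs with hjk
        · have : 1 ≤ x k := retrial_mem_active.1 (hjk ▸ hj)
          rw [← ENNReal.ofReal_natCast, Nat.cast_sub this, Nat.cast_one]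
        · simp
      simp only [afterService, Nat.cast_add, h2]
      rw [lintegral_add_left measurable_const, lintegral_const, measure_univ, mul_one,
        lintegral_pi_eval (false, k) fun m => (m : ℝ≥0∞), lintegral_natCast_poissonMeasure]
      rfl
    have h3 : 0 ≤ (x k : ℝ) - if j = (true, k) then 1 else 0 := by
      split_ifs with hjk
      · have : 1 ≤ x k := retrial_mem_active.1 (hjk ▸ hj)
        have : (1 : ℝ) ≤ x k := by exact_mod_cast this
        linarith
      · simp
    have h4 : 0 ≤ lam k * ∫ s, s ∂F j.2 := mul_nonneg (hlam k).le (hF j.2).mean_pos.le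
    simp only [h1]
    rw [lintegral_const, measure_univ, mul_one, lintegral_add_left measurable_const,
      lintegral_const, measure_univ, mul_one]
    simp_rw [ENNReal.ofReal_mul (hlam k).le]
    rw [lintegral_const_mul _ (by fun_prop), lintegral_service hF, ← ENNReal.ofReal_mul (hlam k).le,
      ← ENNReal.ofReal_add h3 h4, ← ENNReal.ofReal_mul (div_nonneg (hpos j).le hR.le)]
  rw [h, Finset.sum_congr rfl hj, ← ENNReal.ofReal_sum_of_nonneg]
  · congr 1
    have h5 : ∀ j ∈ active x, rate lam alpha j / totalRate lam alpha x *
        ((x k - if j = (true, k) then 1 else 0) + lam k * ∫ s, s ∂F j.2) =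
        (rate lam alpha j * x k - (if j = (true, k) then rate lam alpha j else 0) +
          lam k * (rate lam alpha j * ∫ s, s ∂F j.2)) / totalRate lam alpha x := by
      intro j _
      split_ifs <;> ring
    rw [Finset.sum_congr rfl h5, ← Finset.sum_div, Finset.sum_add_distrib, Finset.sum_sub_distrib,
      ← Finset.sum_mul, ← Finset.mul_sum, Finset.sum_ite_eq', drift, ← workRate, ← totalRate]
    simp only [retrial_mem_active]
    have : rate lam alpha (true, k) = alpha k := rfl
    rw [this]
    field_simp
    ring
  · intro j hj
    refine mul_nonneg (div_nonneg (hpos j).le hR.le) (add_nonneg ?_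
      (mul_nonneg (hlam k).le (hF j.2).mean_pos.le))
    split_ifs with hjk
    · have : 1 ≤ x k := retrial_mem_active.1 (hjk ▸ hj)
      have : (1 : ℝ) ≤ x k := by exact_mod_cast this
      linarith
    · simp

include hlam halpha hF in
-- The mean found in `ℝ≥0∞` is an `ENNReal.ofReal`; this bound recovers the real number. A non-empty
-- orbit loses at most one customer, and `alpha k` is part of the total rate.
lemma add_drift_nonneg (x : Orbits) (k : Fin 2) : 0 ≤ x k + drift lam alpha F x k := by
  have hR := totalRate_pos hlam halpha x
  have hw : 0 ≤ lam k * workRate lam alpha F x := mul_nonneg (hlam k).le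
    (Finset.sum_nonneg fun j _ => mul_nonneg (rate_pos hlam halpha j).le (hF j.2).mean_pos.le)
  rw [drift]
  split_ifs with h
  · have h1 : (1 : ℝ) ≤ x k := by exact_mod_cast h
    have h2 : alpha k ≤ totalRate lam alpha x :=
      Finset.single_le_sum (f := rate lam alpha) (fun i _ => (rate_pos hlam halpha i).le)
        (retrial_mem_active.2 h)
    have h3 : -1 ≤ (lam k * workRate lam alpha F x - alpha k) / totalRate lam alpha x := by
      rw [le_div_iff₀ hR]; linarith
    linarith
  · rw [sub_zero]; positivity

include hlam halpha hF in
lemma integrable_stepOrbits (x : Orbits) (k : Fin 2) :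
    Integrable (fun w => (stepOrbits w x k : ℝ)) (worldLaw lam alpha F) ∧
      ∫ w, (stepOrbits w x k : ℝ) ∂worldLaw lam alpha F = x k + drift lam alpha F x k := by
  have h := lintegral_stepOrbits hlam halpha hF x k
  have hm : Measurable fun w => (stepOrbits w x k : ℝ) := by
    have h1 : Measurable fun y : Orbits => (y k : ℝ) := by fun_prop
    exact h1.comp (measurable_stepOrbits x)
  have h0 : ∀ᵐ w ∂worldLaw lam alpha F, 0 ≤ (stepOrbits w x k : ℝ) :=
    ae_of_all _ fun w => Nat.cast_nonneg _
  constructor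
  · refine ⟨hm.aestronglyMeasurable, ?_⟩
    rw [hasFiniteIntegral_iff_ofReal h0]
    simp only [ENNReal.ofReal_natCast, h, ENNReal.ofReal_lt_top]
  · rw [integral_eq_lintegral_of_nonneg_ae h0 hm.aestronglyMeasurable]
    simp only [ENNReal.ofReal_natCast, h]
    exact ENNReal.toReal_ofReal (add_drift_nonneg hlam halpha hF x k)

/-- Length of a cycle plus the orbits at its end. -/
noncomputable def stepSize (w : World) (x : Orbits) : ℝ :=
  stepDuration w x + stepOrbits w x 0 + stepOrbits w x 1

lemma measurable_stepSize (x : Orbits) : Measurable fun w => stepSize w x := by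
  have h : ∀ k, Measurable fun w => (stepOrbits w x k : ℝ) := fun k => by
    have h1 : Measurable fun y : Orbits => (y k : ℝ) := by fun_prop
    exact h1.comp (measurable_stepOrbits x)
  exact ((measurable_stepDuration x).add (h 0)).add (h 1)

/-- The sum is at most four times its largest term. Thus an exponential moment of a sum reduces to
moments of the summands, although they are dependent. -/
lemma exp_add_four_le {κ : ℝ} (hκ : 0 ≤ κ) (a b c d : ℝ) :
    Real.exp (κ * (a + b + c + d)) ≤ Real.exp (4 * κ * a) + Real.exp (4 * κ * b) +
      Real.exp (4 * κ * c) + Real.exp (4 * κ * d) := by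
  obtain ⟨m, hm, ha, hb, hc, hd⟩ : ∃ m, (m = a ∨ m = b ∨ m = c ∨ m = d) ∧ a ≤ m ∧ b ≤ m ∧
      c ≤ m ∧ d ≤ m := by
    rcases le_total a b with h1 | h1 <;> rcases le_total c d with h2 | h2
    · rcases le_total b d with h3 | h3
      exacts [⟨d, by simp, by linarith, h3, h2, le_rfl⟩, ⟨b, by simp, h1, le_rfl, by linarith, h3⟩]
    · rcases le_total b c with h3 | h3
      exacts [⟨c, by simp, by linarith, h3, le_rfl, h2⟩, ⟨b, by simp, h1, le_rfl, h3, by linarith⟩]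
    · rcases le_total a d with h3 | h3
      exacts [⟨d, by simp, h3, by linarith, h2, le_rfl⟩, ⟨a, by simp, le_rfl, h1, by linarith, h3⟩]
    · rcases le_total a c with h3 | h3
      exacts [⟨c, by simp, h3, by linarith, le_rfl, h2⟩, ⟨a, by simp, le_rfl, h1, h3, by linarith⟩]
  have h1 : Real.exp (κ * (a + b + c + d)) ≤ Real.exp (4 * κ * m) := by
    refine Real.exp_le_exp.2 ?_
    nlinarith
  have ea := Real.exp_pos (4 * κ * a)
  have eb := Real.exp_pos (4 * κ * b)
  have ec := Real.exp_pos (4 * κ * c)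
  have ed := Real.exp_pos (4 * κ * d)
  rcases hm with rfl | rfl | rfl | rfl <;> linarith

include hlam halpha hF in
lemma exists_lintegral_exp_stepSize_lt_top (x : Orbits) :
    ∃ κ > 0, ∫⁻ w, ENNReal.ofReal (Real.exp (κ * stepSize w x)) ∂worldLaw lam alpha F < ⊤ := by
  have := fun k => (hF k).prob
  have hR := totalRate_pos hlam halpha x
  have := isProbabilityMeasure_expMeasure hR
  choose κ₀ hκ₀ hfin using fun k => (hF k).exists_lintegral_exp_lt_top
  -- The conditions on `κ` make finite, in turn, the exponential moments of the idle period, of the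
  -- service, and of the Poisson arrivals in a service of length `S`, whose moment is `exp(lam l
  -- (exp κ - 1) S)`.
  have hev : ∀ᶠ κ in 𝓝[>] (0 : ℝ), κ < totalRate lam alpha x ∧
      (∀ k, κ < κ₀ k) ∧ ∀ k l, lam l * (Real.exp κ - 1) < κ₀ k := by
    refine Filter.Eventually.filter_mono nhdsWithin_le_nhds ?_
    refine (eventually_lt_nhds hR).and ((eventually_all.2 fun k => eventually_lt_nhds (hκ₀ k)).and
      (eventually_all.2 fun k => eventually_all.2 fun l => ?_))
    have hc : Continuous fun κ : ℝ => lam l * (Real.exp κ - 1) := by fun_prop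
    have := hc.tendsto 0
    simp only [Real.exp_zero, sub_self, mul_zero] at this
    exact this.eventually_lt_const (hκ₀ k)
  obtain ⟨κ, ⟨hκR, hκk, hκl⟩, hκ⟩ := (hev.and self_mem_nhdsWithin).exists
  have hκ : 0 < κ := hκ
  refine ⟨κ / 4, by positivity, ?_⟩
  have hexpS : ∀ k : Fin 2, ∀ t < κ₀ k, ∫⁻ S, ENNReal.ofReal (Real.exp (t * S)) ∂F k < ⊤ := by
    intro k t ht
    refine lt_of_le_of_lt (lintegral_mono_ae ?_) (hfin k)
    filter_upwards [ae_service_nonneg' hF k] with S hS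
    exact ENNReal.ofReal_le_ofReal (Real.exp_le_exp.2 (by gcongr))
  have hm : Measurable fun p : ℝ × Orbits =>
      ENNReal.ofReal (Real.exp (κ / 4 * (p.1 + p.2 0 + p.2 1))) := by fun_prop
  have h := lintegral_step_fst hlam halpha hF x hm
  change ∫⁻ w, ENNReal.ofReal (Real.exp (κ / 4 * (stepDuration w x + stepOrbits w x 0 +
    stepOrbits w x 1))) ∂worldLaw lam alpha F < ⊤
  rw [h]
  refine ENNReal.sum_lt_top.2 fun j _ => ENNReal.mul_lt_top ENNReal.ofReal_lt_top ?_
  set c : ℝ≥0∞ := ENNReal.ofReal (Real.exp (κ / 4 * (x 0 + x 1))) with hc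
  set A : ℝ → ℝ≥0∞ := fun s => ENNReal.ofReal (Real.exp (κ * s)) with hA
  have hAm : Measurable A := by fun_prop
  set B : Fin 2 → ℝ → ℝ≥0∞ := fun k S =>
    ENNReal.ofReal (Real.exp (lam k * (Real.exp κ - 1) * S)) with hB
  have hBm : ∀ k, Measurable (B k) := fun k => by fun_prop
  have hbound : ∀ s, ∀ S, 0 ≤ S → ∫⁻ n, ENNReal.ofReal (Real.exp (κ / 4 *
        (s + S + afterService j x n 0 + afterService j x n 1)))
          ∂(Measure.pi fun i => poissonMeasure (rate lam alpha i * S).toNNReal) ≤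
      c * (A s + A S + B 0 S + B 1 S) := by
    intro s S hS
    have h1 : ∀ n : Bool × Fin 2 → ℕ, ENNReal.ofReal (Real.exp (κ / 4 *
        (s + S + afterService j x n 0 + afterService j x n 1))) ≤
        c * (A s + A S + A (n (false, 0)) + A (n (false, 1))) := by
      intro n
      have ha : ∀ k, (afterService j x n k : ℝ) ≤ x k + n (false, k) := by
        intro k
        have : afterService j x n k ≤ x k + n (false, k) := by
          simp only [afterService]; split_ifs <;> omega
        exact_mod_cast this
      have h2 := exp_add_four_le (show 0 ≤ κ / 4 by positivity) s S (n (false, 0)) (n (false, 1))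
      rw [show 4 * (κ / 4) = κ by ring] at h2
      simp only [hc, hA]
      rw [← ENNReal.ofReal_add (by positivity) (by positivity),
        ← ENNReal.ofReal_add (by positivity) (by positivity),
        ← ENNReal.ofReal_add (by positivity) (by positivity), ← ENNReal.ofReal_mul (by positivity)]
      refine ENNReal.ofReal_le_ofReal ?_
      refine le_trans ?_ (mul_le_mul_of_nonneg_left h2 (Real.exp_pos _).le)
      rw [← Real.exp_add]
      refine Real.exp_le_exp.2 ?_
      rw [← mul_add]
      refine mul_le_mul_of_nonneg_left ?_ (by positivity)
      linarith [ha 0, ha 1]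
    refine (lintegral_mono h1).trans (le_of_eq ?_)
    have h3 : ∀ k : Fin 2, ∫⁻ n, A (n (false, k))
        ∂(Measure.pi fun i => poissonMeasure (rate lam alpha i * S).toNNReal) = B k S := by
      intro k
      rw [lintegral_pi_eval (false, k) fun m => A m]
      simp only [hA, lintegral_exp_poissonMeasure, hB]
      have : (((rate lam alpha (false, k) * S).toNNReal : NNReal) : ℝ) = lam k * S :=
        Real.coe_toNNReal _ (mul_nonneg (hlam k).le hS)
      rw [this]
      congr 2
      ring
    rw [lintegral_const_mul _ (by fun_prop), lintegral_add_left (by fun_prop),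
      lintegral_add_left (by fun_prop), lintegral_const, measure_univ, mul_one, h3, h3]
  have hcfin : c < ⊤ := ENNReal.ofReal_lt_top
  have hSint : ∀ s, ∫⁻ S, ∫⁻ n, ENNReal.ofReal (Real.exp (κ / 4 *
        (s + S + afterService j x n 0 + afterService j x n 1)))
          ∂(Measure.pi fun i => poissonMeasure (rate lam alpha i * S).toNNReal) ∂F j.2 ≤
      c * (A s + (∫⁻ S, A S ∂F j.2 + ∫⁻ S, B 0 S ∂F j.2 + ∫⁻ S, B 1 S ∂F j.2)) := by
    intro s
    calc _ ≤ ∫⁻ S, c * (A s + A S + B 0 S + B 1 S) ∂F j.2 := by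
          refine lintegral_mono_ae ?_
          filter_upwards [ae_service_nonneg' hF j.2] with S hS using hbound s S hS
      _ = _ := by
          have hm4 : Measurable fun S => A s + A S + B 0 S + B 1 S :=
            ((hAm.const_add _).add (hBm 0)).add (hBm 1)
          rw [lintegral_const_mul _ hm4,
            lintegral_add_right _ (hBm 1), lintegral_add_right _ (hBm 0), lintegral_add_right _ hAm,
            lintegral_const, measure_univ, mul_one]
          ring
  refine lt_of_le_of_lt (lintegral_mono hSint) ?_
  rw [lintegral_const_mul _ (hAm.add_const _), lintegral_add_right _ measurable_const,
    lintegral_const, measure_univ, mul_one]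
  refine ENNReal.mul_lt_top hcfin (ENNReal.add_lt_top.2 ⟨?_, ENNReal.add_lt_top.2
    ⟨ENNReal.add_lt_top.2 ⟨hexpS _ _ (hκk _), hexpS _ _ (hκl _ _)⟩, hexpS _ _ (hκl _ _)⟩⟩)
  simp only [hA]
  rw [lintegral_exp_mul_expMeasure hR hκR]
  exact ENNReal.ofReal_lt_top

end Moments

/-! ### Exponential moments of a variable with negative mean -/

section Chernoff

variable {α : Type*} [MeasurableSpace α] {μ : Measure α} {D Z : α → ℝ}

lemma zero_mem_interior_integrableExpSet (hD : Measurable D) (hZm : Measurable Z) {κ : ℝ}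
    (hκ : 0 < κ) (hZ : ∫⁻ a, ENNReal.ofReal (Real.exp (κ * Z a)) ∂μ < ⊤) {C : ℝ} (hC : 0 < C)
    (hDZ : ∀ᵐ a ∂μ, |D a| ≤ C * (1 + Z a)) : 0 ∈ interior (integrableExpSet D μ) := by
  rw [mem_interior_iff_mem_nhds]
  have hint : Integrable (fun a => Real.exp (κ * Z a)) μ := by
    refine ⟨by fun_prop, ?_⟩
    rwa [hasFiniteIntegral_iff_ofReal (ae_of_all _ fun _ => (Real.exp_pos _).le)]
  filter_upwards [Metric.ball_mem_nhds (0 : ℝ) (show 0 < κ / C by positivity)] with t ht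
  rw [Metric.mem_ball, dist_zero_right, Real.norm_eq_abs, lt_div_iff₀ hC] at ht
  refine (hint.const_mul (Real.exp κ)).mono' (by fun_prop) ?_
  filter_upwards [hDZ] with a ha
  rw [Real.norm_eq_abs, abs_of_pos (Real.exp_pos _), ← Real.exp_add]
  refine Real.exp_le_exp.2 ?_
  have h1 : 0 ≤ 1 + Z a := by
    by_contra h
    have := abs_nonneg (D a)
    nlinarith
  calc t * D a ≤ |t| * |D a| := by rw [← abs_mul]; exact le_abs_self _
    _ ≤ |t| * (C * (1 + Z a)) := by gcongr
    _ = |t| * C * (1 + Z a) := by ring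
    _ ≤ κ * (1 + Z a) := by gcongr
    _ = κ + κ * Z a := by ring

lemma eventually_lintegral_exp_lt_top (h0 : 0 ∈ interior (integrableExpSet D μ)) :
    ∀ᶠ θ in 𝓝[>] (0 : ℝ), ∫⁻ a, ENNReal.ofReal (Real.exp (θ * D a)) ∂μ < ⊤ := by
  refine Filter.Eventually.filter_mono nhdsWithin_le_nhds ?_
  filter_upwards [mem_interior_iff_mem_nhds.1 h0] with θ hθ
  have := hθ.2
  rwa [hasFiniteIntegral_iff_ofReal (ae_of_all _ fun _ => (Real.exp_pos _).le)] at this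

/-- The moment generating function equals one at zero and has the negative derivative `E D` there.
-/
lemma eventually_lintegral_exp_lt_one [IsProbabilityMeasure μ]
    (h0 : 0 ∈ interior (integrableExpSet D μ))
    (hneg : ∫ a, D a ∂μ < 0) :
    ∀ᶠ θ in 𝓝[>] (0 : ℝ), ∫⁻ a, ENNReal.ofReal (Real.exp (θ * D a)) ∂μ < 1 := by
  have hd := hasDerivAt_mgf h0
  simp only [zero_mul, Real.exp_zero, mul_one] at hd
  have h1 := (hasDerivAt_iff_tendsto_slope.1 hd).eventually_lt_const hneg
  have h2 : ∀ᶠ θ in 𝓝[>] (0 : ℝ), slope (mgf D μ) 0 θ < 0 :=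
    h1.filter_mono (nhdsWithin_mono _ fun y hy => ne_of_gt hy)
  have h3 : ∀ᶠ θ in 𝓝[>] (0 : ℝ), θ ∈ integrableExpSet D μ :=
    Filter.Eventually.filter_mono nhdsWithin_le_nhds (mem_interior_iff_mem_nhds.1 h0)
  filter_upwards [h2, h3, self_mem_nhdsWithin] with θ h2 h3 hθ
  have hθ : 0 < θ := hθ
  rw [slope_def_field, sub_zero, div_lt_iff₀ hθ, zero_mul, mgf_zero, sub_neg] at h2
  rw [← ofReal_integral_eq_lintegral_ofReal h3 (ae_of_all _ fun _ => (Real.exp_pos _).le)]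
  exact ENNReal.ofReal_lt_one.2 h2

end Chernoff

/-! ### Dependence of a cycle on the empty orbits only -/

section Pattern

variable {x y : Orbits} (h : ∀ k, 0 < x k ↔ 0 < y k)

include h

lemma active_congr : active x = active y := by simp only [active, h]

lemma attemptTime_congr (u : Path) (d : ℝ) (k : Fin 2) :
    attemptTime u d x k = attemptTime u d y k := by simp only [attemptTime, h]

lemma startTime_congr (u : Path) (d : ℝ) : startTime u d x = startTime u d y := by
  simp only [startTime, attemptTime_congr h]

lemma servedClass_congr (u : Path) (d : ℝ) : servedClass u d x = servedClass u d y := by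
  simp only [servedClass, attemptTime_congr h]

lemma endTime_congr (u : Path) (d : ℝ) (n : ℕ) : endTime u d x n = endTime u d y n := by
  simp only [endTime, startTime_congr h, servedClass_congr h]

lemma stepDuration_congr (w : World) : stepDuration w x = stepDuration w y := endTime_congr h _ _ _

lemma orbitAtStart_congr (u : Path) (d : ℝ) (k : Fin 2) :
    (orbitAtStart u d x k : ℝ) - x k = orbitAtStart u d y k - y k := by
  have h1 : FromOrbit u d x k ↔ FromOrbit u d y k := by
    simp only [FromOrbit, servedClass_congr h, h]
  by_cases h2 : FromOrbit u d y k
  · have hy : 1 ≤ y k := h2.2.1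
    have hx : 1 ≤ x k := (h k).2 hy
    rw [orbitAtStart, if_pos (h1.2 h2), orbitAtStart, if_pos h2, Nat.cast_sub hx, Nat.cast_sub hy]
    ring
  · rw [orbitAtStart, if_neg fun h3 => h2 (h1.1 h3), orbitAtStart, if_neg h2]
    ring

lemma stepOrbits_congr (w : World) (k : Fin 2) :
    (stepOrbits w x k : ℝ) - x k = stepOrbits w y k - y k := by
  have h1 := orbitAtStart_congr h (toPath w) 0 k
  simp only [stepOrbits, orbitsAtEnd, startTime_congr h, endTime_congr h, Nat.cast_add]
  linarith

lemma drift_congr (lam alpha : Fin 2 → ℝ) (F : Fin 2 → Measure ℝ) (k : Fin 2) :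
    drift lam alpha F x k = drift lam alpha F y k := by
  simp only [drift, workRate, totalRate, active_congr h, h]

end Pattern

/-- Orbits with at most one customer, one for each set of empty orbits. -/
def representative (b : Fin 2 → Bool) : Orbits := fun k => if b k then 1 else 0

lemma exists_representative (x : Orbits) : ∃ b, ∀ k, 0 < x k ↔ 0 < representative b k :=
  ⟨fun k => decide (0 < x k), fun k => by by_cases h : 0 < x k <;> simp [representative, h]⟩

/-- A linear combination of the length of a cycle and of the increments of the orbits. -/
noncomputable def increment (a : ℝ) (b : Fin 2 → ℝ) (x : Orbits) (w : World) : ℝ :=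
  a * stepDuration w x + b 0 * (stepOrbits w x 0 - x 0) + b 1 * (stepOrbits w x 1 - x 1)

lemma increment_congr {x y : Orbits} (h : ∀ k, 0 < x k ↔ 0 < y k) (a : ℝ) (b : Fin 2 → ℝ) :
    increment a b x = increment a b y := by
  funext w
  simp only [increment, stepDuration_congr h, stepOrbits_congr h]

lemma measurable_increment (a : ℝ) (b : Fin 2 → ℝ) (x : Orbits) : Measurable (increment a b x) := by
  have h : ∀ k, Measurable fun w => (stepOrbits w x k : ℝ) := fun k => by
    have h1 : Measurable fun y : Orbits => (y k : ℝ) := by fun_prop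
    exact h1.comp (measurable_stepOrbits x)
  have h0 := h 0
  have h1 := h 1
  have h2 := measurable_stepDuration x
  unfold increment
  fun_prop

section Increment

variable {lam alpha : Fin 2 → ℝ} {F : Fin 2 → Measure ℝ}
  (hlam : ∀ k, 0 < lam k) (halpha : ∀ k, 0 < alpha k) (hF : ∀ k, ClassD (F k))

include hlam halpha hF

lemma ae_good_of_classD : ∀ᵐ w ∂worldLaw lam alpha F, Good w := by
  have := fun k => (hF k).prob
  exact ae_good hlam halpha fun k => (hF k).nonneg

lemma zero_mem_interior_increment (a : ℝ) (b : Fin 2 → ℝ) (x : Orbits) :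
    0 ∈ interior (integrableExpSet (increment a b x) (worldLaw lam alpha F)) := by
  obtain ⟨κ, hκ, hfin⟩ := exists_lintegral_exp_stepSize_lt_top hlam halpha hF x
  set C : ℝ := (1 + |a| + |b 0| + |b 1|) * (1 + x 0 + x 1) with hC
  have hC0 : 0 < C := by positivity
  refine zero_mem_interior_integrableExpSet (measurable_increment a b x) (measurable_stepSize x) hκ
    hfin hC0 ?_
  filter_upwards [ae_good_of_classD hlam halpha hF] with w hw
  have hd := (stepDuration_pos hw x).le
  set τ := stepDuration w x
  have hn0 : (0 : ℝ) ≤ stepOrbits w x 0 := Nat.cast_nonneg _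
  have hn1 : (0 : ℝ) ≤ stepOrbits w x 1 := Nat.cast_nonneg _
  have hx0 : (0 : ℝ) ≤ x 0 := Nat.cast_nonneg _
  have hx1 : (0 : ℝ) ≤ x 1 := Nat.cast_nonneg _
  set p : ℝ := (stepOrbits w x 0 : ℝ)
  set q : ℝ := (stepOrbits w x 1 : ℝ)
  have hM : stepSize w x = τ + p + q := rfl
  set M : ℝ := (1 + x 0 + x 1) * (1 + stepSize w x) with hMdef
  have hprod : M = 1 + τ + p + q + x 0 + x 1 + (x 0 + x 1) * (τ + p + q) := by
    rw [hMdef, hM]; ring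
  have hprod0 : 0 ≤ ((x 0 : ℝ) + x 1) * (τ + p + q) := by positivity
  have e1 : τ ≤ M := by rw [hprod]; linarith
  have e2 : |p - x 0| ≤ M := by
    rw [abs_le]; constructor <;> rw [hprod] <;> linarith
  have e3 : |q - x 1| ≤ M := by
    rw [abs_le]; constructor <;> rw [hprod] <;> linarith
  have hM0 : 0 ≤ M := hd.trans e1
  calc |increment a b x w| ≤ |a * τ| + |b 0 * (p - x 0)| + |b 1 * (q - x 1)| := abs_add_three _ _ _
    _ = |a| * τ + |b 0| * |p - x 0| + |b 1| * |q - x 1| := by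
        rw [abs_mul, abs_mul, abs_mul, abs_of_nonneg hd]
    _ ≤ |a| * M + |b 0| * M + |b 1| * M := by gcongr
    _ ≤ (1 + |a| + |b 0| + |b 1|) * M := by nlinarith
    _ = C * (1 + stepSize w x) := by rw [hC, hMdef]; ring

lemma integrable_stepDuration (x : Orbits) :
    Integrable (fun w => stepDuration w x) (worldLaw lam alpha F) := by
  have h := zero_mem_interior_increment hlam halpha hF 1 (fun _ => 0) x
  have h2 := integrable_of_mem_interior_integrableExpSet h
  have h3 : increment 1 (fun _ => 0) x = fun w => stepDuration w x := by
    funext w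
    simp [increment]
  rwa [h3] at h2

lemma integral_increment (a : ℝ) (b : Fin 2 → ℝ) (x : Orbits) :
    ∫ w, increment a b x w ∂worldLaw lam alpha F =
      a * ∫ w, stepDuration w x ∂worldLaw lam alpha F + b 0 * drift lam alpha F x 0 +
        b 1 * drift lam alpha F x 1 := by
  have := fun k => (hF k).prob
  have := isProbabilityMeasure_worldLaw hlam halpha (F := F)
  have hd := (integrable_stepDuration hlam halpha hF x).const_mul a
  have h := fun k => integrable_stepOrbits hlam halpha hF x k
  have hi : ∀ k, Integrable (fun w => (stepOrbits w x k : ℝ) - x k) (worldLaw lam alpha F) :=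
    fun k => (h k).1.sub (integrable_const _)
  have hs : ∀ k, ∫ w, ((stepOrbits w x k : ℝ) - x k) ∂worldLaw lam alpha F =
      drift lam alpha F x k := by
    intro k
    rw [integral_sub (h k).1 (integrable_const _), (h k).2]
    simp
  simp only [increment]
  have h2 : Integrable (fun w => a * stepDuration w x + b 0 * ((stepOrbits w x 0 : ℝ) - x 0))
    (worldLaw lam alpha F) := hd.add ((hi 0).const_mul _)
  rw [integral_add h2 ((hi 1).const_mul _), integral_add hd ((hi 0).const_mul _),
    integral_const_mul, integral_const_mul,
    integral_const_mul, hs, hs]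

/-- Uniform exponential estimates for the increments. -/
lemma exists_exp_increment_le (a : ℝ) (b : Fin 2 → ℝ) :
    ∃ θ > 0, ∃ q < 1, ∃ B < ⊤, ∀ x,
      (∫ w, increment a b x w ∂worldLaw lam alpha F < 0 →
        ∫⁻ w, ENNReal.ofReal (Real.exp (θ * increment a b x w)) ∂worldLaw lam alpha F ≤ q) ∧
      ∫⁻ w, ENNReal.ofReal (Real.exp (θ * increment a b x w)) ∂worldLaw lam alpha F ≤ B := by
  classical
  have := fun k => (hF k).prob
  have := isProbabilityMeasure_worldLaw hlam halpha (F := F)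
  -- One `θ` serves all states because only the finitely many representatives have to be considered.
  have h1 : ∀ᶠ θ in 𝓝[>] (0 : ℝ), ∀ c : Fin 2 → Bool,
      (∫ w, increment a b (representative c) w ∂worldLaw lam alpha F < 0 →
        ∫⁻ w, ENNReal.ofReal (Real.exp (θ * increment a b (representative c) w))
          ∂worldLaw lam alpha F < 1) ∧
      ∫⁻ w, ENNReal.ofReal (Real.exp (θ * increment a b (representative c) w))
        ∂worldLaw lam alpha F < ⊤ := by
    refine eventually_all.2 fun c => ?_
    have h0 := zero_mem_interior_increment hlam halpha hF a b (representative c)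
    refine Eventually.and ?_ (eventually_lintegral_exp_lt_top h0)
    by_cases hneg : ∫ w, increment a b (representative c) w ∂worldLaw lam alpha F < 0
    · filter_upwards [eventually_lintegral_exp_lt_one h0 hneg] with θ hθ _ using hθ
    · exact Eventually.of_forall fun θ h => absurd h hneg
  obtain ⟨θ, hθ, hθ0⟩ := (h1.and self_mem_nhdsWithin).exists
  set L : (Fin 2 → Bool) → ℝ≥0∞ := fun c =>
    ∫⁻ w, ENNReal.ofReal (Real.exp (θ * increment a b (representative c) w)) ∂worldLaw lam alpha F
  -- Patterns whose mean is not negative get the value zero, so that the maximum `q` stays below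
  -- one.
  set Q : (Fin 2 → Bool) → ℝ≥0∞ := fun c =>
    if ∫ w, increment a b (representative c) w ∂worldLaw lam alpha F < 0 then L c else 0
  refine ⟨θ, hθ0, Finset.univ.sup Q, ?_, Finset.univ.sup L, ?_, fun x => ?_⟩
  · refine (Finset.sup_lt_iff (by simp)).2 fun c _ => ?_
    simp only [Q]
    split_ifs with h
    · exact (hθ c).1 h
    · simp
  · exact (Finset.sup_lt_iff (by simp)).2 fun c _ => (hθ c).2
  · obtain ⟨c, hc⟩ := exists_representative x
    rw [increment_congr hc]
    refine ⟨fun h => ?_, Finset.le_sup (f := L) (Finset.mem_univ c)⟩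
    refine le_trans (le_of_eq ?_) (Finset.le_sup (f := Q) (Finset.mem_univ c))
    simp only [Q, if_pos h, L]

/-- The uniform lower bound on the growth per cycle that drives the renewal estimate. It is positive
because cycles have positive length and there are only four patterns; the truncation at one keeps it
finite. -/
lemma exists_le_lintegral_exp_sub_one {β : ℝ} (hβ : 0 < β) :
    ∃ κ ≠ 0, ∀ x, κ ≤ ∫⁻ w, ENNReal.ofReal (Real.exp (β * min (stepDuration w x) 1) - 1)
      ∂worldLaw lam alpha F := by
  have := fun k => (hF k).prob
  have := isProbabilityMeasure_worldLaw hlam halpha (F := F)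
  set L : (Fin 2 → Bool) → ℝ≥0∞ := fun c =>
    ∫⁻ w, ENNReal.ofReal (Real.exp (β * min (stepDuration w (representative c)) 1) - 1)
      ∂worldLaw lam alpha F
  have hL : ∀ c, 0 < L c := by
    intro c
    have hm := measurable_stepDuration (representative c)
    rw [pos_iff_ne_zero]
    intro h0
    rw [lintegral_eq_zero_iff (by fun_prop)] at h0
    have hfalse : ∀ᵐ w ∂worldLaw lam alpha F, False := by
      filter_upwards [h0, ae_good_of_classD hlam halpha hF] with w hw hg
      simp only [Pi.zero_apply, ENNReal.ofReal_eq_zero, sub_nonpos, Real.exp_le_one_iff] at hw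
      have h1 : 0 < min (stepDuration w (representative c)) 1 :=
        lt_min (stepDuration_pos hg _) one_pos
      exact absurd hw (not_le.2 (by positivity))
    rw [ae_iff] at hfalse
    simp at hfalse
  refine ⟨Finset.univ.inf L, ?_, fun x => ?_⟩
  · rw [← pos_iff_ne_zero]
    exact (Finset.lt_inf_iff (by simp)).2 fun c _ => hL c
  · obtain ⟨c, hc⟩ := exists_representative x
    simp only [stepDuration_congr hc]
    exact Finset.inf_le (f := L) (Finset.mem_univ c)

end Increment

/-! ### Estimates for the chain at departures -/

/-- The fixed-point equation of the geometric series. It holds for `q ≥ 1` too, both sides being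
`⊤`. -/
lemma one_add_mul_inv_one_sub (q : ℝ≥0∞) : 1 + q * (1 - q)⁻¹ = (1 - q)⁻¹ := by
  rw [← ENNReal.tsum_geometric, ← ENNReal.tsum_mul_left]
  conv_rhs => rw [tsum_eq_zero_add' ENNReal.summable]
  simp [pow_succ']

lemma le_of_contraction {u : ℕ → ℝ≥0∞} {q B : ℝ≥0∞} (h0 : u 0 ≤ 1)
    (h : ∀ n, u (n + 1) ≤ q * u n + B) (n : ℕ) : u n ≤ (1 + B) * (1 - q)⁻¹ := by
  have hK := one_add_mul_inv_one_sub q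
  set K := (1 - q)⁻¹
  induction n with
  | zero =>
    rw [← hK]
    exact h0.trans (le_trans (by simp) (mul_le_mul' (le_self_add (a := 1) (b := B)) le_self_add))
  | succ n ih =>
    calc u (n + 1) ≤ q * ((1 + B) * K) + (1 + B) := by
          refine (h n).trans (add_le_add (by gcongr) le_add_self)
      _ = (1 + B) * (1 + q * K) := by ring
      _ = (1 + B) * K := by rw [hK]

/-- The claimed bound is the fixed point of `S ↦ q S + B R + 1`, and this map dominates the passage
from one partial sum of `a` to the next. -/
lemma tsum_le_of_contraction {a r : ℕ → ℝ≥0∞} {q B R : ℝ≥0∞} (h0 : a 0 ≤ 1)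
    (h : ∀ n, a (n + 1) ≤ q * a n + B * r n) (hr : ∑' n, r n ≤ R) :
    ∑' n, a n ≤ (1 + B * R) * (1 - q)⁻¹ := by
  have hK := one_add_mul_inv_one_sub q
  set K := (1 - q)⁻¹
  rw [ENNReal.tsum_eq_iSup_nat]
  refine iSup_le fun N => ?_
  induction N with
  | zero => simp
  | succ N ih =>
    have hrN : ∑ n ∈ Finset.range N, r n ≤ R := (ENNReal.sum_le_tsum _).trans hr
    calc ∑ n ∈ Finset.range (N + 1), a n
        = (∑ n ∈ Finset.range N, a (n + 1)) + a 0 := Finset.sum_range_succ' _ _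
      _ ≤ (∑ n ∈ Finset.range N, (q * a n + B * r n)) + 1 :=
          add_le_add (Finset.sum_le_sum fun n _ => h n) h0
      _ = q * ∑ n ∈ Finset.range N, a n + B * ∑ n ∈ Finset.range N, r n + 1 := by
          rw [Finset.sum_add_distrib, Finset.mul_sum, Finset.mul_sum]
      _ ≤ q * ((1 + B * R) * K) + B * R + 1 := by gcongr
      _ = (1 + B * R) * (1 + q * K) := by ring
      _ = (1 + B * R) * K := by rw [hK]

section Chain

variable {lam alpha : Fin 2 → ℝ} {F : Fin 2 → Measure ℝ}
  (hlam : ∀ k, 0 < lam k) (halpha : ∀ k, 0 < alpha k) (hF : ∀ k, ClassD (F k))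

include hlam halpha hF

lemma lintegral_mul_run_succ (x₀ : Orbits) (n : ℕ) {G V : ℝ × Orbits → ℝ≥0∞} (hG : Measurable G)
    (hV : Measurable V) :
    ∫⁻ w, G (run x₀ w n).1 * V (run x₀ w (n + 1)).1 ∂worldLaw lam alpha F =
      ∫⁻ w, G (run x₀ w n).1 * ∫⁻ w', V ((run x₀ w n).1.1 + stepDuration w' (run x₀ w n).1.2,
        stepOrbits w' (run x₀ w n).1.2) ∂worldLaw lam alpha F ∂worldLaw lam alpha F := by
  have := fun k => (hF k).prob
  have h : Measurable fun p : (ℝ × Orbits) × (ℝ × Orbits) => G p.1 * V p.2 :=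
    (hG.comp measurable_fst).mul (hV.comp measurable_snd)
  rw [lintegral_run_succ hlam halpha (fun k => (hF k).nonneg) x₀ n h]
  refine lintegral_congr fun w => ?_
  have h2 : Measurable fun w' => V ((run x₀ w n).1.1 + stepDuration w' (run x₀ w n).1.2,
      stepOrbits w' (run x₀ w n).1.2) :=
    hV.comp (((measurable_stepDuration _).const_add _).prodMk (measurable_stepOrbits _))
  exact lintegral_const_mul (G (run x₀ w n).1) h2

/-- Geometric decay of an exponential functional of the chain. -/
lemma lintegral_exp_run_le {θ : ℝ} {q : ℝ≥0∞} {b : Fin 2 → ℝ}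
    (hq : ∀ x, ∫⁻ w, ENNReal.ofReal (Real.exp (θ * increment 0 b x w)) ∂worldLaw lam alpha F ≤ q)
    (x₀ : Orbits) (n : ℕ) :
    ∫⁻ w, ENNReal.ofReal (Real.exp (θ * (b 0 * (run x₀ w n).1.2 0 + b 1 * (run x₀ w n).1.2 1)))
      ∂worldLaw lam alpha F ≤ q ^ n * ENNReal.ofReal (Real.exp (θ * (b 0 * x₀ 0 + b 1 * x₀ 1))) := by
  have := fun k => (hF k).prob
  have := isProbabilityMeasure_worldLaw hlam halpha (F := F)
  set V : ℝ × Orbits → ℝ≥0∞ := fun p =>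
    ENNReal.ofReal (Real.exp (θ * (b 0 * p.2 0 + b 1 * p.2 1))) with hVdef
  have hV : Measurable V := by fun_prop
  change ∫⁻ w, V (run x₀ w n).1 ∂worldLaw lam alpha F ≤ _
  induction n with
  | zero => simp [run, hVdef]
  | succ n ih =>
    have h1 := lintegral_mul_run_succ hlam halpha hF x₀ n (G := fun _ => 1) measurable_const hV
    simp only [one_mul] at h1
    rw [h1]
    have h2 : ∀ w, ∫⁻ w', V ((run x₀ w n).1.1 + stepDuration w' (run x₀ w n).1.2,
        stepOrbits w' (run x₀ w n).1.2) ∂worldLaw lam alpha F ≤ q * V (run x₀ w n).1 := by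
      intro w
      set x := (run x₀ w n).1.2
      calc _ = ∫⁻ w', V (run x₀ w n).1 * ENNReal.ofReal (Real.exp (θ * increment 0 b x w'))
            ∂worldLaw lam alpha F := by
            refine lintegral_congr fun w' => ?_
            simp only [hVdef]
            rw [← ENNReal.ofReal_mul (Real.exp_pos _).le, ← Real.exp_add]
            congr 2
            simp only [increment]
            ring
        _ = V (run x₀ w n).1 * ∫⁻ w', ENNReal.ofReal (Real.exp (θ * increment 0 b x w'))
            ∂worldLaw lam alpha F := by
            have := measurable_increment 0 b x
            rw [lintegral_const_mul _ (by fun_prop)]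
        _ ≤ V (run x₀ w n).1 * q := by gcongr; exact hq x
        _ = q * V (run x₀ w n).1 := mul_comm _ _
    calc _ ≤ ∫⁻ w, q * V (run x₀ w n).1 ∂worldLaw lam alpha F := lintegral_mono h2
      _ = q * ∫⁻ w, V (run x₀ w n).1 ∂worldLaw lam alpha F :=
          lintegral_const_mul _ (hV.comp (measurable_fst.comp (measurable_run x₀ n)))
      _ ≤ _ := by
          rw [pow_succ', mul_assoc]
          gcongr

/-- A uniform renewal estimate for the departure instants. -/
lemma exists_tsum_discounted_le {β : ℝ} (hβ : 0 < β) :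
    ∃ R < ⊤, ∀ (x₀ : Orbits) (t : ℝ), ∑' n, ∫⁻ w, (if (run x₀ w n).1.1 ≤ t then
      ENNReal.ofReal (Real.exp (β * ((run x₀ w n).1.1 - t))) else 0) ∂worldLaw lam alpha F ≤ R := by
  have := fun k => (hF k).prob
  have := isProbabilityMeasure_worldLaw hlam halpha (F := F)
  obtain ⟨κ, hκ0, hκ⟩ := exists_le_lintegral_exp_sub_one hlam halpha hF hβ
  set e : ℝ≥0∞ := ENNReal.ofReal (Real.exp (-β)) with he
  have he0 : e ≠ 0 := by simp [he, Real.exp_pos]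
  refine ⟨(κ * e)⁻¹, ENNReal.inv_lt_top.2 (pos_iff_ne_zero.2 (mul_ne_zero hκ0 he0)),
    fun x₀ t => ?_⟩
  -- A potential bounded by one and nondecreasing in time. A cycle that starts at `d ≤ t` raises its
  -- mean by at least `κ exp(-β) exp(β (d - t))`, a multiple of the discount; the shift by one
  -- leaves room below the cap for a time step of `min(stepDuration, 1)`. Telescoping bounds the
  -- discounted sum, uniformly in `t` and in the initial state.
  set ψ : ℝ × Orbits → ℝ≥0∞ := fun p =>
    ENNReal.ofReal (min 1 (Real.exp (β * (p.1 - t - 1)))) with hψdef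
  have hψ : Measurable ψ := by fun_prop
  set G : ℝ × Orbits → ℝ≥0∞ := fun p =>
    if p.1 ≤ t then ENNReal.ofReal (Real.exp (β * (p.1 - t))) else 0 with hGdef
  have hG : Measurable G :=
    Measurable.ite (measurableSet_le measurable_fst measurable_const) (by fun_prop)
      measurable_const
  have hrun : ∀ n, Measurable fun w => (run x₀ w n).1 := fun n =>
    measurable_fst.comp (measurable_run x₀ n)
  change ∑' n, ∫⁻ w, G (run x₀ w n).1 ∂worldLaw lam alpha F ≤ _
  have hstep : ∀ n, ∫⁻ w, ψ (run x₀ w n).1 ∂worldLaw lam alpha F +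
      κ * e * ∫⁻ w, G (run x₀ w n).1 ∂worldLaw lam alpha F ≤
        ∫⁻ w, ψ (run x₀ w (n + 1)).1 ∂worldLaw lam alpha F := by
    intro n
    have h1 := lintegral_mul_run_succ hlam halpha hF x₀ n (G := fun _ => 1) measurable_const hψ
    simp only [one_mul] at h1
    have hψn : Measurable fun w => ψ (run x₀ w n).1 := hψ.comp (hrun n)
    have hGn : Measurable fun w => G (run x₀ w n).1 := hG.comp (hrun n)
    rw [h1, ← lintegral_const_mul _ hGn, ← lintegral_add_left hψn]
    refine lintegral_mono fun w => ?_
    set d := (run x₀ w n).1.1 with hd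
    set x := (run x₀ w n).1.2
    have hτ := measurable_stepDuration x
    have hpos : ∀ᵐ w' ∂worldLaw lam alpha F, 0 < stepDuration w' x := by
      filter_upwards [ae_good_of_classD hlam halpha hF] with w' hw' using stepDuration_pos hw' x
    simp only [hψdef, hGdef, ← hd]
    by_cases hdt : d ≤ t
    · rw [if_pos hdt]
      have hlt : Real.exp (β * (d - t - 1)) ≤ 1 := Real.exp_le_one_iff.2 (by nlinarith)
      have h2 : ∀ᵐ w' ∂worldLaw lam alpha F, ENNReal.ofReal (Real.exp (β * (d - t - 1))) +
          ENNReal.ofReal (Real.exp (β * (d - t - 1))) *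
            ENNReal.ofReal (Real.exp (β * min (stepDuration w' x) 1) - 1) ≤
          ENNReal.ofReal (min 1 (Real.exp (β * (d + stepDuration w' x - t - 1)))) := by
        filter_upwards [hpos] with w' hw'
        have hmin : 0 ≤ min (stepDuration w' x) 1 := le_min hw'.le zero_le_one
        have h3 : 0 ≤ Real.exp (β * min (stepDuration w' x) 1) - 1 := by
          rw [sub_nonneg, Real.one_le_exp_iff]; positivity
        rw [← ENNReal.ofReal_mul (by positivity), ← ENNReal.ofReal_add (by positivity)
          (by positivity)]
        refine ENNReal.ofReal_le_ofReal ?_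
        have h4 : Real.exp (β * (d - t - 1)) + Real.exp (β * (d - t - 1)) *
            (Real.exp (β * min (stepDuration w' x) 1) - 1) =
            Real.exp (β * (d - t - 1 + min (stepDuration w' x) 1)) := by
          rw [mul_add β, Real.exp_add]; ring
        rw [h4]
        refine le_min (Real.exp_le_one_iff.2 ?_) (Real.exp_le_exp.2 ?_)
        · have := min_le_right (stepDuration w' x) 1
          nlinarith
        · have := min_le_left (stepDuration w' x) 1
          nlinarith
      refine le_trans ?_ (lintegral_mono_ae h2)
      rw [lintegral_add_left measurable_const, lintegral_const, measure_univ, mul_one,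
        lintegral_const_mul _ (by fun_prop), min_eq_right hlt]
      refine add_le_add le_rfl ?_
      rw [mul_assoc, mul_comm κ, he, ← ENNReal.ofReal_mul (Real.exp_pos _).le, ← Real.exp_add,
        show -β + β * (d - t) = β * (d - t - 1) by ring]
      exact mul_le_mul_right (hκ x) _
    · rw [if_neg hdt, mul_zero, add_zero]
      have h2 : ∀ᵐ w' ∂worldLaw lam alpha F, ENNReal.ofReal (min 1 (Real.exp (β * (d - t - 1)))) ≤
          ENNReal.ofReal (min 1 (Real.exp (β * (d + stepDuration w' x - t - 1)))) := by
        filter_upwards [hpos] with w' hw'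
        refine ENNReal.ofReal_le_ofReal (min_le_min le_rfl (Real.exp_le_exp.2 ?_))
        nlinarith
      refine le_trans ?_ (lintegral_mono_ae h2)
      rw [lintegral_const, measure_univ, mul_one]
  have hψ1 : ∀ n, ∫⁻ w, ψ (run x₀ w n).1 ∂worldLaw lam alpha F ≤ 1 := by
    intro n
    calc _ ≤ ∫⁻ _, 1 ∂worldLaw lam alpha F := by
          refine lintegral_mono fun w => ?_
          rw [← ENNReal.ofReal_one]
          exact ENNReal.ofReal_le_ofReal (min_le_left _ _)
      _ = 1 := by simp
  have hpart : ∀ N, κ * e * ∑ n ∈ Finset.range N, ∫⁻ w, G (run x₀ w n).1 ∂worldLaw lam alpha F ≤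
      ∫⁻ w, ψ (run x₀ w N).1 ∂worldLaw lam alpha F := by
    intro N
    induction N with
    | zero => simp
    | succ N ih =>
      rw [Finset.sum_range_succ, mul_add]
      exact (add_le_add_left ih _).trans (hstep N)
  -- Division by `κ e` requires it to be finite, which the truncation of the duration at one
  -- guarantees.
  have hκtop : κ * e ≠ ⊤ := by
    refine ENNReal.mul_ne_top (ne_top_of_le_ne_top ?_ (hκ 0)) ENNReal.ofReal_ne_top
    refine ne_top_of_le_ne_top (b := ENNReal.ofReal (Real.exp β)) ENNReal.ofReal_ne_top ?_
    calc _ ≤ ∫⁻ _, ENNReal.ofReal (Real.exp β) ∂worldLaw lam alpha F := by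
          refine lintegral_mono fun w => ENNReal.ofReal_le_ofReal ?_
          have : Real.exp (β * min (stepDuration w 0) 1) ≤ Real.exp β := by
            refine Real.exp_le_exp.2 ?_
            have := min_le_right (stepDuration w 0) 1
            nlinarith
          linarith
      _ = _ := by simp
  rw [ENNReal.tsum_eq_iSup_nat]
  refine iSup_le fun N => ?_
  rw [← one_div, ENNReal.le_div_iff_mul_le (Or.inl (mul_ne_zero hκ0 he0)) (Or.inl hκtop), mul_comm]
  exact (hpart N).trans (hψ1 N)

lemma tsum_measure_run_le_lt_top (x₀ : Orbits) (t : ℝ) :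
    ∑' n, worldLaw lam alpha F {w | (run x₀ w n).1.1 ≤ t} < ⊤ := by
  have := fun k => (hF k).prob
  obtain ⟨R, hR, h⟩ := exists_tsum_discounted_le hlam halpha hF one_pos
  set C := ENNReal.ofReal (Real.exp t)
  refine lt_of_le_of_lt ?_ (ENNReal.mul_lt_top (ENNReal.ofReal_lt_top (r := Real.exp t)) hR)
  refine le_trans ?_ (mul_le_mul_right (h x₀ t) _)
  rw [← ENNReal.tsum_mul_left]
  refine ENNReal.tsum_le_tsum fun n => ?_
  have hm : Measurable fun w => (run x₀ w n).1.1 :=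
    measurable_fst.comp (measurable_fst.comp (measurable_run x₀ n))
  have hs : MeasurableSet {w : World | (run x₀ w n).1.1 ≤ t} := measurableSet_le hm measurable_const
  have hm2 : Measurable fun w => if (run x₀ w n).1.1 ≤ t then
      ENNReal.ofReal (Real.exp (1 * ((run x₀ w n).1.1 - t))) else 0 :=
    Measurable.ite hs (by fun_prop) measurable_const
  rw [← lintegral_indicator_one hs, ← lintegral_const_mul _ hm2]
  refine lintegral_mono_ae ?_
  filter_upwards [ae_good_of_classD hlam halpha hF] with w hw
  by_cases h1 : (run x₀ w n).1.1 ≤ t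
  · rw [Set.indicator_of_mem (by exact h1), if_pos h1, ← ENNReal.ofReal_mul (Real.exp_pos _).le,
      ← Real.exp_add, Pi.one_apply, ENNReal.one_le_ofReal, Real.one_le_exp_iff]
    linarith [run_time_nonneg hw x₀ n]
  · rw [Set.indicator_of_notMem (by exact h1)]; exact zero_le

/-- Borel–Cantelli: the expected number of departures up to any time is finite. Hence only finitely
many departures precede `t`, as the use of `ncard` in `departuresBefore` requires. -/
lemma ae_exists_lt_run (x₀ : Orbits) :
    ∀ᵐ w ∂worldLaw lam alpha F, ∀ t : ℝ, ∃ n, t < (run x₀ w n).1.1 := by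
  have h : ∀ᵐ w ∂worldLaw lam alpha F, ∀ T : ℕ, ∃ n, (T : ℝ) < (run x₀ w n).1.1 := by
    refine ae_all_iff.2 fun T => ?_
    have := ae_eventually_notMem (tsum_measure_run_le_lt_top hlam halpha hF x₀ T).ne
    filter_upwards [this] with w hw
    obtain ⟨n, hn⟩ := hw.exists
    exact ⟨n, by simpa using hn⟩
  filter_upwards [h] with w hw t
  obtain ⟨T, hT⟩ := exists_nat_ge t
  obtain ⟨n, hn⟩ := hw T
  exact ⟨n, hT.trans_lt hn⟩

/-- If the drift of orbit `0` is negative whenever this orbit is non-empty, then its size has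
exponential moments that are bounded uniformly in time, also when weighted by the departures. -/
lemma exists_tsum_exp_run_succ_le (hneg : ∀ x : Orbits, 0 < x 0 → drift lam alpha F x 0 < 0) :
    ∃ θ > 0, ∃ C < ⊤, ∃ C' < ⊤,
      (∀ n, ∫⁻ w, ENNReal.ofReal (Real.exp (θ * (run 0 w n).1.2 0)) ∂worldLaw lam alpha F ≤ C') ∧
      ∀ t : ℝ, 0 ≤ t → ∑' n, ∫⁻ w, (if (run 0 w n).1.1 ≤ t ∧ t ≤ (run 0 w (n + 1)).1.1 then
        ENNReal.ofReal (Real.exp (θ * (run 0 w (n + 1)).1.2 0)) else 0)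
        ∂worldLaw lam alpha F ≤ C := by
  have := fun k => (hF k).prob
  have := isProbabilityMeasure_worldLaw hlam halpha (F := F)
  -- The drift of orbit `0` remains negative after adding a small multiple `ε` of the cycle length.
  -- This surplus pays for the factor in elapsed time used below.
  obtain ⟨ε, hε, hεneg⟩ : ∃ ε > 0, ∀ x : Orbits, 0 < x 0 →
      ∫ w, increment ε ![1, 0] x w ∂worldLaw lam alpha F < 0 := by
    have h1 : ∀ᶠ ε in 𝓝[>] (0 : ℝ), ∀ c : Fin 2 → Bool, 0 < representative c 0 →
        ∫ w, increment ε ![1, 0] (representative c) w ∂worldLaw lam alpha F < 0 := by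
      refine Filter.Eventually.filter_mono nhdsWithin_le_nhds (eventually_all.2 fun c => ?_)
      by_cases hc : 0 < representative c 0
      · simp only [hc, true_implies, integral_increment hlam halpha hF]
        have hcont : Continuous fun ε : ℝ =>
            ε * ∫ w, stepDuration w (representative c) ∂worldLaw lam alpha F +
              (![1, 0] : Fin 2 → ℝ) 0 * drift lam alpha F (representative c) 0 +
              (![1, 0] : Fin 2 → ℝ) 1 * drift lam alpha F (representative c) 1 := by fun_prop
        have h2 := hcont.tendsto 0
        refine h2.eventually_lt_const ?_
        simpa using hneg _ hc
      · exact Eventually.of_forall fun _ h => absurd h hc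
    obtain ⟨ε, h, hε⟩ := (h1.and self_mem_nhdsWithin).exists
    refine ⟨ε, hε, fun x hx => ?_⟩
    obtain ⟨c, hc⟩ := exists_representative x
    rw [increment_congr hc]
    exact h c ((hc 0).1 hx)
  obtain ⟨θ, hθ, q, hq, B, hB, hqB⟩ := exists_exp_increment_le hlam halpha hF ε ![1, 0]
  -- The discount rate of the renewal bound has to be `θ ε`, the rate at which the functional below
  -- grows with time.
  have hβ : 0 < θ * ε := mul_pos hθ hε
  obtain ⟨R, hR, hRle⟩ := exists_tsum_discounted_le hlam halpha hF hβ
  have hq' : (1 - q)⁻¹ < ⊤ := ENNReal.inv_lt_top.2 (tsub_pos_of_lt hq)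
  have hB1 : 1 + B < ⊤ := ENNReal.add_lt_top.2 ⟨ENNReal.one_lt_top, hB⟩
  have hBR : B * R < ⊤ := ENNReal.mul_lt_top hB hR
  have hBR1 : 1 + B * R < ⊤ := ENNReal.add_lt_top.2 ⟨ENNReal.one_lt_top, hBR⟩
  have hq1 : q < ⊤ := hq.trans ENNReal.one_lt_top
  have hL : ∀ x : Orbits, 0 < x 0 → ∫⁻ w, ENNReal.ofReal (Real.exp (θ * increment ε ![1, 0] x w))
      ∂worldLaw lam alpha F ≤ q := fun x hx => (hqB x).1 (hεneg x hx)
  have hgood := ae_good_of_classD hlam halpha hF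
  have hrun : ∀ n, Measurable fun w => (run 0 w n).1 := fun n =>
    measurable_fst.comp (measurable_run 0 n)
  refine ⟨θ, hθ, q * ((1 + B * R) * (1 - q)⁻¹) + B * R, ENNReal.add_lt_top.2
    ⟨ENNReal.mul_lt_top hq1 (ENNReal.mul_lt_top hBR1 hq'), hBR⟩, (1 + B) * (1 - q)⁻¹,
    ENNReal.mul_lt_top hB1 hq', ?_, ?_⟩
  · refine le_of_contraction (by simp [run]) fun n => ?_
    set V : ℝ × Orbits → ℝ≥0∞ := fun p => ENNReal.ofReal (Real.exp (θ * p.2 0)) with hVdef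
    have hV : Measurable V := by fun_prop
    have h1 := lintegral_mul_run_succ hlam halpha hF 0 n (G := fun _ => 1) measurable_const hV
    simp only [one_mul] at h1
    have hVn : Measurable fun w => V (run 0 w n).1 := hV.comp (hrun n)
    change ∫⁻ w, V (run 0 w (n + 1)).1 ∂worldLaw lam alpha F ≤
      q * ∫⁻ w, V (run 0 w n).1 ∂worldLaw lam alpha F + B
    have h2 : q * ∫⁻ w, V (run 0 w n).1 ∂worldLaw lam alpha F + B =
        ∫⁻ w, (q * V (run 0 w n).1 + B) ∂worldLaw lam alpha F := by
      rw [lintegral_add_right _ measurable_const, lintegral_const_mul _ hVn, lintegral_const,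
        measure_univ, mul_one]
    rw [h1, h2]
    refine lintegral_mono fun w => ?_
    set d := (run 0 w n).1.1
    set x := (run 0 w n).1.2 with hx
    have hincr := measurable_increment ε ![1, 0] x
    calc ∫⁻ w', V (d + stepDuration w' x, stepOrbits w' x) ∂worldLaw lam alpha F
        ≤ ∫⁻ w', V (run 0 w n).1 * ENNReal.ofReal (Real.exp (θ * increment ε ![1, 0] x w'))
            ∂worldLaw lam alpha F := by
          refine lintegral_mono_ae ?_
          filter_upwards [hgood] with w' hw'
          -- No time factor is needed here: `ε` times the cycle length is positive, so including it
          -- only enlarges the bound.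
          have h3 := mul_pos hε (stepDuration_pos hw' x)
          simp only [hVdef, ← hx]
          rw [← ENNReal.ofReal_mul (Real.exp_pos _).le, ← Real.exp_add, ← mul_add]
          refine ENNReal.ofReal_le_ofReal (Real.exp_le_exp.2 (mul_le_mul_of_nonneg_left ?_ hθ.le))
          simp only [increment, Matrix.cons_val_zero, Matrix.cons_val_one]
          linarith
      _ = V (run 0 w n).1 * ∫⁻ w', ENNReal.ofReal (Real.exp (θ * increment ε ![1, 0] x w'))
            ∂worldLaw lam alpha F := lintegral_const_mul _ (by fun_prop)
      _ ≤ q * V (run 0 w n).1 + B := by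
          rcases Nat.eq_zero_or_pos (x 0) with h0 | h0
          · have h4 : V (run 0 w n).1 = 1 := by simp [hVdef, ← hx, h0]
            rw [h4, one_mul]
            exact (hqB x).2.trans le_add_self
          · rw [mul_comm q]
            exact (mul_le_mul_right (hL x h0) _).trans le_self_add
  · intro t ht
    -- From a state with orbit `0` non-empty, `V` contracts by `q` in the mean. From a state with
    -- orbit `0` empty, `V` is just the discount `H`, and its mean after one cycle is at most `B`
    -- times that; the discounts have a bounded sum over the departures.
    set V : ℝ × Orbits → ℝ≥0∞ := fun p =>
      ENNReal.ofReal (Real.exp (θ * p.2 0 + θ * ε * (p.1 - t))) with hVdef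
    set G : ℝ × Orbits → ℝ≥0∞ := fun p => if p.1 ≤ t then 1 else 0 with hGdef
    set H : ℝ × Orbits → ℝ≥0∞ := fun p =>
      if p.1 ≤ t then ENNReal.ofReal (Real.exp (θ * ε * (p.1 - t))) else 0 with hHdef
    have hset : MeasurableSet {p : ℝ × Orbits | p.1 ≤ t} :=
      measurableSet_le measurable_fst measurable_const
    have hV : Measurable V := by fun_prop
    have hG : Measurable G := Measurable.ite hset measurable_const measurable_const
    have hH : Measurable H := Measurable.ite hset (by fun_prop) measurable_const
    set a : ℕ → ℝ≥0∞ := fun n =>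
      ∫⁻ w, G (run 0 w n).1 * V (run 0 w n).1 ∂worldLaw lam alpha F with ha
    set r : ℕ → ℝ≥0∞ := fun n => ∫⁻ w, H (run 0 w n).1 ∂worldLaw lam alpha F with hr
    have hrR : ∑' n, r n ≤ R := hRle 0 t
    have hstep : ∀ n, ∫⁻ w, G (run 0 w n).1 * V (run 0 w (n + 1)).1 ∂worldLaw lam alpha F ≤
        q * a n + B * r n := by
      intro n
      have hGVn : Measurable fun w => G (run 0 w n).1 * V (run 0 w n).1 :=
        (hG.mul hV).comp (hrun n)
      have hHn : Measurable fun w => H (run 0 w n).1 := hH.comp (hrun n)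
      rw [lintegral_mul_run_succ hlam halpha hF 0 n hG hV, ha, hr]
      simp only
      rw [← lintegral_const_mul _ hGVn, ← lintegral_const_mul _ hHn,
        ← lintegral_add_left (hGVn.const_mul q)]
      refine lintegral_mono fun w => ?_
      set d := (run 0 w n).1.1 with hd
      set x := (run 0 w n).1.2 with hx
      have hincr := measurable_increment ε ![1, 0] x
      have h1 : ∫⁻ w', V (d + stepDuration w' x, stepOrbits w' x) ∂worldLaw lam alpha F =
          V (run 0 w n).1 * ∫⁻ w', ENNReal.ofReal (Real.exp (θ * increment ε ![1, 0] x w'))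
            ∂worldLaw lam alpha F := by
        rw [← lintegral_const_mul _ (by fun_prop)]
        refine lintegral_congr fun w' => ?_
        simp only [hVdef, ← hx, ← hd]
        rw [← ENNReal.ofReal_mul (Real.exp_pos _).le, ← Real.exp_add]
        congr 2
        simp only [increment, Matrix.cons_val_zero, Matrix.cons_val_one]
        ring
      rw [h1]
      by_cases hdt : d ≤ t
      · have hG1 : G (run 0 w n).1 = 1 := if_pos hdt
        have hH1 : H (run 0 w n).1 = ENNReal.ofReal (Real.exp (θ * ε * (d - t))) := if_pos hdt
        rw [hG1, hH1, one_mul, one_mul]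
        rcases Nat.eq_zero_or_pos (x 0) with h0 | h0
        · have h4 : V (run 0 w n).1 = ENNReal.ofReal (Real.exp (θ * ε * (d - t))) := by
            simp [hVdef, ← hx, h0, ← hd]
          rw [h4, mul_comm B]
          exact (mul_le_mul_right (hqB x).2 _).trans le_add_self
        · rw [mul_comm q]
          exact (mul_le_mul_right (hL x h0) _).trans le_self_add
      · have hG0 : G (run 0 w n).1 = 0 := if_neg hdt
        rw [hG0, zero_mul]
        exact zero_le
    have hmono : ∀ᵐ w ∂worldLaw lam alpha F, ∀ n, (run 0 w n).1.1 ≤ (run 0 w (n + 1)).1.1 := by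
      filter_upwards [hgood] with w hw n
      have := stepDuration_pos (run_good hw 0 n) (run 0 w n).1.2
      simp only [run]
      linarith
    -- Departure instants increase, so the restriction to departures up to `t` at index `n + 1` is
    -- stronger than at index `n`.
    have hrec : ∀ n, a (n + 1) ≤ q * a n + B * r n := by
      intro n
      refine le_trans (lintegral_mono_ae ?_) (hstep n)
      filter_upwards [hmono] with w hw
      gcongr ?_ * _
      simp only [hGdef]
      split_ifs with h1 h2
      · exact le_rfl
      · exact absurd ((hw n).trans h1) h2
      · exact zero_le
      · exact le_rfl
    have ha0 : a 0 ≤ 1 := by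
      have h1 : a 0 = ENNReal.ofReal (Real.exp (θ * ε * (0 - t))) := by
        simp [ha, run, hGdef, hVdef, ht]
      rw [h1, ENNReal.ofReal_le_one, Real.exp_le_one_iff]
      nlinarith
    have hsum := tsum_le_of_contraction ha0 hrec hrR
    calc _ ≤ ∑' n, (q * a n + B * r n) := by
          refine ENNReal.tsum_le_tsum fun n => le_trans (lintegral_mono fun w => ?_) (hstep n)
          -- For the cycle that contains `t` the next departure is not before `t`, so the time
          -- factor of `V` is at least one there and can be dropped.
          by_cases h : (run 0 w n).1.1 ≤ t ∧ t ≤ (run 0 w (n + 1)).1.1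
          · have hG1 : G (run 0 w n).1 = 1 := if_pos h.1
            rw [if_pos h, hG1, one_mul]
            refine ENNReal.ofReal_le_ofReal (Real.exp_le_exp.2 ?_)
            have := mul_nonneg hβ.le (sub_nonneg.2 h.2)
            linarith
          · rw [if_neg h]; exact zero_le
      _ = q * ∑' n, a n + B * ∑' n, r n := by
          rw [ENNReal.tsum_add, ENNReal.tsum_mul_left, ENNReal.tsum_mul_left]
      _ ≤ _ := by gcongr

end Chain

/-! ### Orbit sizes at fixed times -/

lemma orbitAtStart_le (u : Path) (d : ℝ) (x : Orbits) (k : Fin 2) : orbitAtStart u d x k ≤ x k := by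
  rw [orbitAtStart]
  split_ifs <;> omega

lemma le_orbitAtStart_add_one (u : Path) (d : ℝ) (x : Orbits) (k : Fin 2) :
    x k ≤ orbitAtStart u d x k + 1 := by
  rw [orbitAtStart]
  split_ifs <;> omega

section Deterministic

variable {w : World} (hw : Good w)

include hw

lemma run_time_strictMono (x₀ : Orbits) : StrictMono fun n => (run x₀ w n).1.1 := by
  refine strictMono_nat_of_lt_succ fun n => ?_
  have := stepDuration_pos (run_good hw x₀ n) (run x₀ w n).1.2
  simp only [run]
  linarith

lemma departuresBefore_spec (x₀ : Orbits) (hinf : ∀ t : ℝ, ∃ n, t < (run x₀ w n).1.1) {t : ℝ}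
    (ht : 0 ≤ t) :
    (run x₀ w (departuresBefore (toPath w) x₀ t)).1.1 ≤ t ∧
      t ≤ (run x₀ w (departuresBefore (toPath w) x₀ t + 1)).1.1 ∧
      ∀ m, (run x₀ w m).1.1 < t → m ≤ departuresBefore (toPath w) x₀ t := by
  classical
  have hmono := run_time_strictMono hw x₀
  have hex : ∃ n, t ≤ (run x₀ w (n + 1)).1.1 := by
    obtain ⟨n, hn⟩ := hinf t
    exact ⟨n, hn.le.trans (hmono.monotone n.le_succ)⟩
  have hset : {n | departureTime (toPath w) x₀ (n + 1) < t} = Set.Iio (Nat.find hex) := by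
    ext n
    simp only [Set.mem_ofPred_eq, Set.mem_Iio, departureTime, (departure_eq_run hw x₀ _).1,
      Nat.lt_find_iff, not_le]
    exact ⟨fun h m hm => (hmono.monotone (Nat.succ_le_succ hm)).trans_lt h, fun h => h n le_rfl⟩
  have hN : departuresBefore (toPath w) x₀ t = Nat.find hex := by
    rw [departuresBefore, hset, ← Finset.coe_Iio, Set.ncard_coe_finset, Nat.card_Iio]
  rw [hN]
  refine ⟨?_, Nat.find_spec hex, fun m hm => ?_⟩
  · rcases Nat.eq_zero_or_pos (Nat.find hex) with h0 | h0
    · rw [h0]; exact ht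
    · have h1 := Nat.find_min hex (Nat.sub_lt h0 one_pos)
      rw [Nat.sub_add_cancel (show 1 ≤ Nat.find hex from h0), not_le] at h1
      exact h1.le
  · by_contra! h
    exact absurd ((Nat.find_spec hex).trans (hmono.monotone h)) (not_le.2 hm)

/-- The orbits at time `t` are comparable with those at the departures around `t`. -/
lemma exists_orbit_bounds (x₀ : Orbits) (hinf : ∀ t : ℝ, ∃ n, t < (run x₀ w n).1.1) {t : ℝ}
    (ht : 0 ≤ t) (k : Fin 2) :
    ∃ N, (run x₀ w N).1.1 ≤ t ∧ t ≤ (run x₀ w (N + 1)).1.1 ∧ (∀ m, (run x₀ w m).1.1 < t → m ≤ N) ∧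
      orbit (toPath w) x₀ k t ≤ (run x₀ w (N + 1)).1.2 k + 1 ∧
      (run x₀ w N).1.2 k ≤ orbit (toPath w) x₀ k t + 1 := by
  obtain ⟨h1, h2, h3⟩ := departuresBefore_spec hw x₀ hinf ht
  set N := departuresBefore (toPath w) x₀ t with hN
  refine ⟨N, h1, h2, h3, ?_⟩
  set d := (run x₀ w N).1.1 with hd
  set x := (run x₀ w N).1.2 with hx
  have hdep : departure (toPath w) x₀ N = (d, x) := (departure_eq_run hw x₀ N).1
  have hsucc : (run x₀ w (N + 1)).1 = (endTime (toPath w) d x N, orbitsAtEnd (toPath w) d x N) := by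
    rw [← (departure_eq_run hw x₀ (N + 1)).1, departure, hdep]
  have hle := le_orbitAtStart_add_one (toPath w) d x k
  have hle' := orbitAtStart_le (toPath w) d x k
  rw [hsucc] at h2 ⊢
  change t ≤ endTime (toPath w) d x N at h2
  have hE : orbitsAtEnd (toPath w) d x N k = orbitAtStart (toPath w) d x k +
    {m | startTime (toPath w) d x < epoch (w.1 (false, k)) m ∧
      epoch (w.1 (false, k)) m ≤ endTime (toPath w) d x N}.ncard := rfl
  have horb : orbit (toPath w) x₀ k t = if t ≤ startTime (toPath w) d x then x k
      else orbitAtStart (toPath w) d x k + {m | startTime (toPath w) d x < epoch (w.1 (false, k)) m ∧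
        epoch (w.1 (false, k)) m < t}.ncard := by
    simp only [orbit, ← hN, departureTime, embedded, hdep]
    rfl
  rw [horb]
  change _ ≤ orbitsAtEnd (toPath w) d x N k + 1 ∧ _
  rw [hE]
  -- Until the service starts, the orbit may hold one customer more than at its start; this is the
  -- source of the summand `1` in both bounds. During the service, the arrivals before `t` are among
  -- those counted up to the end.
  split_ifs
  · omega
  · have := (hw.clock (false, k)).ncard_Ioo_le (s := startTime (toPath w) d x) h2
    omega

end Deterministic

lemma tsum_ofReal_exp_neg_pow_lt_top {a : ℝ} (ha : 0 < a) :
    ∑' n : ℕ, ENNReal.ofReal (Real.exp (-a)) ^ n < ⊤ := by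
  rw [ENNReal.tsum_geometric]
  refine ENNReal.inv_lt_top.2 (tsub_pos_of_lt ?_)
  rw [ENNReal.ofReal_lt_one, Real.exp_lt_one_iff]
  linarith

lemma one_le_ofReal_exp_mul {a b : ℝ} (h : 0 ≤ a + b) :
    1 ≤ ENNReal.ofReal (Real.exp a) * ENNReal.ofReal (Real.exp b) := by
  rw [← ENNReal.ofReal_mul (Real.exp_pos _).le, ← Real.exp_add, ENNReal.one_le_ofReal,
    Real.one_le_exp_iff]
  exact h

/-- Writing the contraction factor as an exponential allows its rate to be split into halves later.
Only an upper bound is available, since `q` may be zero. -/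
lemma exists_le_ofReal_exp_neg {q : ℝ≥0∞} (hq : q < 1) :
    ∃ a > 0, q ≤ ENNReal.ofReal (Real.exp (-a)) := by
  have h : Tendsto (fun a : ℝ => ENNReal.ofReal (Real.exp (-a))) (𝓝[>] 0) (𝓝 1) := by
    have h1 : Continuous fun a : ℝ => ENNReal.ofReal (Real.exp (-a)) :=
      ENNReal.continuous_ofReal.comp (by fun_prop)
    have h2 := (h1.tendsto 0).mono_left (nhdsWithin_le_nhds (s := Set.Ioi 0))
    simpa using h2
  obtain ⟨a, h2, h3⟩ := ((h.eventually_const_lt hq).and self_mem_nhdsWithin).exists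
  exact ⟨a, h3, h2.le⟩

section Chain

variable {lam alpha : Fin 2 → ℝ} {F : Fin 2 → Measure ℝ}
  (hlam : ∀ k, 0 < lam k) (halpha : ∀ k, 0 < alpha k) (hF : ∀ k, ClassD (F k))

lemma measurable_run_orbits (x₀ : Orbits) (n : ℕ) : Measurable fun w => (run x₀ w n).1.2 :=
  measurable_snd.comp (measurable_fst.comp (measurable_run x₀ n))

lemma measurable_exp_run_orbit (θ : ℝ) (x₀ : Orbits) (n : ℕ) (k : Fin 2) :
    Measurable fun w => ENNReal.ofReal (Real.exp (θ * (run x₀ w n).1.2 k)) := by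
  have h : Measurable fun y : Orbits => ENNReal.ofReal (Real.exp (θ * y k)) := by fun_prop
  exact h.comp (measurable_run_orbits x₀ n)

include hlam halpha hF

lemma ae_exists_orbit_bounds (x₀ : Orbits) : ∀ᵐ w ∂worldLaw lam alpha F, ∀ t : ℝ, 0 ≤ t → ∀ k,
    ∃ N, (run x₀ w N).1.1 ≤ t ∧ t ≤ (run x₀ w (N + 1)).1.1 ∧ (∀ m, (run x₀ w m).1.1 < t → m ≤ N) ∧
      orbit (toPath w) x₀ k t ≤ (run x₀ w (N + 1)).1.2 k + 1 ∧
      (run x₀ w N).1.2 k ≤ orbit (toPath w) x₀ k t + 1 := by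
  filter_upwards [ae_good_of_classD hlam halpha hF, ae_exists_lt_run hlam halpha hF x₀]
    with w hw hinf t ht k using exists_orbit_bounds hw x₀ hinf ht k

/-- Uniform exponential tails of orbit `0`. -/
lemma exists_measure_lt_orbit_le (hneg : ∀ x : Orbits, 0 < x 0 → drift lam alpha F x 0 < 0) :
    ∃ θ > 0, ∃ C < ⊤, ∀ (K : ℕ) (t : ℝ), 0 ≤ t →
      worldLaw lam alpha F {w | K < orbit (toPath w) 0 0 t} ≤
        ENNReal.ofReal (Real.exp (-(θ * K))) * C := by
  obtain ⟨θ, hθ, C, hC, -, -, -, h⟩ := exists_tsum_exp_run_succ_le hlam halpha hF hneg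
  refine ⟨θ, hθ, C, hC, fun K t ht => ?_⟩
  -- The index of the cycle containing `t` is random, so all indices are summed. The non-strict
  -- bound absorbs the possible extra customer of the orbit at time `t`.
  set A : ℕ → Set World := fun n => {w | ((run 0 w n).1.1 ≤ t ∧ t ≤ (run 0 w (n + 1)).1.1) ∧
    K ≤ (run 0 w (n + 1)).1.2 0} with hA
  have hsub : {w | K < orbit (toPath w) 0 0 t} ≤ᵐ[worldLaw lam alpha F] ⋃ n, A n := by
    filter_upwards [ae_exists_orbit_bounds hlam halpha hF 0] with w hw hK
    obtain ⟨N, h1, h2, -, h3, -⟩ := hw t ht 0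
    have hK' : K < orbit (toPath w) 0 0 t := hK
    exact Set.mem_iUnion.2 ⟨N, ⟨h1, h2⟩, by omega⟩
  have hd : ∀ n, Measurable fun w => (run 0 w n).1.1 := fun n =>
    measurable_fst.comp (measurable_fst.comp (measurable_run 0 n))
  have hAn : ∀ n, worldLaw lam alpha F (A n) ≤ ENNReal.ofReal (Real.exp (-(θ * K))) *
      ∫⁻ w, (if (run 0 w n).1.1 ≤ t ∧ t ≤ (run 0 w (n + 1)).1.1 then
        ENNReal.ofReal (Real.exp (θ * (run 0 w (n + 1)).1.2 0)) else 0) ∂worldLaw lam alpha F := by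
    intro n
    have hs : MeasurableSet {w | (run 0 w n).1.1 ≤ t ∧ t ≤ (run 0 w (n + 1)).1.1} :=
      (measurableSet_le (hd n) measurable_const).inter (measurableSet_le measurable_const (hd _))
    have hf : Measurable fun w => if (run 0 w n).1.1 ≤ t ∧ t ≤ (run 0 w (n + 1)).1.1 then
        ENNReal.ofReal (Real.exp (θ * (run 0 w (n + 1)).1.2 0)) else 0 :=
      Measurable.ite hs (measurable_exp_run_orbit θ 0 (n + 1) 0) measurable_const
    rw [← lintegral_const_mul _ hf]
    refine meas_le_lintegral₀ (hf.const_mul _).aemeasurable ?_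
    rintro w ⟨h1, h2⟩
    rw [if_pos h1]
    refine one_le_ofReal_exp_mul ?_
    have h3 : (K : ℝ) ≤ (run 0 w (n + 1)).1.2 0 := Nat.cast_le.2 h2
    linarith [mul_le_mul_of_nonneg_left h3 hθ.le]
  calc _ ≤ worldLaw lam alpha F (⋃ n, A n) := measure_mono_ae hsub
    _ ≤ ∑' n, worldLaw lam alpha F (A n) := measure_iUnion_le _
    _ ≤ _ := (ENNReal.tsum_le_tsum hAn).trans (by
        rw [ENNReal.tsum_mul_left]
        exact mul_le_mul_right (h t ht) _)

/-- A positive drift of a linear combination of the orbits makes this combination grow linearly, up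
to exponentially small probabilities. -/
lemma exists_measure_linear_le {c : ℝ}
    (hpos : ∀ x : Orbits, 0 < drift lam alpha F x 1 + c * drift lam alpha F x 0) :
    ∃ θ > 0, ∃ η > 0, ∀ x₀ : Orbits, ∃ C < ⊤, ∀ (n : ℕ) (L : ℝ),
      worldLaw lam alpha F {w | c * (run x₀ w n).1.2 0 + (run x₀ w n).1.2 1 ≤ L} ≤
        C * (ENNReal.ofReal (Real.exp (θ * L)) * ENNReal.ofReal (Real.exp (-η)) ^ n) := by
  -- These coefficients give the increments of `-(c X₀ + X₁)`, whose mean is negative in every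
  -- state.
  obtain ⟨θ, hθ, q, hq, B, -, hqB⟩ := exists_exp_increment_le hlam halpha hF 0 ![-c, -1]
  obtain ⟨η, hη, hqη⟩ := exists_le_ofReal_exp_neg hq
  have hdec := lintegral_exp_run_le hlam halpha hF (b := ![-c, -1]) (θ := θ) (q := q) (by
    refine fun x => (hqB x).1 ?_
    rw [integral_increment hlam halpha hF]
    have := hpos x
    simp only [Matrix.cons_val_zero, Matrix.cons_val_one]
    linarith)
  refine ⟨θ, hθ, η, hη, fun x₀ => ⟨ENNReal.ofReal (Real.exp (θ * ((![-c, -1] : Fin 2 → ℝ) 0 * x₀ 0 +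
    (![-c, -1] : Fin 2 → ℝ) 1 * x₀ 1))), ENNReal.ofReal_lt_top, fun n L => ?_⟩⟩
  set A := {w | c * (run x₀ w n).1.2 0 + (run x₀ w n).1.2 1 ≤ L} with hA
  have hf : Measurable fun w => ENNReal.ofReal (Real.exp (θ * ((![-c, -1] : Fin 2 → ℝ) 0 *
      (run x₀ w n).1.2 0 + (![-c, -1] : Fin 2 → ℝ) 1 * (run x₀ w n).1.2 1))) := by
    have h : Measurable fun y : Orbits => ENNReal.ofReal (Real.exp (θ * ((![-c, -1] : Fin 2 → ℝ) 0 *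
      y 0 + (![-c, -1] : Fin 2 → ℝ) 1 * y 1))) := by fun_prop
    exact h.comp (measurable_run_orbits x₀ n)
  calc worldLaw lam alpha F A
      ≤ ENNReal.ofReal (Real.exp (θ * L)) * ∫⁻ w, ENNReal.ofReal (Real.exp (θ *
          ((![-c, -1] : Fin 2 → ℝ) 0 * (run x₀ w n).1.2 0 +
            (![-c, -1] : Fin 2 → ℝ) 1 * (run x₀ w n).1.2 1))) ∂worldLaw lam alpha F := by
        rw [← lintegral_const_mul _ hf]
        refine meas_le_lintegral₀ (hf.const_mul _).aemeasurable fun w hw => ?_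
        refine one_le_ofReal_exp_mul ?_
        have h2 : c * (run x₀ w n).1.2 0 + (run x₀ w n).1.2 1 ≤ L := hw
        simp only [Matrix.cons_val_zero, Matrix.cons_val_one]
        linarith [mul_le_mul_of_nonneg_left h2 hθ.le]
    _ ≤ ENNReal.ofReal (Real.exp (θ * L)) * (ENNReal.ofReal (Real.exp (-η)) ^ n *
          ENNReal.ofReal (Real.exp (θ * ((![-c, -1] : Fin 2 → ℝ) 0 * x₀ 0 +
            (![-c, -1] : Fin 2 → ℝ) 1 * x₀ 1)))) := by
        refine mul_le_mul_right ((hdec x₀ n).trans ?_) _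
        gcongr
    _ = _ := by ring

lemma tsum_measure_run_eq_lt_top {c : ℝ}
    (hpos : ∀ x : Orbits, 0 < drift lam alpha F x 1 + c * drift lam alpha F x 0) (x₀ y : Orbits) :
    ∑' n, worldLaw lam alpha F {w | (run x₀ w n).1.2 = y} < ⊤ := by
  obtain ⟨θ, -, η, hη, h⟩ := exists_measure_linear_le hlam halpha hF hpos
  obtain ⟨C, hC, h⟩ := h x₀
  refine lt_of_le_of_lt (ENNReal.tsum_le_tsum fun n =>
    (measure_mono fun w hw => ?_).trans (h n (c * y 0 + y 1))) ?_
  · have hw' : (run x₀ w n).1.2 = y := hw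
    simp [hw']
  · rw [ENNReal.tsum_mul_left, ENNReal.tsum_mul_left]
    exact ENNReal.mul_lt_top hC
      (ENNReal.mul_lt_top ENNReal.ofReal_lt_top (tsum_ofReal_exp_neg_pow_lt_top hη))

/-- If `X₁ ≤ L` after `n` departures, then either `X₀ ≥ ε n`, or `c X₀ + X₁` is at most `L + c ε n`.
The first event is exponentially unlikely by the uniform moments of `X₀`; the second by the linear
growth of the combination, provided `ε` is small. -/
lemma tsum_measure_run_one_le_lt_top {c : ℝ} (hc : 0 < c)
    (hneg : ∀ x : Orbits, 0 < x 0 → drift lam alpha F x 0 < 0)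
    (hpos : ∀ x : Orbits, 0 < drift lam alpha F x 1 + c * drift lam alpha F x 0) (L : ℕ) :
    ∑' n, worldLaw lam alpha F {w | (run 0 w n).1.2 1 ≤ L} < ⊤ := by
  obtain ⟨θ', hθ', -, -, C', hC', hexp, -⟩ := exists_tsum_exp_run_succ_le hlam halpha hF hneg
  obtain ⟨θ, hθ, η, hη, h⟩ := exists_measure_linear_le hlam halpha hF hpos
  obtain ⟨C, hC, h⟩ := h 0
  -- With this slope the factor `exp(θ c ε n)` uses up half of the decay rate `η`.
  set ε := η / (2 * θ * c) with hε
  have hε0 : 0 < ε := by positivity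
  have hθcε : θ * (c * ε) = η / 2 := by rw [hε]; field_simp
  have hbound : ∀ n, worldLaw lam alpha F {w | (run 0 w n).1.2 1 ≤ L} ≤
      C' * ENNReal.ofReal (Real.exp (-(θ' * ε))) ^ n +
        C * (ENNReal.ofReal (Real.exp (θ * L)) * ENNReal.ofReal (Real.exp (-(η / 2))) ^ n) := by
    intro n
    have h1 : worldLaw lam alpha F {w | ε * n ≤ (run 0 w n).1.2 0} ≤
        C' * ENNReal.ofReal (Real.exp (-(θ' * ε))) ^ n := by
      have hf := measurable_exp_run_orbit θ' 0 n 0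
      rw [← ENNReal.ofReal_pow (Real.exp_pos _).le, ← Real.exp_nat_mul, mul_comm C']
      refine le_trans ?_ (mul_le_mul_right (hexp n) _)
      rw [← lintegral_const_mul _ hf]
      refine meas_le_lintegral₀ (hf.const_mul _).aemeasurable fun w hw => ?_
      refine one_le_ofReal_exp_mul ?_
      have h2 : ε * n ≤ (run 0 w n).1.2 0 := hw
      linarith [mul_le_mul_of_nonneg_left h2 hθ'.le]
    have h2 : ENNReal.ofReal (Real.exp (θ * (L + c * (ε * n)))) * ENNReal.ofReal (Real.exp (-η)) ^ n =
        ENNReal.ofReal (Real.exp (θ * L)) * ENNReal.ofReal (Real.exp (-(η / 2))) ^ n := by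
      rw [← ENNReal.ofReal_pow (Real.exp_pos _).le, ← ENNReal.ofReal_pow (Real.exp_pos _).le,
        ← Real.exp_nat_mul, ← Real.exp_nat_mul, ← ENNReal.ofReal_mul (Real.exp_pos _).le,
        ← ENNReal.ofReal_mul (Real.exp_pos _).le, ← Real.exp_add, ← Real.exp_add]
      congr 2
      linear_combination (n : ℝ) * hθcε
    refine le_trans (measure_mono fun w hw => ?_) ((measure_union_le
      {w | ε * n ≤ (run 0 w n).1.2 0}
      {w | c * (run 0 w n).1.2 0 + (run 0 w n).1.2 1 ≤ L + c * (ε * n)}).trans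
      (add_le_add h1 ((h n _).trans_eq (by rw [h2]))))
    have hw' : ((run 0 w n).1.2 1 : ℝ) ≤ L := by exact_mod_cast hw
    by_cases h3 : ε * n ≤ (run 0 w n).1.2 0
    · exact Or.inl h3
    · refine Or.inr ?_
      have h4 := mul_le_mul_of_nonneg_left (not_le.1 h3).le hc.le
      change c * (run 0 w n).1.2 0 + (run 0 w n).1.2 1 ≤ L + c * (ε * n)
      linarith
  refine lt_of_le_of_lt (ENNReal.tsum_le_tsum hbound) ?_
  rw [ENNReal.tsum_add, ENNReal.tsum_mul_left, ENNReal.tsum_mul_left, ENNReal.tsum_mul_left]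
  exact ENNReal.add_lt_top.2 ⟨ENNReal.mul_lt_top hC' (tsum_ofReal_exp_neg_pow_lt_top (by positivity)),
    ENNReal.mul_lt_top hC (ENNReal.mul_lt_top ENNReal.ofReal_lt_top
      (tsum_ofReal_exp_neg_pow_lt_top (by positivity)))⟩

lemma tendsto_measure_le_run_time (x₀ : Orbits) (m : ℕ) :
    Tendsto (fun t : ℝ => worldLaw lam alpha F {w | t ≤ (run x₀ w m).1.1}) atTop (𝓝 0) := by
  have := fun k => (hF k).prob
  have := isProbabilityMeasure_worldLaw hlam halpha (F := F)
  have hd : Measurable fun w => (run x₀ w m).1.1 :=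
    measurable_fst.comp (measurable_fst.comp (measurable_run x₀ m))
  have h := tendsto_measure_iInter_atTop (μ := worldLaw lam alpha F)
    (s := fun t : ℝ => {w | t ≤ (run x₀ w m).1.1})
    (fun t => (measurableSet_le measurable_const hd).nullMeasurableSet)
    (fun s t hst w hw => le_trans hst hw) ⟨0, measure_ne_top _ _⟩
  have h0 : ⋂ t : ℝ, {w : World | t ≤ (run x₀ w m).1.1} = ∅ := by
    refine Set.eq_empty_iff_forall_notMem.2 fun w hw => ?_
    have h1 : (run x₀ w m).1.1 + 1 ≤ (run x₀ w m).1.1 := Set.mem_iInter.1 hw _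
    linarith
  rwa [h0, measure_empty] at h

/-- Once departure `m` lies before `t`, the last departure has some index `n ≥ m`, and a small orbit
at `t` forces a small orbit at that departure. A union bound over `n ≥ m` gives the tail of a
convergent series, independent of `t`. The level `K + 1` allows for one customer having left the
orbit since that departure. -/
lemma tendsto_measure_orbit_one_le {c : ℝ} (hc : 0 < c)
    (hneg : ∀ x : Orbits, 0 < x 0 → drift lam alpha F x 0 < 0)
    (hpos : ∀ x : Orbits, 0 < drift lam alpha F x 1 + c * drift lam alpha F x 0) (K : ℕ) :
    Tendsto (fun t : ℝ => worldLaw lam alpha F {w | orbit (toPath w) 0 1 t ≤ K}) atTop (𝓝 0) := by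
  have hsum := tsum_measure_run_one_le_lt_top hlam halpha hF hc hneg hpos (K + 1)
  have htail := ENNReal.tendsto_sum_nat_add _ hsum.ne
  have hbound : ∀ (m : ℕ) (t : ℝ), 0 ≤ t → worldLaw lam alpha F {w | orbit (toPath w) 0 1 t ≤ K} ≤
      worldLaw lam alpha F {w | t ≤ (run 0 w m).1.1} +
        ∑' n, worldLaw lam alpha F {w | (run 0 w (n + m)).1.2 1 ≤ K + 1} := by
    intro m t ht
    have hsub : {w | orbit (toPath w) 0 1 t ≤ K} ≤ᵐ[worldLaw lam alpha F]
        ({w | t ≤ (run 0 w m).1.1} ∪ ⋃ n, {w | (run 0 w (n + m)).1.2 1 ≤ K + 1} : Set World) := by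
      filter_upwards [ae_exists_orbit_bounds hlam halpha hF 0] with w hw hK
      obtain ⟨N, -, -, h3, -, h5⟩ := hw t ht 1
      have hK' : orbit (toPath w) 0 1 t ≤ K := hK
      by_cases h : t ≤ (run 0 w m).1.1
      · exact Or.inl h
      · refine Or.inr (Set.mem_iUnion.2 ⟨N - m, ?_⟩)
        change (run 0 w (N - m + m)).1.2 1 ≤ K + 1
        rw [Nat.sub_add_cancel (h3 m (not_le.1 h))]
        omega
    exact (measure_mono_ae hsub).trans ((measure_union_le _ _).trans
      (add_le_add le_rfl (measure_iUnion_le _)))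
  rw [ENNReal.tendsto_nhds_zero]
  intro ε hε
  have hε2 : 0 < ε / 2 := ENNReal.half_pos hε.ne'
  obtain ⟨m, hm⟩ := ((ENNReal.tendsto_nhds_zero.1 htail) (ε / 2) hε2).exists
  filter_upwards [ENNReal.tendsto_nhds_zero.1
    (tendsto_measure_le_run_time hlam halpha hF 0 m) (ε / 2) hε2, eventually_ge_atTop 0] with t h1 h2
  calc _ ≤ _ := hbound m t h2
    _ ≤ ε / 2 + ε / 2 := add_le_add h1 hm
    _ = ε := ENNReal.add_halves ε

end Chain

/-! ### Mean drifts of the embedded chain -/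

section Chain

variable {lam alpha : Fin 2 → ℝ} {F : Fin 2 → Measure ℝ}
  (hlam : ∀ k, 0 < lam k) (halpha : ∀ k, 0 < alpha k) (hF : ∀ k, ClassD (F k))

include hlam halpha hF

lemma setIntegral_run_succ_sub (x₀ : Orbits) (n : ℕ) (x : Orbits) (k : Fin 2) :
    IntegrableOn (fun w => ((run x₀ w (n + 1)).1.2 k : ℝ) - (run x₀ w n).1.2 k)
        {w | (run x₀ w n).1.2 = x} (worldLaw lam alpha F) ∧
      ∫ w in {w | (run x₀ w n).1.2 = x}, (((run x₀ w (n + 1)).1.2 k : ℝ) - (run x₀ w n).1.2 k)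
        ∂worldLaw lam alpha F =
      drift lam alpha F x k * (worldLaw lam alpha F).real {w | (run x₀ w n).1.2 = x} := by
  have := fun k => (hF k).prob
  have := isProbabilityMeasure_worldLaw hlam halpha (F := F)
  set A : Set World := {w | (run x₀ w n).1.2 = x} with hA
  have hAm : MeasurableSet A := measurable_run_orbits x₀ n (measurableSet_singleton x)
  set G : ℝ × Orbits → ℝ≥0∞ := Set.indicator {p | p.2 = x} 1 with hG
  set V : ℝ × Orbits → ℝ≥0∞ := fun p => (p.2 k : ℝ≥0∞) with hV
  have hGm : Measurable G := measurable_one.indicator (measurable_snd (measurableSet_singleton x))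
  have hVm : Measurable V := by fun_prop
  have hcast : Measurable fun y : Orbits => (y k : ℝ) := by fun_prop
  have hf : Measurable fun w => ((run x₀ w (n + 1)).1.2 k : ℝ) :=
    hcast.comp (measurable_run_orbits x₀ (n + 1))
  have h1 : ∫⁻ w in A, ENNReal.ofReal ((run x₀ w (n + 1)).1.2 k) ∂worldLaw lam alpha F =
      ENNReal.ofReal (x k + drift lam alpha F x k) * worldLaw lam alpha F A := by
    have h2 := lintegral_mul_run_succ hlam halpha hF x₀ n hGm hVm
    have h3 : ∀ (w : World) (c : World → ℝ≥0∞), G (run x₀ w n).1 * c w = A.indicator c w := by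
      intro w c
      by_cases hw : w ∈ A
      · have h4 : (run x₀ w n).1 ∈ {p : ℝ × Orbits | p.2 = x} := hw
        rw [hG, Set.indicator_of_mem h4, Set.indicator_of_mem hw, Pi.one_apply, one_mul]
      · have h4 : (run x₀ w n).1 ∉ {p : ℝ × Orbits | p.2 = x} := hw
        rw [hG, Set.indicator_of_notMem h4, Set.indicator_of_notMem hw, zero_mul]
    rw [lintegral_congr fun w => h3 w fun w => V (run x₀ w (n + 1)).1, lintegral_indicator hAm] at h2
    simp only [hV, lintegral_stepOrbits hlam halpha hF] at h2
    rw [lintegral_congr fun w => h3 w fun w => ENNReal.ofReal ((run x₀ w n).1.2 k +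
      drift lam alpha F (run x₀ w n).1.2 k), lintegral_indicator hAm] at h2
    simp only [ENNReal.ofReal_natCast]
    rw [h2, ← setLIntegral_const]
    refine setLIntegral_congr_fun hAm fun w hw => ?_
    have h5 : (run x₀ w n).1.2 = x := hw
    rw [h5]
  have hint : IntegrableOn (fun w => ((run x₀ w (n + 1)).1.2 k : ℝ)) A (worldLaw lam alpha F) := by
    refine ⟨hf.aestronglyMeasurable, ?_⟩
    rw [hasFiniteIntegral_iff_ofReal (ae_of_all _ fun _ => Nat.cast_nonneg _), h1]
    exact ENNReal.mul_lt_top ENNReal.ofReal_lt_top (measure_lt_top _ _)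
  have hval : ∫ w in A, ((run x₀ w (n + 1)).1.2 k : ℝ) ∂worldLaw lam alpha F =
      (x k + drift lam alpha F x k) * (worldLaw lam alpha F).real A := by
    rw [integral_eq_lintegral_of_nonneg_ae (ae_of_all _ fun _ => Nat.cast_nonneg _)
      hf.aestronglyMeasurable, h1, ENNReal.toReal_mul,
      ENNReal.toReal_ofReal (add_drift_nonneg hlam halpha hF x k), measureReal_def]
  have hc : IntegrableOn (fun _ : World => (x k : ℝ)) A (worldLaw lam alpha F) :=
    integrable_const _
  have hcongr : Set.EqOn (fun w => ((run x₀ w (n + 1)).1.2 k : ℝ) - x k)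
      (fun w => ((run x₀ w (n + 1)).1.2 k : ℝ) - (run x₀ w n).1.2 k) A := by
    intro w hw
    have h5 : (run x₀ w n).1.2 = x := hw
    simp only [h5]
  refine ⟨(hint.sub hc).congr_fun hcongr hAm, ?_⟩
  rw [← setIntegral_congr_fun hAm hcongr, integral_sub hint hc, hval, setIntegral_const, smul_eq_mul]
  ring

variable {Ω : Type*} [MeasurableSpace Ω] {P : Measure Ω} {U : Source → Fin 2 → ℕ → Ω → ℝ}
  (hU : Drives P lam alpha F U)

include hU

lemma measurePreserving_ofPath_pathAt :
    MeasurePreserving (fun ω => ofPath (pathAt U ω)) P (worldLaw lam alpha F) := by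
  have := fun k => (hF k).prob
  exact ⟨measurable_ofPath_pathAt hU, map_ofPath hlam halpha hU⟩

lemma ae_embedded_eq (x₀ : Orbits) : ∀ᵐ ω ∂P, ∀ n,
    embedded (pathAt U ω) x₀ n = (run x₀ (ofPath (pathAt U ω)) n).1.2 := by
  have hT := measurePreserving_ofPath_pathAt hlam halpha hF hU
  filter_upwards [hT.quasiMeasurePreserving.ae (ae_good_of_classD hlam halpha hF)] with ω hω n
  rw [← (departure_eq_run hω x₀ n).1, toPath_ofPath]
  rfl

lemma hasMeanDrift_of_forall_drift_eq {region : Set Orbits} {k : Fin 2} {m : ℝ}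
    (h : ∀ x ∈ region, drift lam alpha F x k = m) : HasMeanDrift P U region k m := by
  intro x₀ n x hx
  have hT := measurePreserving_ofPath_pathAt hlam halpha hF hU
  obtain ⟨h1, h2⟩ := setIntegral_run_succ_sub hlam halpha hF x₀ n x k
  rw [h x hx] at h2
  set A : Set World := {w | (run x₀ w n).1.2 = x} with hA
  have hAm : MeasurableSet A := measurable_run_orbits x₀ n (measurableSet_singleton x)
  have hTA := hT.restrict_preimage hAm
  have hae := ae_embedded_eq hlam halpha hF hU x₀
  have hset : {ω | embedded (pathAt U ω) x₀ n = x} =ᵐ[P]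
      (fun ω => ofPath (pathAt U ω)) ⁻¹' A := by
    filter_upwards [hae] with ω hω
    exact propext (by
      change embedded (pathAt U ω) x₀ n = x ↔ (run x₀ (ofPath (pathAt U ω)) n).1.2 = x
      rw [hω n])
  have hfun : (fun ω => (embedded (pathAt U ω) x₀ (n + 1) k : ℝ) - embedded (pathAt U ω) x₀ n k)
      =ᵐ[P] fun ω => ((run x₀ (ofPath (pathAt U ω)) (n + 1)).1.2 k : ℝ) -
        (run x₀ (ofPath (pathAt U ω)) n).1.2 k := by
    filter_upwards [hae] with ω hω
    rw [hω, hω]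
  rw [IntegrableOn, Measure.restrict_congr_set hset, measureReal_congr hset]
  refine ⟨(hTA.integrable_comp_of_integrable h1).congr (ae_restrict_of_ae hfun.symm), ?_⟩
  rw [integral_congr_ae (ae_restrict_of_ae hfun)]
  have h3 := integral_map hTA.measurable.aemeasurable (f := fun w =>
    ((run x₀ w (n + 1)).1.2 k : ℝ) - (run x₀ w n).1.2 k) (by rw [hTA.map_eq]; exact h1.1)
  rw [hTA.map_eq] at h3
  rw [← h3, h2, measureReal_def, measureReal_def, hT.measure_preimage hAm.nullMeasurableSet]

omit hlam halpha hF hU in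
-- Starting the chain at a state of the region gives the event at time zero probability one. Hence
-- the constants chosen existentially in `CaseC2` must be the actual drifts.
lemma HasMeanDrift.unique [IsProbabilityMeasure P] {region : Set Orbits} {k : Fin 2} {m m' : ℝ}
    (h : HasMeanDrift P U region k m) (h' : HasMeanDrift P U region k m') (hne : region.Nonempty) :
    m = m' := by
  obtain ⟨x, hx⟩ := hne
  have h1 := (h x 0 x hx).2
  have h2 := (h' x 0 x hx).2
  have h3 : {ω | embedded (pathAt U ω) x 0 = x} = Set.univ := Set.eq_univ_of_forall fun ω => rfl
  rw [h3, probReal_univ, mul_one] at h1 h2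
  exact h1.symm.trans h2

lemma caseC2_iff [IsProbabilityMeasure P] :
    CaseC2 P U ↔ drift lam alpha F ![1, 1] 0 < 0 ∧ 0 ≤ drift lam alpha F ![1, 1] 1 ∧
      0 < drift lam alpha F ![1, 1] 1 * drift lam alpha F ![0, 1] 0 -
        drift lam alpha F ![1, 1] 0 * drift lam alpha F ![0, 1] 1 := by
  have h11 : ∀ k, HasMeanDrift P U {x | 0 < x 0 ∧ 0 < x 1} k (drift lam alpha F ![1, 1] k) :=
    fun k => hasMeanDrift_of_forall_drift_eq hlam halpha hF hU fun x hx =>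
      drift_congr (Fin.forall_fin_two.2 ⟨by simpa using hx.1, by simpa using hx.2⟩) _ _ _ _
  have h01 : ∀ k, HasMeanDrift P U {x | x 0 = 0 ∧ 0 < x 1} k (drift lam alpha F ![0, 1] k) :=
    fun k => hasMeanDrift_of_forall_drift_eq hlam halpha hF hU fun x hx =>
      drift_congr (Fin.forall_fin_two.2 ⟨by simpa using hx.1, by simpa using hx.2⟩) _ _ _ _
  constructor
  · rintro ⟨M11, M01, hM11, hM01, h⟩
    have e11 : ∀ k, M11 k = drift lam alpha F ![1, 1] k := fun k =>
      (hM11 k).unique (h11 k) ⟨![1, 1], by simp⟩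
    have e01 : ∀ k, M01 k = drift lam alpha F ![0, 1] k := fun k =>
      (hM01 k).unique (h01 k) ⟨![0, 1], by simp⟩
    simpa only [e11, e01] using h
  · exact fun h => ⟨_, _, h11, h01, h⟩

/-! ### Limit theorems for the driven system -/

lemma orbitTight_zero (hneg : ∀ x : Orbits, 0 < x 0 → drift lam alpha F x 0 < 0) :
    OrbitTight P U 0 := by
  intro ε hε
  have hT := measurePreserving_ofPath_pathAt hlam halpha hF hU
  obtain ⟨θ, hθ, C, hC, h⟩ := exists_measure_lt_orbit_le hlam halpha hF hneg
  have hlim : Tendsto (fun K : ℕ => ENNReal.ofReal (Real.exp (-(θ * K))) * C) atTop (𝓝 0) := by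
    have h1 : Tendsto (fun K : ℕ => Real.exp (-(θ * K))) atTop (𝓝 0) :=
      Real.tendsto_exp_neg_atTop_nhds_zero.comp
        (tendsto_natCast_atTop_atTop.const_mul_atTop hθ)
    have h2 := ENNReal.Tendsto.mul_const (ENNReal.tendsto_ofReal h1) (Or.inr hC.ne)
    simpa using h2
  obtain ⟨K, hK⟩ := (ENNReal.tendsto_nhds_zero.1 hlim _ (ENNReal.ofReal_pos.2 hε)).exists
  refine ⟨K, fun t ht => ?_⟩
  refine ENNReal.toReal_le_of_le_ofReal hε.le (le_trans ?_ ((h K t ht).trans hK))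
  rw [← hT.map_eq]
  -- The inequality for the image measure holds for arbitrary sets, so measurability of `orbit` at a
  -- fixed time is not needed.
  refine le_trans (le_of_eq ?_) (Measure.le_map_apply hT.measurable.aemeasurable _)
  simp only [Set.preimage_ofPred_eq, toPath_ofPath]

lemma orbitTendsToInfinity_one {c : ℝ} (hc : 0 < c)
    (hneg : ∀ x : Orbits, 0 < x 0 → drift lam alpha F x 0 < 0)
    (hpos : ∀ x : Orbits, 0 < drift lam alpha F x 1 + c * drift lam alpha F x 0) :
    OrbitTendsToInfinity P U 1 := by
  intro K
  have hT := measurePreserving_ofPath_pathAt hlam halpha hF hU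
  have h := tendsto_measure_orbit_one_le hlam halpha hF hc hneg hpos K
  have h1 : Tendsto (fun t : ℝ => P {ω | orbit (pathAt U ω) 0 1 t ≤ K}) atTop (𝓝 0) := by
    refine tendsto_of_tendsto_of_tendsto_of_le_of_le tendsto_const_nhds h (fun _ => zero_le) ?_
    intro t
    simp only
    rw [← hT.map_eq]
    refine le_trans (le_of_eq ?_) (Measure.le_map_apply hT.measurable.aemeasurable _)
    simp only [Set.preimage_ofPred_eq, toPath_ofPath]
  simpa [measureReal_def, Function.comp_def] using
    (ENNReal.tendsto_toReal ENNReal.zero_ne_top).comp h1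

lemma embeddedTransient_of_drift {c : ℝ}
    (hpos : ∀ x : Orbits, 0 < drift lam alpha F x 1 + c * drift lam alpha F x 0) :
    EmbeddedTransient P U := by
  intro x₀ y
  have hT := measurePreserving_ofPath_pathAt hlam halpha hF hU
  refine lt_of_le_of_lt (ENNReal.tsum_le_tsum fun n => ?_)
    (tsum_measure_run_eq_lt_top hlam halpha hF hpos x₀ y)
  rw [← hT.map_eq]
  refine le_trans (measure_mono_ae ?_) (Measure.le_map_apply hT.measurable.aemeasurable _)
  filter_upwards [ae_embedded_eq hlam halpha hF hU x₀] with ω hω h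
  exact (hω n).symm.trans h

end Chain

/-! ### The conditions in terms of the loads -/

lemma sum_active (x : Orbits) (f : Bool × Fin 2 → ℝ) :
    ∑ j ∈ active x, f j = f (false, 0) + f (false, 1) + (if 0 < x 0 then f (true, 0) else 0) +
      if 0 < x 1 then f (true, 1) else 0 := by
  simp [active, Finset.sum_filter, Fintype.sum_prod_type, Fin.sum_univ_two]
  ring

lemma drift_eq (lam alpha : Fin 2 → ℝ) (F : Fin 2 → Measure ℝ) (x : Orbits) (k : Fin 2) :
    drift lam alpha F x k =
      (lam k * (lam 0 * ∫ s, s ∂F 0 + lam 1 * ∫ s, s ∂F 1 +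
        (if 0 < x 0 then alpha 0 * ∫ s, s ∂F 0 else 0) +
        if 0 < x 1 then alpha 1 * ∫ s, s ∂F 1 else 0) - if 0 < x k then alpha k else 0) /
      (lam 0 + lam 1 + (if 0 < x 0 then alpha 0 else 0) + if 0 < x 1 then alpha 1 else 0) := by
  simp only [drift, workRate, totalRate, sum_active, rate, if_true, Bool.false_eq_true, if_false]

section Algebra

variable {l₀ l₁ a₀ a₁ m₀ m₁ : ℝ} (hl₀ : 0 < l₀) (hl₁ : 0 < l₁) (ha₀ : 0 < a₀) (ha₁ : 0 < a₁)
  (hm₀ : 0 < m₀) (hm₁ : 0 < m₁)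

include hm₀ in
lemma lt_load_iff :
    l₀ * m₀ * ((l₀ * m₀ + l₁ * m₁) + (a₀ * m₀ + a₁ * m₁)) < a₀ * m₀ ↔
      l₀ * (l₀ * m₀ + l₁ * m₁ + a₀ * m₀ + a₁ * m₁) < a₀ := by
  rw [← mul_lt_mul_iff_of_pos_right hm₀ (b := l₀ * _)]
  ring_nf

include hl₁ ha₁ hm₁ in
lemma div_lt_load_iff :
    a₁ * m₁ / (l₁ * m₁ + a₁ * m₁) < l₀ * m₀ + l₁ * m₁ ↔
      a₁ < (l₀ * m₀ + l₁ * m₁) * (l₁ + a₁) := by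
  rw [div_lt_iff₀ (by positivity), ← mul_lt_mul_iff_of_pos_right hm₁ (b := a₁)]
  ring_nf

include hl₀ hl₁ ha₀ ha₁ hm₀ hm₁

/-- Suppose `l₁ S ≤ a₁`. Adding this and `h1`, weighted by the means `m₁` and `m₀`, gives `r S < S -
r`, so `r < 1` and `r < S (1 - r)`. But `h2` says `a₁ (1 - r) < l₁ r`, and with `l₁ S ≤ a₁` this
yields `S (1 - r) < r`, a contradiction. -/
lemma second_drift_numerator_pos
    (h1 : l₀ * (l₀ * m₀ + l₁ * m₁ + a₀ * m₀ + a₁ * m₁) < a₀)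
    (h2 : a₁ < (l₀ * m₀ + l₁ * m₁) * (l₁ + a₁)) :
    0 < l₁ * (l₀ * m₀ + l₁ * m₁ + a₀ * m₀ + a₁ * m₁) - a₁ := by
  by_contra! h
  set r := l₀ * m₀ + l₁ * m₁ with hr
  set S := r + a₀ * m₀ + a₁ * m₁ with hS
  have hr0 : 0 < r := by positivity
  have hS0 : 0 < S := by positivity
  have hrS : r * S < a₀ * m₀ + a₁ * m₁ := by
    have h3 := mul_lt_mul_of_pos_right h1 hm₀
    have h4 := mul_le_mul_of_nonneg_right (sub_nonpos.1 h) hm₁.le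
    rw [hr]
    linarith
  have hrS' : r * S < S - r := by rw [hS]; rw [hS] at hrS; linarith
  have hr1 : r < 1 := by
    by_contra! h5
    nlinarith
  have h6 : l₁ * S * (1 - r) ≤ a₁ * (1 - r) :=
    mul_le_mul_of_nonneg_right (by linarith) (by linarith)
  have h7 : l₁ * (S * (1 - r)) < l₁ * r := by linarith
  have h8 := lt_of_mul_lt_mul_left h7 hl₁.le
  linarith

/-- A weight for which the weighted sums of the drifts are positive for all sets of empty orbits. -/
lemma exists_weight
    (h1 : l₀ * (l₀ * m₀ + l₁ * m₁ + a₀ * m₀ + a₁ * m₁) < a₀)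
    (h2 : a₁ < (l₀ * m₀ + l₁ * m₁) * (l₁ + a₁)) :
    ∃ c > 0,
      0 < (l₁ * (l₀ * m₀ + l₁ * m₁ + a₀ * m₀ + a₁ * m₁) - a₁) +
        c * (l₀ * (l₀ * m₀ + l₁ * m₁ + a₀ * m₀ + a₁ * m₁) - a₀) ∧
      0 < (l₁ * (l₀ * m₀ + l₁ * m₁ + a₁ * m₁) - a₁) + c * (l₀ * (l₀ * m₀ + l₁ * m₁ + a₁ * m₁)) ∧
      0 < l₁ * (l₀ * m₀ + l₁ * m₁ + a₀ * m₀) + c * (l₀ * (l₀ * m₀ + l₁ * m₁ + a₀ * m₀) - a₀) := by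
  have hpos := second_drift_numerator_pos hl₀ hl₁ ha₀ ha₁ hm₀ hm₁ h1 h2
  set R := l₀ * m₀ + l₁ * m₁ + a₁ * m₁ with hR
  have hlR : 0 < l₀ * R := by positivity
  -- The weight `e` is the smallest non-negative one for which the combination does not drift down
  -- where orbit `0` is empty and orbit `1` is not. The other two inequalities are strict at `e`.
  obtain ⟨e, he, heR, hA, hC⟩ : ∃ e ≥ 0, 0 ≤ (l₁ * R - a₁) + e * (l₀ * R) ∧
      0 < (l₁ * (l₀ * m₀ + l₁ * m₁ + a₀ * m₀ + a₁ * m₁) - a₁) +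
        e * (l₀ * (l₀ * m₀ + l₁ * m₁ + a₀ * m₀ + a₁ * m₁) - a₀) ∧
      0 < l₁ * (l₀ * m₀ + l₁ * m₁ + a₀ * m₀) + e * (l₀ * (l₀ * m₀ + l₁ * m₁ + a₀ * m₀) - a₀) := by
    rcases le_or_gt a₁ (l₁ * R) with h | h
    · refine ⟨0, le_rfl, by linarith, by linarith, ?_⟩
      rw [zero_mul, add_zero]
      positivity
    -- At the critical weight the interior expression, multiplied by `l₀ R`, is exactly this
    -- determinant; the one for orbit `1` empty exceeds it by `a₁ l₀ (l₀ m₀ + l₁ m₁)`.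
    · have hdet : 0 < a₀ * ((l₀ * m₀ + l₁ * m₁) * (l₁ + a₁) - a₁) := mul_pos ha₀ (by linarith)
      have he : (a₁ - l₁ * R) / (l₀ * R) * (l₀ * R) = a₁ - l₁ * R := div_mul_cancel₀ _ hlR.ne'
      refine ⟨(a₁ - l₁ * R) / (l₀ * R), by apply div_nonneg <;> linarith, by linarith, ?_, ?_⟩
      · refine pos_of_mul_pos_left ?_ hlR.le
        rw [add_mul, mul_right_comm, he]
        refine hdet.trans_eq ?_
        rw [hR]; ring
      · refine pos_of_mul_pos_left ?_ hlR.le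
        rw [add_mul, mul_right_comm ((a₁ - l₁ * R) / (l₀ * R)), he]
        have h3 : 0 < a₁ * l₀ * (l₀ * m₀ + l₁ * m₁) := by positivity
        refine (add_pos hdet h3).trans_eq ?_
        rw [hR]; ring
  -- Raising `e` slightly makes the remaining inequality strict and keeps the other two, by
  -- continuity.
  have hev : ∀ᶠ c in 𝓝[>] e, e < c ∧
      0 < (l₁ * (l₀ * m₀ + l₁ * m₁ + a₀ * m₀ + a₁ * m₁) - a₁) +
        c * (l₀ * (l₀ * m₀ + l₁ * m₁ + a₀ * m₀ + a₁ * m₁) - a₀) ∧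
      0 < l₁ * (l₀ * m₀ + l₁ * m₁ + a₀ * m₀) +
        c * (l₀ * (l₀ * m₀ + l₁ * m₁ + a₀ * m₀) - a₀) := by
    have hlin : ∀ p q : ℝ, 0 < p + e * q → ∀ᶠ c in 𝓝[>] e, 0 < p + c * q := fun p q h =>
      ((by fun_prop : Continuous fun c : ℝ => p + c * q).tendsto e).mono_left
        nhdsWithin_le_nhds |>.eventually_const_lt h
    exact (eventually_mem_nhdsWithin (s := Set.Ioi e)).and ((hlin _ _ hA).and (hlin _ _ hC))
  obtain ⟨c, hc, h3, h4⟩ := hev.exists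
  refine ⟨c, he.trans_lt hc, h3, ?_, h4⟩
  have := mul_lt_mul_of_pos_right hc hlR
  linarith

end Algebra

section Conditions

variable {lam alpha : Fin 2 → ℝ} {F : Fin 2 → Measure ℝ}
  (hlam : ∀ k, 0 < lam k) (halpha : ∀ k, 0 < alpha k) (hF : ∀ k, ClassD (F k))

include hlam halpha hF

/-- The first inequalities coincide up to a positive denominator. The numerator of the determinant
factors as `alpha 0` times the difference of the two sides of the second condition, and the sign of
the interior drift of orbit `1` then follows from both conditions. -/
lemma drift_conditions_iff :
    (lam 0 * (lam 0 * ∫ s, s ∂F 0 + lam 1 * ∫ s, s ∂F 1 + alpha 0 * ∫ s, s ∂F 0 +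
        alpha 1 * ∫ s, s ∂F 1) < alpha 0 ∧
      alpha 1 < (lam 0 * ∫ s, s ∂F 0 + lam 1 * ∫ s, s ∂F 1) * (lam 1 + alpha 1)) ↔
    drift lam alpha F ![1, 1] 0 < 0 ∧ 0 ≤ drift lam alpha F ![1, 1] 1 ∧
      0 < drift lam alpha F ![1, 1] 1 * drift lam alpha F ![0, 1] 0 -
        drift lam alpha F ![1, 1] 0 * drift lam alpha F ![0, 1] 1 := by
  have hl₀ := hlam 0
  have hl₁ := hlam 1
  have ha₀ := halpha 0
  have ha₁ := halpha 1
  have hm₀ := (hF 0).mean_pos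
  have hm₁ := (hF 1).mean_pos
  simp only [drift_eq, Matrix.cons_val_zero, Matrix.cons_val_one, zero_lt_one, lt_irrefl, if_true,
    if_false, add_zero, sub_zero]
  set m₀ := ∫ s, s ∂F 0
  set m₁ := ∫ s, s ∂F 1
  set D := lam 0 + lam 1 + alpha 0 + alpha 1
  set D' := lam 0 + lam 1 + alpha 1
  have hD : 0 < D := by positivity
  have hD' : 0 < D' := by positivity
  rw [div_lt_iff₀ hD, zero_mul, sub_neg, le_div_iff₀ hD, zero_mul, div_mul_div_comm,
    div_mul_div_comm, ← sub_div, lt_div_iff₀ (mul_pos hD hD'), zero_mul]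
  have hdet : (lam 1 * (lam 0 * m₀ + lam 1 * m₁ + alpha 0 * m₀ + alpha 1 * m₁) - alpha 1) *
      (lam 0 * (lam 0 * m₀ + lam 1 * m₁ + alpha 1 * m₁)) -
      (lam 0 * (lam 0 * m₀ + lam 1 * m₁ + alpha 0 * m₀ + alpha 1 * m₁) - alpha 0) *
      (lam 1 * (lam 0 * m₀ + lam 1 * m₁ + alpha 1 * m₁) - alpha 1) =
      alpha 0 * ((lam 0 * m₀ + lam 1 * m₁) * (lam 1 + alpha 1) - alpha 1) := by ring
  rw [hdet, mul_pos_iff_of_pos_left ha₀, sub_pos]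
  exact ⟨fun h => ⟨h.1, (second_drift_numerator_pos hl₀ hl₁ ha₀ ha₁ hm₀ hm₁ h.1 h.2).le, h.2⟩,
    fun h => ⟨h.1, h.2.2⟩⟩

/-- An empty orbit `1` only removes its retrials, and with them a positive term of the numerator;
negativity in the interior therefore extends to that face. -/
lemma drift_zero_neg (h : lam 0 * (lam 0 * ∫ s, s ∂F 0 + lam 1 * ∫ s, s ∂F 1 +
      alpha 0 * ∫ s, s ∂F 0 + alpha 1 * ∫ s, s ∂F 1) < alpha 0) (x : Orbits) (hx : 0 < x 0) :
    drift lam alpha F x 0 < 0 := by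
  have h1 : 0 < lam 0 * (alpha 1 * ∫ s, s ∂F 1) :=
    mul_pos (hlam 0) (mul_pos (halpha 1) (hF 1).mean_pos)
  have hl₀ := hlam 0
  have hl₁ := hlam 1
  have ha₀ := halpha 0
  have ha₁ := halpha 1
  simp only [drift_eq, if_pos hx]
  split_ifs
  · exact div_neg_of_neg_of_pos (by linarith) (by positivity)
  · exact div_neg_of_neg_of_pos (by linarith) (by positivity)

lemma exists_weighted_drift_pos (h1 : lam 0 * (lam 0 * ∫ s, s ∂F 0 + lam 1 * ∫ s, s ∂F 1 +
      alpha 0 * ∫ s, s ∂F 0 + alpha 1 * ∫ s, s ∂F 1) < alpha 0)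
    (h2 : alpha 1 < (lam 0 * ∫ s, s ∂F 0 + lam 1 * ∫ s, s ∂F 1) * (lam 1 + alpha 1)) :
    ∃ c > 0, ∀ x : Orbits, 0 < drift lam alpha F x 1 + c * drift lam alpha F x 0 := by
  have hl₀ := hlam 0
  have hl₁ := hlam 1
  have ha₀ := halpha 0
  have ha₁ := halpha 1
  have hm₀ := (hF 0).mean_pos
  have hm₁ := (hF 1).mean_pos
  obtain ⟨c, hc, h11, h01, h10⟩ := exists_weight hl₀ hl₁ ha₀ ha₁ hm₀ hm₁ h1 h2
  refine ⟨c, hc, fun x => ?_⟩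
  rw [drift_eq, drift_eq, mul_div_assoc', ← add_div]
  split_ifs
  · exact div_pos h11 (by positivity)
  · exact div_pos (by linarith) (by positivity)
  · exact div_pos (by linarith) (by positivity)
  -- With both orbits empty no customer can leave an orbit, so both drifts are positive and any
  -- weight works.
  · simp only [add_zero, sub_zero]; positivity

end Conditions

lemma load_eq (r : ℝ) (F : Measure ℝ) : load r F = r * ∫ s, s ∂F := by
  rw [load, serviceRate, div_div_eq_mul_div, div_one]

end Retrial

theorem theorem2 {Ω : Type*} [MeasurableSpace Ω] (P : Measure Ω) [IsProbabilityMeasure P]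
    (lam alpha : Fin 2 → ℝ) (F : Fin 2 → Measure ℝ)
    (U : Retrial.Source → Fin 2 → ℕ → Ω → ℝ)
    (hlam : ∀ k, 0 < lam k) (halpha : ∀ k, 0 < alpha k)
    (hF : ∀ k, Retrial.ClassD (F k))
    (hU : Retrial.Drives P lam alpha F U)
    (ρ ρh : Fin 2 → ℝ)
    (hρ : ∀ k, ρ k = Retrial.load (lam k) (F k))
    (hρh : ∀ k, ρh k = Retrial.load (alpha k) (F k)) :
    (ρ 0 * ((ρ 0 + ρ 1) + (ρh 0 + ρh 1)) < ρh 0 ∧ ρh 1 / (ρ 1 + ρh 1) < ρ 0 + ρ 1 →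
      Retrial.OrbitTight P U 0 ∧ Retrial.OrbitTendsToInfinity P U 1 ∧
        Retrial.EmbeddedTransient P U) ∧
    (ρ 0 * ((ρ 0 + ρ 1) + (ρh 0 + ρh 1)) < ρh 0 ∧ ρh 1 / (ρ 1 + ρh 1) < ρ 0 + ρ 1 ↔
      Retrial.CaseC2 P U) := by
  simp only [hρ, hρh, Retrial.load_eq]
  rw [Retrial.lt_load_iff (hF 0).mean_pos,
    Retrial.div_lt_load_iff (hlam 1) (halpha 1) (hF 1).mean_pos]
  refine ⟨fun ⟨h1, h2⟩ => ?_, ?_⟩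
  · have hneg := Retrial.drift_zero_neg hlam halpha hF h1
    obtain ⟨c, hc, hpos⟩ := Retrial.exists_weighted_drift_pos hlam halpha hF h1 h2
    exact ⟨Retrial.orbitTight_zero hlam halpha hF hU hneg,
      Retrial.orbitTendsToInfinity_one hlam halpha hF hU hc hneg hpos,
      Retrial.embeddedTransient_of_drift hlam halpha hF hU hpos⟩
  · rw [Retrial.caseC2_iff hlam halpha hF hU]
    exact Retrial.drift_conditions_iff hlam halpha hF
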